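/- \textbf{Setting.} Let $d\ge 1$ and let $\nu$ be a measure on $\mathbb{R}\setminus\{0\}$ with $m_2<\infty$, where $m_p=\int |z|^p\,\nu(dz)$. Let $N$ be a Poisson random measure on $\mathbb{R}^d\times(\mathbb{R}\setminus\{0\})$ of intensity $dx\,\nu(dz)$ on a probability space, $\widehat N$ its compensated version, and $L(\varphi)=\int \varphi(x)z\,\widehat N(dx,dz)$ for $\varphi\in L^2(\mathbb{R}^d)$. Write $\mathcal{F}\varphi(\xi)=\int e^{-i\xi\cdot x}\varphi(x)dx$. A function is tempered if it is measurable and $\int |f(x)|(1+|x|^2)^{-k}dx<\infty$ for some $k$. Let $\kappa:\mathbb{R}^d\to[0,\infty]$ be a tempered function satisfying Assumption A1: its Fourier transform $h=\mathcal{F}\kappa$ in $\mathcal{S}'(\mathbb{R}^d)$ is a tempered function, $|h|^2$ is tempered, and $|h|^2=\mathcal{F}f$ for some tempered $f:\mathbb{R}^d\to[0,\infty]$. Let $\mu(d\xi)=(2\pi)^{-d}|\mathcal{F}\kappa(\xi)|^2d\xi$ and $\widetilde\kappa(x)=\kappa(-x)$. The noise is $X(\varphi)=L(\varphi*\kappa)$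 for test functions $\varphi$, extended by isometry to limits of test functions for the norm $\left(\int|\mathcal{F}S|^2d\mu\right)^{1/2}$. Let $(G_t)_{t>0}$ be a family of tempered distributions on $\mathbb{R}^d$ (for instance the fundamental solution of a second-order operator $\mathcal{L}$ whose coefficients do not depend on $x$) such that: (A) each $G_t$ is a distribution with rapid decrease, i.e. $(1+|x|^2)^{k/2}G_t$ is a bounded distribution for every $k\in\mathbb{N}$; (B) $\int|\mathcal{F}G_t|^2d\mu<\infty$ for all $t>0$; (C) $\int|\mathcal{F}G_{t_n}-\mathcal{F}G_t|^2d\mu\to0$ whenever $t_n\to t>0$. A random field solution (of $\mathcal{L}v=\dot X$ with zero initial conditions) is a process with $v(t,x)=\int_0^t\int_{\mathbb{R}^d} G_{t-s}(x-y)X(dy)\,ds$ a.s., where the inner integral is replaced by a jointly measurable modification in $(\omega,s)$ whose paths are a.s. integrable on $[0,t]$. Put $J_p(t)=\|G_t*\kappa\|_{L^p(\mathbb{R}^d)}^2$, $\widetilde J_p(t)=\|G_t*\widetilde\kappa\|_{L^p(\mathbb{R}^d)}^2$ (with value $\infty$ if the convolution is not a function), and let $\|\cdot\|_p$ be the norm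 of $L^p(\Omega)$. \textbf{Moment inequality.} For every $p\ge2$ there is a constant $\mathcal{B}_p>0$ depending only on $p$ such that, with $\mathcal{C}_p=\mathcal{B}_p\max(m_2^{1/2},m_p^{1/p})$: under the assumptions above, if $m_p<\infty$, then every random field solution satisfies, for all $t>0$ and $x\in\mathbb{R}^d$, $$\|v(t,x)\|_p\le\mathcal{C}_p\int_0^t\left(\widetilde J_2(s)^{1/2}+\widetilde J_p(s)^{1/2}\right)ds .$$ If, moreover, all $G_s$ are invariant under $x\mapsto-x$, or $\kappa(-x)=\kappa(x)$ for almost every $x$, then $$\|v(t,x)\|_p\le\mathcal{C}_p\int_0^t\left(J_2(s)^{1/2}+J_p(s)^{1/2}\right)ds .$$ \textbf{Kernels.} Let $H_{d,\alpha}(x)=(2\pi\alpha)^{-d/2}e^{-|x|^2/(2\alpha)}$ and $R_{d,\alpha}(x)=\pi^{-d/2}2^{-\alpha}\frac{\Gamma((d-\alpha)/2)}{\Gamma(\alpha/2)}|x|^{-(d-\alpha)}$. In the statements below $p\ge2$, and the bounds on $J_p(t)$ hold for all $t>0$ with a constant $C$ that does not depend on $t$. The bounds on $\|v(t,x)\|_p$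 hold if $m_p<\infty$, for every random field solution $v$ of the equation in question, all $t>0$ and all $x$, with a constant $C$ depending only on $d$, $p$, $\nu$ and $\kappa$ (so the $p$-th moment is finite). Condition (D) is $\int(1+|\xi|^2)^{-1}\mu(d\xi)<\infty$. \textbf{Heat equation} $\partial_tv=\frac12\Delta v+\dot X$, with $G_t=H_{d,t}$ and $d\ge 1$. (i) If $\kappa=H_{d,\alpha/2}$, $\alpha>0$: $J_p(t)\le C(t+\alpha/2)^{-d/2}$ and $\|v(t,x)\|_p\le Ct$. (ii) If $\kappa=R_{d,\alpha/2}$, $\max(d-2,0)<\alpha<d$: $J_p(t)\le Ct^{d(\frac1p+\frac{\alpha}{2d}-1)}$. If in addition $p(2d-\alpha-4)<2d$, then $\|v(t,x)\|_p\le Ct^{\frac d2(\frac{\alpha}{2d}-1)+1}(t^{\frac d4}+t^{\frac d{2p}})$. In particular this bound holds if $d\le2$; if $d=3$ and $\alpha\ge2$; if $d=3$, $\alpha<2$ and $p<\frac{6}{2-\alpha}$; and if $d\ge4$ and $p<\frac{2d}{2d-\alpha-4}$. (iii) If $\kappa\in L^1(\mathbb{R}^d)$ satisfies Assumption A1 and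 (D): $J_p(t)\le Ct^{d(\frac1p-1)}$. If in addition $p(d-2)<d$, i.e. $d\le2$, or $d=3$ and $p<3$, then $\|v(t,x)\|_p\le Ct^{-\frac d2+1}(t^{\frac d4}+t^{\frac d{2p}})$. \textbf{Wave equation} $\partial_t^2v=\Delta v+\dot X$, with $G_t$ the fundamental solution of the wave operator, i.e. $\mathcal{F}G_t(\xi)=\frac{\sin(t|\xi|)}{|\xi|}$. (i) If $d\ge1$ and $\kappa=H_{d,\alpha/2}$, $\alpha>0$: $J_p(t)\le Ct^2$ and $\|v(t,x)\|_p\le Ct^2$. (ii) If $\kappa=R_{d,\alpha/2}$ with $0<\alpha<d$: for $d=1$, $J_p(t)\le Ct^{\frac2p+\alpha}$ and $\|v(t,x)\|_p\le Ct^{\frac\alpha2+1}(t^{\frac12}+t^{\frac1p})$; for $d=2$ and $p<\frac{4}{2-\alpha}$, $J_p(t)\le Ct^{\frac4p+\alpha-2}$ and $\|v(t,x)\|_p\le Ct^{\frac\alpha2}(t+t^{\frac2p})$. (iii) If $d=1$ and $\kappa\in L^1(\mathbb{R})$ satisfies Assumption A1 and (D): $J_p(t)\le Ct^{\frac2p}$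 and $\|v(t,x)\|_p\le Ct(t^{\frac12}+t^{\frac1p})$. -/

import Mathlib

open MeasureTheory ProbabilityTheory Filter Topology Set
open scoped ENNReal NNReal FourierTransform SchwartzMap RealInnerProductSpace

universe u

noncomputable section

namespace LevyColored

/-- The Euclidean space `ℝᵈ`. -/
abbrev Eu (d : ℕ) : Type := EuclideanSpace ℝ (Fin d)

/-! ### Translations and reflections of Schwartz functions -/

/-- The Schwartz function `z ↦ φ (-z)`. -/
def reflect {d : ℕ} (φ : 𝓢(Eu d, ℂ)) : 𝓢(Eu d, ℂ) :=
  SchwartzMap.compCLMOfContinuousLinearEquiv ℂ (ContinuousLinearEquiv.neg ℝ (M := Eu d)) φ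

/-- The Schwartz function `z ↦ φ (x + z)`. -/
def shift {d : ℕ} (x : Eu d) (φ : 𝓢(Eu d, ℂ)) : 𝓢(Eu d, ℂ) :=
  SchwartzMap.compSubConstCLM ℂ (-x) φ

theorem reflect_apply {d : ℕ} (φ : 𝓢(Eu d, ℂ)) (z : Eu d) : reflect φ z = φ (-z) := rfl

theorem shift_apply {d : ℕ} (x : Eu d) (φ : 𝓢(Eu d, ℂ)) (z : Eu d) :
    shift x φ z = φ (x + z) := by
  simp [shift, SchwartzMap.compSubConstCLM_apply, add_comm]

/-! ### Tempered functions, Fourier transforms, convolutions -/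

/-- A (nonnegative, possibly infinite) tempered function: a measurable function which is integrable
against some power of `(1 + |x|²)⁻¹`. -/
def IsTempered {d : ℕ} (f : Eu d → ℝ≥0∞) : Prop :=
  Measurable f ∧ ∃ k : ℕ, ∫⁻ x, f x * ENNReal.ofReal ((1 + ‖x‖ ^ 2) ^ (-(k : ℝ))) < ⊤

/-- The Fourier transform of the functional `T` on Schwartz functions is the function `g`, for the
convention `ℱ φ (ξ) = ∫ exp (- i ξ · x) φ x dx`. Since Mathlib's Fourier transform is
`𝓕 φ (ξ) = ∫ exp (- 2 π i ξ · x) φ x dx = ℱ φ (2 π ξ)`, the defining identity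
`T (ℱ φ) = ∫ g φ` becomes `T (𝓕 φ) = ∫ g (2 π ξ) φ ξ dξ`. -/
def HasFourier {d : ℕ} (T : 𝓢(Eu d, ℂ) → ℂ) (g : Eu d → ℂ) : Prop :=
  AEStronglyMeasurable g volume ∧ ∀ φ : 𝓢(Eu d, ℂ),
    Integrable (fun ξ => g ((2 * Real.pi) • ξ) * φ ξ) volume ∧
      T (𝓕 φ) = ∫ ξ, g ((2 * Real.pi) • ξ) * φ ξ

/-- The functional on Schwartz functions induced by a function with values in `[0, ∞]`. -/
def funPairing {d : ℕ} (κ : Eu d → ℝ≥0∞) (φ : 𝓢(Eu d, ℂ)) : ℂ :=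
  ∫ x, ((κ x).toReal : ℂ) * φ x

/-- Assumption A1 on the kernel `κ`. -/
def AssumptionA1 {d : ℕ} (κ : Eu d → ℝ≥0∞) : Prop :=
  IsTempered κ ∧
  ∃ h : Eu d → ℂ, Measurable h ∧ HasFourier (funPairing κ) h ∧
    IsTempered (fun ξ => ‖h ξ‖ₑ) ∧ IsTempered (fun ξ => ‖h ξ‖ₑ ^ 2) ∧
    ∃ f : Eu d → ℝ≥0∞, IsTempered f ∧
      HasFourier (funPairing f) (fun ξ => ((‖h ξ‖ ^ 2 : ℝ) : ℂ))

open Classical in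
/-- The Fourier transform of `κ`, when it is a function (it is then unique up to null sets). -/
def kernelFourier {d : ℕ} (κ : Eu d → ℝ≥0∞) : Eu d → ℂ :=
  if H : ∃ h : Eu d → ℂ, HasFourier (funPairing κ) h then H.choose else 0

/-- The spectral measure `μ(dξ) = (2π)⁻ᵈ |ℱ κ (ξ)|² dξ`. -/
def spectralMeasure {d : ℕ} (κ : Eu d → ℝ≥0∞) : Measure (Eu d) :=
  volume.withDensity
    (fun ξ => ENNReal.ofReal ((2 * Real.pi) ^ (-(d : ℝ))) * ‖kernelFourier κ ξ‖ₑ ^ 2)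

/-- `∫ |ℱ T (ξ)|² μ(dξ)`; the value is `∞` if `ℱ T` is not a function. All the functions `g` in the
infimum are equal almost everywhere, and give the same integral. -/
def spectralNormSq {d : ℕ} (κ : Eu d → ℝ≥0∞) (T : 𝓢(Eu d, ℂ) → ℂ) : ℝ≥0∞ :=
  ⨅ (g : Eu d → ℂ) (_ : HasFourier T g), ∫⁻ ξ, ‖g ξ‖ₑ ^ 2 ∂(spectralMeasure κ)

/-- The convolution `S * κ` of a tempered distribution with `κ` is the function `g`: one has
`⟨S * κ, φ⟩ = ⟨κ, y ↦ ⟨S, φ (y + ·)⟩⟩ = ∫ g φ` for all Schwartz functions `φ`. -/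
def HasConv {d : ℕ} (S : 𝓢'(Eu d, ℂ)) (κ : Eu d → ℝ≥0∞) (g : Eu d → ℂ) : Prop :=
  AEStronglyMeasurable g volume ∧ ∀ φ : 𝓢(Eu d, ℂ),
    Integrable (fun y => ((κ y).toReal : ℂ) * S (shift y φ)) volume ∧
    Integrable (fun y => g y * φ y) volume ∧
      ∫ y, ((κ y).toReal : ℂ) * S (shift y φ) = ∫ y, g y * φ y

/-- `‖S * κ‖` in `Lᵖ(ℝᵈ)`; the value is `∞` if `S * κ` is not a function. All the functions `g` in
the infimum are equal almost everywhere. -/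
def convNorm {d : ℕ} (S : 𝓢'(Eu d, ℂ)) (κ : Eu d → ℝ≥0∞) (p : ℝ) : ℝ≥0∞ :=
  ⨅ (g : Eu d → ℂ) (_ : HasConv S κ g), eLpNorm g (ENNReal.ofReal p) volume

/-- `J_p(t) = ‖G_t * κ‖²`, the norm being that of `Lᵖ(ℝᵈ)`. -/
def J {d : ℕ} (G : ℝ → 𝓢'(Eu d, ℂ)) (κ : Eu d → ℝ≥0∞) (p t : ℝ) : ℝ≥0∞ :=
  (convNorm (G t) κ p) ^ 2

/-- The reflected kernel `x ↦ κ (-x)`. -/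
def reflectKernel {d : ℕ} (κ : Eu d → ℝ≥0∞) : Eu d → ℝ≥0∞ := fun x => κ (-x)

/-- `S` is invariant under `x ↦ -x`. -/
def EvenDistribution {d : ℕ} (S : 𝓢'(Eu d, ℂ)) : Prop := ∀ φ, S (reflect φ) = S φ

/-! ### The hypotheses on the fundamental solution -/

/-- Distributions with rapid decrease: for every `k`, the distribution `(1 + |x|²)^(k/2) S` is
bounded, i.e. continuous for the topology of the space of smooth functions all of whose derivatives
are integrable. -/
def RapidDecrease {d : ℕ} (S : 𝓢'(Eu d, ℂ)) : Prop :=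
  ∀ k : ℕ, ∃ (C : ℝ) (m : ℕ), ∀ φ : 𝓢(Eu d, ℂ),
    ‖S (SchwartzMap.smulLeftCLM ℂ (fun x : Eu d => (1 + ‖x‖ ^ 2) ^ ((k : ℝ) / 2)) φ)‖ ≤
      C * ∑ j ∈ Finset.range (m + 1), ∫ x, ‖iteratedFDeriv ℝ j φ x‖

def HypothesisA {d : ℕ} (G : ℝ → 𝓢'(Eu d, ℂ)) : Prop := ∀ t : ℝ, 0 < t → RapidDecrease (G t)

def HypothesisB {d : ℕ} (κ : Eu d → ℝ≥0∞) (G : ℝ → 𝓢'(Eu d, ℂ)) : Prop :=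
  ∀ t : ℝ, 0 < t → spectralNormSq κ (fun φ => G t φ) < ⊤

def HypothesisC {d : ℕ} (κ : Eu d → ℝ≥0∞) (G : ℝ → 𝓢'(Eu d, ℂ)) : Prop :=
  ∀ t : ℝ, 0 < t →
    Tendsto (fun r => spectralNormSq κ (fun φ => G r φ - G t φ)) (𝓝 t) (𝓝 0)

/-- Dalang's condition (D). -/
def DalangCondition {d : ℕ} (κ : Eu d → ℝ≥0∞) : Prop :=
  ∫⁻ ξ, ENNReal.ofReal (1 / (1 + ‖ξ‖ ^ 2)) ∂(spectralMeasure κ) < ⊤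

/-! ### The noise -/

/-- `m_p = ∫ |z|ᵖ ν(dz)`. -/
def moment (ν : Measure ℝ) (p : ℝ) : ℝ≥0∞ := ∫⁻ z, ‖z‖ₑ ^ p ∂ν

/-- A measure on `ℝ \ {0}` with finite second moment. -/
def IsJumpMeasure (ν : Measure ℝ) : Prop := ν {0} = 0 ∧ moment ν 2 < ⊤

/-- `N` is a Poisson random measure of intensity `m`. -/
structure IsPoissonRandomMeasure {Z : Type} [MeasurableSpace Z] {Ω : Type u} [MeasurableSpace Ω]
    (P : Measure Ω) (m : Measure Z) (N : Ω → Measure Z) : Prop where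
  measurable : ∀ B, MeasurableSet B → Measurable (fun ω => N ω B)
  law : ∀ B, MeasurableSet B → m B < ⊤ → ∀ k : ℕ,
    P {ω | N ω B = k} =
      ENNReal.ofReal (Real.exp (-(m B).toReal) * (m B).toReal ^ k / (k.factorial : ℝ))
  infinite : ∀ B, MeasurableSet B → m B = ⊤ → ∀ᵐ ω ∂P, N ω B = ⊤
  indep : ∀ (n : ℕ) (B : Fin n → Set Z), (∀ i, MeasurableSet (B i)) →
    Pairwise (fun i j => Disjoint (B i) (B j)) → iIndepFun (fun i ω => N ω (B i)) P

/-- The integral of a simple function with respect to the compensated measure `N - m`. -/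
def simpleCompensated {Z : Type} [MeasurableSpace Z] {Ω : Type u} (m : Measure Z)
    (N : Ω → Measure Z) (f : SimpleFunc Z ℝ) (ω : Ω) : ℝ :=
  ∑ c ∈ f.range, c * ((N ω (f ⁻¹' {c})).toReal - (m (f ⁻¹' {c})).toReal)

/-- `Y` is (a version of) the integral of `f ∈ L²(m)` with respect to the compensated measure
`N - m`: the isometric extension to `L²(m)` of the integral of simple functions. -/
def IsCompensatedIntegral {Z : Type} [MeasurableSpace Z] {Ω : Type u} [MeasurableSpace Ω]
    (P : Measure Ω) (m : Measure Z) (N : Ω → Measure Z) (f : Z → ℝ) (Y : Ω → ℝ) : Prop :=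
  MemLp f 2 m ∧ AEStronglyMeasurable Y P ∧
  ∃ F : ℕ → SimpleFunc Z ℝ, (∀ n, MemLp (F n) 2 m) ∧
    Tendsto (fun n => eLpNorm (fun z => F n z - f z) 2 m) atTop (𝓝 0) ∧
    Tendsto (fun n => eLpNorm (fun ω => simpleCompensated m N (F n) ω - Y ω) 2 P) atTop (𝓝 0)

/-- The intensity `dx ν(dz)`. -/
def intensity (d : ℕ) (ν : Measure ℝ) : Measure (Eu d × ℝ) := (volume : Measure (Eu d)).prod ν

/-- `Y = L(φ)`, the integral of `φ (x) z` with respect to the compensated Poisson random measure. -/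
def IsLevyIntegral {d : ℕ} {Ω : Type u} [MeasurableSpace Ω] (P : Measure Ω) (ν : Measure ℝ)
    (N : Ω → Measure (Eu d × ℝ)) (φ : Eu d → ℝ) (Y : Ω → ℝ) : Prop :=
  IsCompensatedIntegral P (intensity d ν) N (fun q => φ q.1 * q.2) Y

/-- The function `φ * κ`. -/
def testConv {d : ℕ} (φ : Eu d → ℝ) (κ : Eu d → ℝ≥0∞) (x : Eu d) : ℝ :=
  ∫ y, φ (x - y) * (κ y).toReal

/-- `Y = ∫ S(y) X(dy)`, where `X(φ) = L(φ * κ)` for test functions `φ`, extended by isometry to the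
functionals `S` that are limits of test functions with respect to
`‖S‖₀² = ∫ |ℱ S (ξ)|² μ(dξ)`. -/
def IsNoiseIntegral {d : ℕ} {Ω : Type u} [MeasurableSpace Ω] (P : Measure Ω) (ν : Measure ℝ)
    (N : Ω → Measure (Eu d × ℝ)) (κ : Eu d → ℝ≥0∞) (S : 𝓢(Eu d, ℂ) → ℂ) (Y : Ω → ℝ) : Prop :=
  AEStronglyMeasurable Y P ∧
  ∃ (φ : ℕ → 𝓢(Eu d, ℝ)) (W : ℕ → Ω → ℝ),
    (∀ n, HasCompactSupport (φ n)) ∧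
    (∀ n, IsLevyIntegral P ν N (testConv (φ n) κ) (W n)) ∧
    Tendsto (fun n => spectralNormSq κ (fun ψ => (∫ x, ((φ n x : ℝ) : ℂ) * ψ x) - S ψ))
      atTop (𝓝 0) ∧
    Tendsto (fun n => eLpNorm (fun ω => W n ω - Y ω) 2 P) atTop (𝓝 0)

/-- `v` is the random field solution
`v(t, x) = ∫₀ᵗ ∫ G_{t-s}(x - y) X(dy) ds`: the inner integral, as a process in `s`, has a jointly
measurable modification `Y` with paths integrable over `[0, t]`, and `v(t, x)` is its
integral. -/
def IsRandomFieldSolution {d : ℕ} {Ω : Type u} [MeasurableSpace Ω] (P : Measure Ω)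
    (ν : Measure ℝ) (N : Ω → Measure (Eu d × ℝ)) (κ : Eu d → ℝ≥0∞) (G : ℝ → 𝓢'(Eu d, ℂ))
    (v : ℝ → Eu d → Ω → ℝ) : Prop :=
  ∀ t : ℝ, 0 ≤ t → ∀ x : Eu d, ∃ Y : ℝ → Ω → ℝ, Measurable (Function.uncurry Y) ∧
    (∀ s : ℝ, 0 ≤ s → s < t →
      IsNoiseIntegral P ν N κ (fun φ => G (t - s) (reflect (shift x φ))) (Y s)) ∧
    (∀ᵐ ω ∂P, IntervalIntegrable (fun s => Y s ω) volume 0 t) ∧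
    ∀ᵐ ω ∂P, v t x ω = ∫ s in (0 : ℝ)..t, Y s ω

/-- On every probability space with a Poisson random measure of intensity `dx ν(dz)`, the random
field solution satisfies `‖v(t, x)‖_p ≤ b(t)` for all `t > 0` and all `x`. -/
def SolutionMomentBound {d : ℕ} (ν : Measure ℝ) (κ : Eu d → ℝ≥0∞) (G : ℝ → 𝓢'(Eu d, ℂ)) (p : ℝ)
    (b : ℝ → ℝ≥0∞) : Prop :=
  ∀ (Ω : Type u) [MeasurableSpace Ω] (P : Measure Ω) [IsProbabilityMeasure P]
    (N : Ω → Measure (Eu d × ℝ)), IsPoissonRandomMeasure P (intensity d ν) N →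
  ∀ v : ℝ → Eu d → Ω → ℝ, IsRandomFieldSolution P ν N κ G v →
  ∀ t : ℝ, 0 < t → ∀ x : Eu d, eLpNorm (v t x) (ENNReal.ofReal p) P ≤ b t

/-! ### The kernels and the fundamental solutions -/

/-- `H_{d,α}(x) = (2πα)^{-d/2} exp (-|x|²/(2α))`. -/
def heatKernel (d : ℕ) (α : ℝ) (x : Eu d) : ℝ :=
  (2 * Real.pi * α) ^ (-(d : ℝ) / 2) * Real.exp (-‖x‖ ^ 2 / (2 * α))

/-- The heat kernel as a coloration kernel. -/
def heatColor (d : ℕ) (α : ℝ) (x : Eu d) : ℝ≥0∞ := ENNReal.ofReal (heatKernel d α x)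

/-- `R_{d,α}(x) = π^{-d/2} 2^{-α} Γ((d-α)/2) / Γ(α/2) |x|^{-(d-α)}`. -/
def rieszColor (d : ℕ) (α : ℝ) (x : Eu d) : ℝ≥0∞ :=
  ENNReal.ofReal (Real.pi ^ (-(d : ℝ) / 2) * 2 ^ (-α) * Real.Gamma ((d - α) / 2) /
    Real.Gamma (α / 2)) * ‖x‖ₑ ^ (-(d - α))

theorem heatKernel_memLp (d : ℕ) {t : ℝ} (ht : 0 < t) :
    MemLp (fun x : Eu d => ((heatKernel d t x : ℝ) : ℂ)) ⊤ volume := by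
  refine memLp_top_of_bound ?_ ((2 * Real.pi * t) ^ (-(d : ℝ) / 2)) (ae_of_all _ fun x => ?_)
  · unfold heatKernel
    exact (by fun_prop : Continuous _).aestronglyMeasurable
  · have h1 : 0 ≤ (2 * Real.pi * t) ^ (-(d : ℝ) / 2) := by positivity
    have h2 : Real.exp (-‖x‖ ^ 2 / (2 * t)) ≤ 1 := by
      rw [Real.exp_le_one_iff]
      exact div_nonpos_of_nonpos_of_nonneg (by simp) (by positivity)
    rw [Complex.norm_real, heatKernel, Real.norm_of_nonneg (by positivity)]
    exact mul_le_of_le_one_right h1 h2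

/-- The fundamental solution of the heat operator `∂ₜ - Δ/2`: the distribution induced by the
density `(2πt)^{-d/2} exp (-|x|²/(2t))`, for `t > 0`. -/
def heatG (d : ℕ) (t : ℝ) : 𝓢'(Eu d, ℂ) :=
  if ht : 0 < t then Lp.toTemperedDistribution (heatKernel_memLp d ht).toLp else 0

theorem waveSymbol_memLp (d : ℕ) (t : ℝ) :
    MemLp (fun ξ : Eu d => ((t * Real.sinc (t * (2 * Real.pi * ‖ξ‖)) : ℝ) : ℂ)) ⊤ volume := by
  refine memLp_top_of_bound ?_ |t| (ae_of_all _ fun x => ?_)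
  · have := Real.continuous_sinc
    exact (by fun_prop : Continuous _).aestronglyMeasurable
  · rw [Complex.norm_real, Real.norm_eq_abs, abs_mul]
    exact mul_le_of_le_one_right (abs_nonneg _) (Real.abs_sinc_le_one _)

/-- The fundamental solution of the wave operator `∂ₜ² - Δ` in any dimension: the tempered
distribution whose Fourier transform, for the convention `∫ exp (- i ξ · x) φ x dx`, is
`sin (t |ξ|) / |ξ|`, the solution of `y'' = - |ξ|² y`, `y 0 = 0`, `y' 0 = 1`. In Mathlib's
convention, this is `sin (2 π t |ξ|) / (2 π |ξ|)`; recall that `sinc a = sin a / a`. -/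
def waveG (d : ℕ) (t : ℝ) : 𝓢'(Eu d, ℂ) :=
  𝓕⁻ (Lp.toTemperedDistribution (waveSymbol_memLp d t).toLp)

end LevyColored

end

namespace LevyColored

/-! ### Moments of Poisson variables -/

/-! The moment inequality combines three facts. First, Minkowski's integral inequality bounds the
norm of `v t x` in `L^p(Ω)` by the integral over `s` of the norms of the noise integrals of
`G_{t-s}(x - ·)`. Second, such a noise integral is the Lévy integral of the function `y ↦ (G_{t-s} *
κ̃)(x - y)`. Third, compensated Poisson integrals satisfy `‖∫ f dN̂‖_p ≤ B_p (‖f‖_2 + ‖f‖_p)`. For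
`f(y, z) = g(y) z` the norms on the right factor into `m_q^{1/q} ‖g‖_q`, and translation and
reflection do not change `‖g‖_q`. If the convolution is not a function, or not in `L² ∩ L^p`, the
right side is infinite.

The Poisson inequality (`exists_eLpNorm_compensatedIntegral_le`) is proved first for simple
functions. Their integral is a sum of independent centred Poisson variables times the levels, so
Rosenthal's inequality (`rosenthal`) applies. The `p`-th absolute moment of a centred Poisson
variable of parameter `r` is at most `C (r + r^{p/2})`: the first term sums to `‖F‖_p^p`, the second
is dominated by `‖F‖_2^p`. The isometry and Fatou's lemma give the general case, with a constant
that depends on `p` alone.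

The identification of the noise integral (`IsNoiseIntegral.isLevyIntegral`) is the delicate point.
If test functions `φ_n` approach `S` in the spectral norm, the variables `L(φ_n * κ)` converge in
`L²(Ω)`, hence `φ_n * κ` converges in `L²(ℝᵈ)`. The limit must be shown to be `S * κ`. Tested
against `𝓕 ψ` with `ψ` compactly supported, `(φ_n - S) * κ` becomes `∫ ℱκ · ℱ(φ_n - S) · ψ`, which
Cauchy–Schwarz bounds by the spectral norm times `‖ψ‖_2`. This needs the convolution theorem for a
product of two functions that need not be smooth (`integral_mul_shift_fourier`). It holds once `ℱS`
is locally bounded, which follows from rapid decrease (`RapidDecrease.hasLocallyBoundedFourier`) and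
is checked directly for the heat and wave kernels.

The bounds on `J_p` come from Young's inequality (`lintegral_convolution_rpow_le`) and scaling. The
heat densities, and the wave densities in dimensions one and two, are self-similar. For Riesz
kernels homogeneity then gives the exact power of `t` (`convLp_scale`), and it remains to see that
the norm is finite at `t = 1`, by cutting the kernel at the unit sphere. For the wave equation with
Gaussian colour no density is needed: `|sin(t|ξ|)/|ξ|| ≤ t` bounds `G_t * κ` in `L^∞` and in `L²`
through its Fourier transform (`exists_J_waveG_le`). Integrating `J_2^{1/2} + J_p^{1/2}` in time
gives the moment bounds. -/

theorem map_eq_map_poissonMeasure {Ω : Type*} [MeasurableSpace Ω] {P : Measure Ω}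
    [IsProbabilityMeasure P] {X : Ω → ℝ≥0∞} (hX : Measurable X) {r : ℝ≥0}
    (h : ∀ k : ℕ, P {ω | X ω = k} =
      ENNReal.ofReal (Real.exp (-(r : ℝ)) * (r : ℝ) ^ k / (k.factorial : ℝ))) :
    P.map X = (poissonMeasure r).map (Nat.cast : ℕ → ℝ≥0∞) := by
  have : IsProbabilityMeasure (P.map X) := Measure.isProbabilityMeasure_map hX.aemeasurable
  symm
  -- Between probability measures one inequality is enough, and it only involves the atoms at the
  -- integers. The value `∞` thereby gets mass zero.
  refine Measure.eq_of_le_of_isProbabilityMeasure ?_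
  refine Measure.le_iff.2 fun s hs => ?_
  rw [Measure.map_apply (by fun_prop) hs, Measure.map_apply hX hs]
  set A : Set ℕ := (Nat.cast : ℕ → ℝ≥0∞) ⁻¹' s
  calc poissonMeasure r A = ∑' k : A, poissonMeasure r {(k : ℕ)} := by
        rw [← measure_biUnion (to_countable A)]
        · simp
        · intro i _ j _ hij
          simpa using hij
        · intro i _
          measurability
    _ = ∑' k : A, P {ω | X ω = ((k : ℕ) : ℝ≥0∞)} := by
        congr 1
        ext k
        rw [h, poissonMeasure_singleton]
    _ = P (⋃ k ∈ A, {ω | X ω = ((k : ℕ) : ℝ≥0∞)}) := by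
        rw [measure_biUnion (to_countable A)]
        · intro i _ j _ hij
          refine Set.disjoint_left.2 fun ω h1 h2 => hij ?_
          have : ((i : ℕ) : ℝ≥0∞) = j := h1.symm.trans h2
          exact_mod_cast this
        · intro i _
          exact hX (measurableSet_singleton _)
    _ ≤ P (X ⁻¹' s) := by
        refine measure_mono ?_
        intro ω hω
        simp only [mem_iUnion] at hω
        obtain ⟨k, hk, h1⟩ := hω
        change X ω ∈ s
        rw [show X ω = k from h1]
        exact hk

theorem hasSum_exp_poissonMeasure (r : ℝ≥0) (θ : ℝ) :
    HasSum (fun n : ℕ => Real.exp (-r) * (r : ℝ) ^ n / (n.factorial : ℝ) * Real.exp (θ * n))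
      (Real.exp (r * (Real.exp θ - 1))) := by
  have h := (NormedSpace.expSeries_div_hasSum_exp ((r : ℝ) * Real.exp θ)).mul_left
    (Real.exp (-(r : ℝ)))
  rw [← Real.exp_eq_exp_ℝ, ← Real.exp_add] at h
  convert! h using 1
  · ext n
    rw [mul_pow, ← Real.exp_nat_mul, mul_comm θ]
    ring
  · congr 1
    ring

/-- `X` has the exponential moments of a centred Poisson variable with parameter `r`. -/
structure IsCentredPoisson {Ω : Type*} [MeasurableSpace Ω] (P : Measure Ω) (r : ℝ)
    (X : Ω → ℝ) : Prop where
  integrable_exp : ∀ θ : ℝ, Integrable (fun ω => Real.exp (θ * X ω)) P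
  integral_exp : ∀ θ : ℝ, ∫ ω, Real.exp (θ * X ω) ∂P = Real.exp (r * (Real.exp θ - 1 - θ))

theorem isCentredPoisson_of_law {Ω : Type*} [MeasurableSpace Ω] {P : Measure Ω}
    [IsProbabilityMeasure P] {X : Ω → ℝ≥0∞} (hX : Measurable X) {r : ℝ≥0}
    (h : ∀ k : ℕ, P {ω | X ω = k} =
      ENNReal.ofReal (Real.exp (-(r : ℝ)) * (r : ℝ) ^ k / (k.factorial : ℝ))) :
    IsCentredPoisson P r (fun ω => (X ω).toReal - r) := by
  have hmap := map_eq_map_poissonMeasure hX h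
  have key : ∀ θ : ℝ, Integrable (fun n : ℕ => Real.exp (θ * ((n : ℝ) - r))) (poissonMeasure r) ∧
      ∫ n, Real.exp (θ * ((n : ℝ) - r)) ∂(poissonMeasure r) =
        Real.exp (r * (Real.exp θ - 1 - θ)) := by
    intro θ
    have hs := (hasSum_exp_poissonMeasure r θ).mul_right (Real.exp (-θ * r))
    have he : ∀ n : ℕ, Real.exp (-r) * (r : ℝ) ^ n / (n.factorial : ℝ) * Real.exp (θ * n) *
        Real.exp (-θ * r) =
        (Real.exp (-r) * (r : ℝ) ^ n / (n.factorial : ℝ)) * Real.exp (θ * ((n : ℝ) - r)) := by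
      intro n
      rw [mul_assoc, ← Real.exp_add]
      ring_nf
    simp_rw [he] at hs
    have hint : Integrable (fun n : ℕ => Real.exp (θ * ((n : ℝ) - r))) (poissonMeasure r) := by
      rw [integrable_poissonMeasure_iff]
      simpa [Real.norm_eq_abs, Real.abs_exp] using hs.summable
    refine ⟨hint, ?_⟩
    have h2 := hasSum_integral_poissonMeasure hint
    rw [h2.unique hs, ← Real.exp_add]
    congr 1
    ring
  have hg : ∀ θ : ℝ, Measurable (fun x : ℝ≥0∞ => Real.exp (θ * (x.toReal - r))) := by
    intro θ
    fun_prop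
  have hcast : Measurable (Nat.cast : ℕ → ℝ≥0∞) := by fun_prop
  constructor
  · intro θ
    have h1 : Integrable (fun x : ℝ≥0∞ => Real.exp (θ * (x.toReal - r))) (P.map X) := by
      rw [hmap, integrable_map_measure (hg θ).aestronglyMeasurable hcast.aemeasurable]
      simpa [Function.comp_def] using (key θ).1
    exact (integrable_map_measure (hg θ).aestronglyMeasurable hX.aemeasurable).1 h1
  · intro θ
    rw [← (key θ).2]
    have h1 := integral_map (μ := P) hX.aemeasurable (hg θ).aestronglyMeasurable
    rw [← h1, hmap, integral_map hcast.aemeasurable (hg θ).aestronglyMeasurable]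
    simp

namespace IsCentredPoisson

variable {Ω : Type*} [MeasurableSpace Ω] {P : Measure Ω} {r : ℝ} {X : Ω → ℝ}

theorem zero_mem_interior (hX : IsCentredPoisson P r X) : 0 ∈ interior (integrableExpSet X P) := by
  have : integrableExpSet X P = univ := eq_univ_of_forall fun θ => hX.integrable_exp θ
  simp [this]

theorem memLp (hX : IsCentredPoisson P r X) (p : ℝ≥0) : MemLp X p P :=
  memLp_of_mem_interior_integrableExpSet hX.zero_mem_interior p

theorem mgf_eq (hX : IsCentredPoisson P r X) :
    mgf X P = fun θ => Real.exp (r * (Real.exp θ - 1 - θ)) := by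
  ext θ
  exact hX.integral_exp θ

theorem hasDerivAt_mgf (hX : IsCentredPoisson P r X) (θ : ℝ) :
    HasDerivAt (mgf X P) (Real.exp (r * (Real.exp θ - 1 - θ)) * (r * (Real.exp θ - 1))) θ := by
  rw [hX.mgf_eq]
  exact ((((Real.hasDerivAt_exp θ).sub_const 1).sub (hasDerivAt_id θ)).const_mul r).exp

theorem integral_eq_zero (hX : IsCentredPoisson P r X) : ∫ ω, X ω ∂P = 0 := by
  have h := deriv_mgf_zero hX.zero_mem_interior
  rw [(hX.hasDerivAt_mgf 0).deriv] at h
  simpa using h.symm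

theorem integral_sq (hX : IsCentredPoisson P r X) : ∫ ω, X ω ^ 2 ∂P = r := by
  have h := iteratedDeriv_mgf_zero hX.zero_mem_interior 2
  rw [iteratedDeriv_succ, iteratedDeriv_one] at h
  have h1 : deriv (mgf X P) = fun θ =>
      Real.exp (r * (Real.exp θ - 1 - θ)) * (r * (Real.exp θ - 1)) := by
    ext θ
    exact (hX.hasDerivAt_mgf θ).deriv
  rw [h1] at h
  have h2 : HasDerivAt (fun θ => Real.exp (r * (Real.exp θ - 1 - θ)) * (r * (Real.exp θ - 1))) r
      0 := by
    have h3 := ((((Real.hasDerivAt_exp 0).sub_const 1).sub (hasDerivAt_id 0)).const_mul r).exp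
    have h4 := ((Real.hasDerivAt_exp 0).sub_const 1).const_mul r
    convert! h3.mul h4 using 1
    simp
  rw [h2.deriv] at h
  exact h.symm

/-- Chernoff's method with `θ = r^{-1/2}`, the inverse of the standard deviation: since `|e^η - 1 -
η| ≤ η²` for `|η| ≤ 1`, the exponential moments at `±θ` are at most `e`, while `|x|^p ≤ (p√r)^p
e^{θ|x|}`. -/
theorem integral_abs_rpow_le_of_one_le (hX : IsCentredPoisson P r X) {p : ℝ} (hp : 2 ≤ p)
    (hr : 1 ≤ r) : ∫ ω, |X ω| ^ p ∂P ≤ 2 * Real.exp 1 * p ^ p * r ^ (p / 2) := by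
  have hs : 0 < √r := Real.sqrt_pos.2 (by linarith)
  set θ : ℝ := 1 / √r with hθ
  have hθ0 : 0 < θ := by positivity
  have hθ1 : θ ≤ 1 := by
    rw [hθ, div_le_one hs]
    exact Real.one_le_sqrt.2 hr
  have hrθ : r * θ ^ 2 = 1 := by
    rw [hθ, div_pow, Real.sq_sqrt (by linarith)]
    field_simp
  have hb : ∀ η : ℝ, |η| = θ → ∫ ω, Real.exp (η * X ω) ∂P ≤ Real.exp 1 := by
    intro η hη
    rw [hX.integral_exp, Real.exp_le_exp]
    have h1 := Real.abs_exp_sub_one_sub_id_le (x := η) (hη ▸ hθ1)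
    have h2 := (abs_le.1 h1).2
    have h3 : η ^ 2 = θ ^ 2 := by rw [← hη, sq_abs]
    rw [h3] at h2
    nlinarith
  have hpt : ∀ x : ℝ, |x| ^ p ≤ (p * √r) ^ p * (Real.exp (θ * x) + Real.exp (-θ * x)) := by
    intro x
    have h1 := rpow_abs_le_mul_exp_abs x (t := θ) (p := p) (by linarith) hθ0.ne'
    have h2 : p / |θ| = p * √r := by
      rw [abs_of_pos hθ0, hθ]
      field_simp
    rw [h2] at h1
    refine h1.trans (mul_le_mul_of_nonneg_left ?_ (by positivity))
    rcases abs_cases (x) with ⟨h3, _⟩ | ⟨h3, _⟩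
    · rw [abs_of_pos hθ0, h3]
      linarith [Real.exp_pos (-θ * x)]
    · rw [abs_of_pos hθ0, h3]
      have : θ * -x = -θ * x := by ring
      rw [this]
      linarith [Real.exp_pos (θ * x)]
  calc ∫ ω, |X ω| ^ p ∂P
      ≤ ∫ ω, (p * √r) ^ p * (Real.exp (θ * X ω) + Real.exp (-θ * X ω)) ∂P :=
        integral_mono_of_nonneg (ae_of_all _ fun ω => by positivity)
          (((hX.integrable_exp _).add (hX.integrable_exp _)).const_mul _)
          (ae_of_all _ fun ω => hpt _)
    _ ≤ (p * √r) ^ p * (Real.exp 1 + Real.exp 1) := by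
        rw [integral_const_mul, integral_add (hX.integrable_exp _) (hX.integrable_exp _)]
        refine mul_le_mul_of_nonneg_left (add_le_add (hb _ (abs_of_pos hθ0)) (hb _ ?_))
          (by positivity)
        rw [abs_neg, abs_of_pos hθ0]
    _ = 2 * Real.exp 1 * p ^ p * r ^ (p / 2) := by
        rw [Real.mul_rpow (by linarith) hs.le, Real.sqrt_eq_rpow, ← Real.rpow_mul (by linarith)]
        ring_nf

/-- For small `r` the moment must be bounded linearly in `r`, so `|x|^p` is compared with `2 cosh x
- 2`, whose expectation vanishes with `r`. It dominates `x²`, which suffices for `|x| ≤ 1`, and it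
is comparable to `e^{|x|}` elsewhere. -/
theorem abs_rpow_le_cosh {p : ℝ} (hp : 2 ≤ p) (x : ℝ) :
    |x| ^ p ≤ (1 + 4 * p ^ p) * (Real.exp (1 * x) + Real.exp (-1 * x) - 2) := by
  have hsym : Real.exp (1 * x) + Real.exp (-1 * x) = Real.exp |x| + Real.exp (-|x|) := by
    rcases abs_cases x with ⟨h, _⟩ | ⟨h, _⟩ <;> rw [h]
    · simp
    · simp [add_comm]
  have hpp : 0 ≤ p ^ p := by positivity
  rw [hsym]
  set y := |x| with hy
  have hy0 : 0 ≤ y := abs_nonneg x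
  have hcosh : y ^ 2 ≤ Real.exp y + Real.exp (-y) - 2 := by
    have h1 : y / 2 ≤ Real.sinh (y / 2) := Real.self_le_sinh_iff.2 (by positivity)
    have h2 := Real.cosh_sq (y / 2)
    have h3 := Real.cosh_two_mul (y / 2)
    rw [mul_div_cancel₀ y two_ne_zero, Real.cosh_eq] at h3
    nlinarith
  rcases le_total y 1 with h1 | h1
  · have h2 : y ^ p ≤ y ^ (2 : ℝ) := Real.rpow_le_rpow_of_exponent_ge' hy0 h1 (by norm_num) hp
    rw [Real.rpow_two] at h2
    nlinarith [sq_nonneg y]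
  · have h2 := rpow_abs_le_mul_exp_abs x (t := 1) (p := p) (by linarith) one_ne_zero
    simp only [abs_one, div_one, one_mul] at h2
    have h3 : Real.exp 1 ≤ Real.exp y := Real.exp_le_exp.2 h1
    have h4 := Real.exp_one_gt_d9
    have h5 := Real.exp_pos (-y)
    -- The factor `4` is admissible because `e > 8/3`.
    have h6 : Real.exp y ≤ 4 * (Real.exp y + Real.exp (-y) - 2) := by nlinarith
    rw [← hy] at h2
    nlinarith [sq_nonneg y]

theorem integral_abs_rpow_le_of_le_one [IsProbabilityMeasure P] (hX : IsCentredPoisson P r X)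
    {p : ℝ} (hp : 2 ≤ p)
    (hr0 : 0 ≤ r) (hr : r ≤ 1) : ∫ ω, |X ω| ^ p ∂P ≤ 4 * (1 + 4 * p ^ p) * r := by
  have hpp : 0 ≤ p ^ p := by positivity
  have hb : ∀ η : ℝ, |η| = 1 → ∫ ω, Real.exp (η * X ω) ∂P ≤ 1 + 2 * r := by
    intro η hη
    rw [hX.integral_exp]
    have h1 := Real.abs_exp_sub_one_sub_id_le (x := η) hη.le
    have h3 : η ^ 2 = 1 := by rw [← sq_abs, hη]; norm_num
    rw [h3] at h1
    have h4 : 0 ≤ Real.exp η - 1 - η := by linarith [Real.add_one_le_exp η]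
    rw [abs_of_nonneg h4] at h1
    set w := Real.exp η - 1 - η
    have h5 : r * w ≤ r := mul_le_of_le_one_right hr0 h1
    have h6 : 0 ≤ r * w := mul_nonneg hr0 h4
    have h7 := Real.abs_exp_sub_one_sub_id_le (x := r * w) (by rw [abs_of_nonneg h6]; linarith)
    have h8 := (abs_le.1 h7).2
    nlinarith
  calc ∫ ω, |X ω| ^ p ∂P
      ≤ ∫ ω, (1 + 4 * p ^ p) * (Real.exp (1 * X ω) + Real.exp (-1 * X ω) - 2) ∂P :=
        integral_mono_of_nonneg (ae_of_all _ fun ω => by positivity)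
          ((((hX.integrable_exp _).add (hX.integrable_exp _)).sub (integrable_const _)).const_mul _)
          (ae_of_all _ fun ω => abs_rpow_le_cosh hp _)
    _ ≤ (1 + 4 * p ^ p) * ((1 + 2 * r) + (1 + 2 * r) - 2) := by
        have hadd : Integrable (fun ω => Real.exp (1 * X ω) + Real.exp (-1 * X ω)) P :=
          (hX.integrable_exp _).add (hX.integrable_exp _)
        rw [integral_const_mul, integral_sub hadd (integrable_const _),
          integral_add (hX.integrable_exp _) (hX.integrable_exp _)]
        refine mul_le_mul_of_nonneg_left ?_ (by positivity)
        simp only [integral_const, probReal_univ, one_smul]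
        have h1 := hb 1 (by simp)
        have h2 := hb (-1) (by simp)
        linarith
    _ = _ := by ring

end IsCentredPoisson

theorem exists_integral_abs_rpow_le {p : ℝ} (hp : 2 ≤ p) : ∃ C : ℝ, 0 < C ∧
    ∀ (Ω : Type u) [MeasurableSpace Ω] (P : Measure Ω) [IsProbabilityMeasure P] (r : ℝ)
      (X : Ω → ℝ), 0 ≤ r → IsCentredPoisson P r X →
      ∫ ω, |X ω| ^ p ∂P ≤ C * (r + r ^ (p / 2)) := by
  have hpp : 0 ≤ p ^ p := by positivity
  have he := Real.exp_pos 1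
  refine ⟨4 * (1 + 4 * p ^ p) + 2 * Real.exp 1 * p ^ p, by positivity, ?_⟩
  intro Ω _ P _ r X hr hX
  have hr2 : 0 ≤ r ^ (p / 2) := by positivity
  have h1 : 0 ≤ 2 * Real.exp 1 * p ^ p := by positivity
  have h2 : 0 ≤ 4 * (1 + 4 * p ^ p) := by positivity
  rcases le_total r 1 with h | h
  · have := hX.integral_abs_rpow_le_of_le_one hp hr h
    nlinarith [mul_nonneg h1 hr, mul_nonneg h1 hr2, mul_nonneg h2 hr2]
  · have := hX.integral_abs_rpow_le_of_one_le hp h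
    nlinarith [mul_nonneg h1 hr, mul_nonneg h2 hr, mul_nonneg h2 hr2]

end LevyColored

namespace LevyColored

/-! ### Rosenthal's inequality -/

/-- A second-order Taylor bound obtained from Bernoulli's inequality alone. At the point `-u/(1+u)`
it yields `(1+u)^q ≤ 1 + q u (1+u)^{q-1}`; the factor `(1+u)^{p-1} - 1` is then estimated in the
same way for `u ≥ 0` and by Bernoulli at `u` for `u ≤ 0`. -/
theorem one_add_rpow_le {p u : ℝ} (hp : 2 ≤ p) (h1 : -(1 / 2) < u) (h2 : u < 1 / 2) :
    (1 + u) ^ p ≤ 1 + p * u + p * (p * 2 ^ p) * u ^ 2 := by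
  have hv : 0 < 1 + u := by linarith
  have tangent : ∀ q : ℝ, 1 ≤ q → (1 + u) ^ q ≤ 1 + q * u * (1 + u) ^ (q - 1) := by
    intro q hq
    have h := one_add_mul_self_le_rpow_one_add (s := -u / (1 + u)) (p := q)
      (by rw [le_div_iff₀ hv]; linarith) hq
    have h3 : 1 + -u / (1 + u) = (1 + u)⁻¹ := by field_simp; ring
    have hV : 0 < (1 + u) ^ q := by positivity
    rw [h3, Real.inv_rpow hv.le] at h
    have h4 := mul_le_mul_of_nonneg_right h hV.le
    rw [inv_mul_cancel₀ hV.ne'] at h4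
    have h5 : (1 + u) ^ (q - 1) = (1 + u) ^ q / (1 + u) := by
      rw [Real.rpow_sub hv, Real.rpow_one]
    rw [h5]
    have h6 : (1 + q * (-u / (1 + u))) * (1 + u) ^ q =
        (1 + u) ^ q - q * u * ((1 + u) ^ q / (1 + u)) := by ring
    linarith
  have h2p : (1 : ℝ) ≤ 2 ^ p := Real.one_le_rpow (by norm_num) (by linarith)
  have key : u * ((1 + u) ^ (p - 1) - 1) ≤ p * 2 ^ p * u ^ 2 := by
    rcases le_total 0 u with h | h
    · have h3 := tangent (p - 1) (by linarith)
      have h4 : (1 + u) ^ (p - 1 - 1) ≤ 2 ^ p :=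
        (Real.rpow_le_rpow hv.le (by linarith : 1 + u ≤ 2) (by linarith)).trans
          (Real.rpow_le_rpow_of_exponent_le (by norm_num) (by linarith))
      have h5 : (p - 1) * u * (1 + u) ^ (p - 1 - 1) ≤ p * u * 2 ^ p := by
        gcongr
        linarith
      calc u * ((1 + u) ^ (p - 1) - 1) ≤ u * (p * u * 2 ^ p) :=
            mul_le_mul_of_nonneg_left (by linarith) h
        _ = _ := by ring
    · have h3 := one_add_mul_self_le_rpow_one_add (s := u) (p := p - 1) (by linarith) (by linarith)
      have h4 : u * ((1 + u) ^ (p - 1) - 1) ≤ u * ((p - 1) * u) :=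
        mul_le_mul_of_nonpos_left (by linarith) h
      nlinarith [sq_nonneg u, mul_nonneg (sq_nonneg u) (by linarith : 0 ≤ p)]
  have h3 := tangent p (by linarith)
  have h4 := mul_le_mul_of_nonneg_left key (by linarith : 0 ≤ p)
  nlinarith

/-- The constant in the expansion of `|s + x| ^ p`. -/
noncomputable def expansionConst (p : ℝ) : ℝ := p * (p * 2 ^ p) + 3 ^ p + 2 * p

theorem one_le_expansionConst {p : ℝ} (hp : 2 ≤ p) : 1 ≤ expansionConst p := by
  have h3 : (1 : ℝ) ≤ 3 ^ p := Real.one_le_rpow (by norm_num) (by linarith)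
  have : 0 ≤ p * (p * 2 ^ p) := by positivity
  unfold expansionConst
  linarith

theorem abs_one_add_rpow_le {p : ℝ} (hp : 2 ≤ p) (u : ℝ) :
    |1 + u| ^ p ≤ 1 + p * u + expansionConst p * (u ^ 2 + |u| ^ p) := by
  have h3 : (0 : ℝ) ≤ 3 ^ p := by positivity
  have h2 : 0 ≤ p * (p * 2 ^ p) := by positivity
  have hup : 0 ≤ |u| ^ p := by positivity
  unfold expansionConst
  rcases lt_or_ge |u| (1 / 2) with h | h
  · obtain ⟨ha, hb⟩ := abs_lt.1 h
    rw [abs_of_pos (by linarith : 0 < 1 + u)]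
    have := one_add_rpow_le hp ha hb
    nlinarith [sq_nonneg u, mul_nonneg h2 hup, mul_nonneg h3 hup, mul_nonneg h3 (sq_nonneg u),
      mul_nonneg (by linarith : 0 ≤ p) (sq_nonneg u), mul_nonneg (by linarith : 0 ≤ p) hup]
  · have h4 : |1 + u| ≤ 3 * |u| := by
      have := abs_add_le 1 u
      rw [abs_one] at this
      linarith
    have h5 : |1 + u| ^ p ≤ 3 ^ p * |u| ^ p := by
      rw [← Real.mul_rpow (by norm_num) (abs_nonneg _)]
      exact Real.rpow_le_rpow (abs_nonneg _) h4 (by linarith)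
    have h6 : -u ≤ 2 * u ^ 2 := by
      have := neg_abs_le u
      rw [← sq_abs u]
      nlinarith
    have h7 := mul_le_mul_of_nonneg_left h6 (by linarith : 0 ≤ p)
    nlinarith [sq_nonneg u, mul_nonneg h2 hup, mul_nonneg h2 (sq_nonneg u),
      mul_nonneg h3 (sq_nonneg u), mul_nonneg (by linarith : 0 ≤ p) hup]

/-- The previous expansion at `u = x / s`, made homogeneous. The first-order term is kept exactly,
because it has mean zero when `x` is a centred variable independent of `s`. -/
theorem abs_add_rpow_le {p : ℝ} (hp : 2 ≤ p) (s x : ℝ) :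
    |s + x| ^ p ≤ |s| ^ p + p * (|s| ^ (p - 2) * s * x) +
      expansionConst p * (|s| ^ (p - 2) * x ^ 2 + |x| ^ p) := by
  rcases eq_or_ne s 0 with rfl | hs
  · have h1 := one_le_expansionConst hp
    have h2 : (0 : ℝ) ≤ 0 ^ (p - 2) := Real.zero_rpow_nonneg _
    have h3 : 0 ≤ |x| ^ p := by positivity
    have h4 : (0 : ℝ) ^ p = 0 := Real.zero_rpow (by linarith)
    simp only [zero_add, abs_zero, h4, mul_zero, zero_mul]
    nlinarith [mul_nonneg h2 (sq_nonneg x)]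
  · have h := mul_le_mul_of_nonneg_left (abs_one_add_rpow_le hp (x / s))
      (by positivity : 0 ≤ |s| ^ p)
    have hs0 : 0 < |s| := abs_pos.2 hs
    have e1 : |s| ^ p * |1 + x / s| ^ p = |s + x| ^ p := by
      rw [← Real.mul_rpow (abs_nonneg _) (abs_nonneg _), ← abs_mul]
      congr 2
      field_simp
    have e2 : |s| ^ p = |s| ^ (p - 2) * s ^ 2 := by
      rw [← sq_abs s, ← Real.rpow_two, ← Real.rpow_add hs0]
      ring_nf
    have e3 : |s| ^ p * |x / s| ^ p = |x| ^ p := by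
      rw [← Real.mul_rpow (abs_nonneg _) (abs_nonneg _), ← abs_mul]
      congr 2
      field_simp
    rw [e1] at h
    calc |s + x| ^ p ≤ |s| ^ p * (1 + p * (x / s) +
          expansionConst p * ((x / s) ^ 2 + |x / s| ^ p)) := h
      _ = |s| ^ p + p * (|s| ^ p * (x / s)) +
          expansionConst p * (|s| ^ p * (x / s) ^ 2 + |s| ^ p * |x / s| ^ p) := by ring
      _ = _ := by
        rw [e3, e2]
        field_simp

section Rosenthal

variable {Ω : Type*} [MeasurableSpace Ω] {P : Measure Ω} [IsProbabilityMeasure P]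

theorem integrable_abs_rpow_of_le {p q : ℝ} {S : Ω → ℝ} (hS : Measurable S)
    (hint : Integrable (fun ω => |S ω| ^ p) P) (hq : 0 ≤ q) (hqp : q ≤ p) :
    Integrable (fun ω => |S ω| ^ q) P := by
  refine ((integrable_const (1 : ℝ)).add hint).mono' (by fun_prop) (ae_of_all _ fun ω => ?_)
  rw [Real.norm_of_nonneg (by positivity)]
  simp only [Pi.add_apply]
  have h0 : 0 ≤ |S ω| ^ p := by positivity
  rcases le_total |S ω| 1 with h | h
  · have := Real.rpow_le_one (abs_nonneg _) h hq
    linarith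
  · have := Real.rpow_le_rpow_of_exponent_le h hqp
    linarith

/-- The effect of one more independent summand: by independence the linear term of the expansion
vanishes and the quadratic term factors. -/
theorem integral_abs_add_rpow_le {p : ℝ} (hp : 2 ≤ p) {S X : Ω → ℝ} (hS : Measurable S)
    (hX : Measurable X) (hind : IndepFun S X P) (hSi : Integrable (fun ω => |S ω| ^ p) P)
    (hXi : Integrable (fun ω => |X ω| ^ p) P) (hX0 : ∫ ω, X ω ∂P = 0) :
    Integrable (fun ω => |S ω + X ω| ^ p) P ∧
    ∫ ω, |S ω + X ω| ^ p ∂P ≤ ∫ ω, |S ω| ^ p ∂P + expansionConst p *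
      ((∫ ω, |S ω| ^ p ∂P) ^ ((p - 2) / p) * ∫ ω, X ω ^ 2 ∂P + ∫ ω, |X ω| ^ p ∂P) := by
  have hX1 : Integrable X P := by
    have := integrable_abs_rpow_of_le hX hXi (q := 1) (by norm_num) (by linarith)
    simp only [Real.rpow_one] at this
    exact (integrable_norm_iff hX.aestronglyMeasurable).1 this
  have hX2 : Integrable (fun ω => X ω ^ 2) P := by
    have := integrable_abs_rpow_of_le hX hXi (q := 2) (by norm_num) hp
    simpa only [Real.rpow_two, sq_abs] using this
  have hS1 : Integrable (fun ω => |S ω| ^ (p - 2)) P :=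
    integrable_abs_rpow_of_le hS hSi (by linarith) (by linarith)
  have hS2 : Integrable (fun ω => |S ω| ^ (p - 2) * S ω) P := by
    refine (integrable_abs_rpow_of_le hS hSi (q := p - 1) (by linarith) (by linarith)).mono'
      (by fun_prop) (ae_of_all _ fun ω => ?_)
    rw [norm_mul, Real.norm_of_nonneg (by positivity), Real.norm_eq_abs]
    rcases eq_or_ne (S ω) 0 with h | h
    · rw [h]
      simp only [abs_zero, mul_zero]
      exact Real.zero_rpow_nonneg _
    · rw [← Real.rpow_add_one (abs_ne_zero.2 h)]
      ring_nf
      rfl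
  have hi1 : IndepFun (fun ω => |S ω| ^ (p - 2) * S ω) X P :=
    hind.comp (φ := fun s : ℝ => |s| ^ (p - 2) * s) (ψ := id) (by fun_prop) measurable_id
  have hi2 : IndepFun (fun ω => |S ω| ^ (p - 2)) (fun ω => X ω ^ 2) P :=
    hind.comp (φ := fun s : ℝ => |s| ^ (p - 2)) (ψ := fun x : ℝ => x ^ 2) (by fun_prop)
      (by fun_prop)
  have hm1 : Integrable (fun ω => |S ω| ^ (p - 2) * S ω * X ω) P := hi1.integrable_mul hS2 hX1
  have hm2 : Integrable (fun ω => |S ω| ^ (p - 2) * X ω ^ 2) P := hi2.integrable_mul hS1 hX2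
  have he1 : ∫ ω, |S ω| ^ (p - 2) * S ω * X ω ∂P = 0 := by
    have := hi1.integral_mul_eq_mul_integral hS2.aestronglyMeasurable hX1.aestronglyMeasurable
    rw [hX0, mul_zero] at this
    exact this
  have he2 : ∫ ω, |S ω| ^ (p - 2) * X ω ^ 2 ∂P =
      (∫ ω, |S ω| ^ (p - 2) ∂P) * ∫ ω, X ω ^ 2 ∂P :=
    hi2.integral_mul_eq_mul_integral hS1.aestronglyMeasurable hX2.aestronglyMeasurable
  -- Jensen's inequality for the concave power `(p - 2) / p`.
  have hJ : ∫ ω, |S ω| ^ (p - 2) ∂P ≤ (∫ ω, |S ω| ^ p ∂P) ^ ((p - 2) / p) := by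
    have hq0 : 0 ≤ (p - 2) / p := div_nonneg (by linarith) (by linarith)
    have hq1 : (p - 2) / p ≤ 1 := by
      rw [div_le_one (by linarith)]
      linarith
    have hcomp : ((fun x : ℝ => x ^ ((p - 2) / p)) ∘ fun ω => |S ω| ^ p) =
        fun ω => |S ω| ^ (p - 2) := by
      ext ω
      simp only [Function.comp_apply]
      rw [← Real.rpow_mul (abs_nonneg _)]
      congr 1
      field_simp
    have := (Real.concaveOn_rpow hq0 hq1).le_map_integral (μ := P)
      (Real.continuous_rpow_const hq0).continuousOn isClosed_Ici
      (ae_of_all _ fun ω => (by positivity : 0 ≤ |S ω| ^ p)) hSi (by rw [hcomp]; exact hS1)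
    calc ∫ ω, |S ω| ^ (p - 2) ∂P = ∫ ω, (|S ω| ^ p) ^ ((p - 2) / p) ∂P := by
          rw [← hcomp]
          rfl
      _ ≤ _ := this
  have hc := one_le_expansionConst hp
  have hbi : Integrable (fun ω => |S ω| ^ p + p * (|S ω| ^ (p - 2) * S ω * X ω) +
      expansionConst p * (|S ω| ^ (p - 2) * X ω ^ 2 + |X ω| ^ p)) P :=
    (hSi.add (hm1.const_mul _)).add ((hm2.add hXi).const_mul _)
  have hSX : Measurable (fun ω => |S ω + X ω| ^ p) := by fun_prop
  refine ⟨hbi.mono' hSX.aestronglyMeasurable (ae_of_all _ fun ω => ?_), ?_⟩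
  · rw [Real.norm_of_nonneg (by positivity)]
    exact abs_add_rpow_le hp _ _
  calc ∫ ω, |S ω + X ω| ^ p ∂P
      ≤ ∫ ω, |S ω| ^ p + p * (|S ω| ^ (p - 2) * S ω * X ω) +
          expansionConst p * (|S ω| ^ (p - 2) * X ω ^ 2 + |X ω| ^ p) ∂P :=
        integral_mono_of_nonneg (ae_of_all _ fun ω => by positivity) hbi
          (ae_of_all _ fun ω => abs_add_rpow_le hp _ _)
    _ = ∫ ω, |S ω| ^ p ∂P + expansionConst p *
          ((∫ ω, |S ω| ^ (p - 2) ∂P) * ∫ ω, X ω ^ 2 ∂P + ∫ ω, |X ω| ^ p ∂P) := by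
        have ha : Integrable (fun ω => |S ω| ^ p + p * (|S ω| ^ (p - 2) * S ω * X ω)) P :=
          hSi.add (hm1.const_mul _)
        have hb : Integrable (fun ω => expansionConst p *
            (|S ω| ^ (p - 2) * X ω ^ 2 + |X ω| ^ p)) P := (hm2.add hXi).const_mul _
        rw [integral_add ha hb, integral_add hSi (hm1.const_mul _), integral_const_mul, integral_const_mul,
          integral_add hm2 hXi, he1, he2, mul_zero, add_zero]
    _ ≤ _ := by
        have h2 : 0 ≤ ∫ ω, X ω ^ 2 ∂P := integral_nonneg fun ω => sq_nonneg _
        gcongr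

/-- Absorption: either `W` is the larger term, or `M ≤ 2A M^{1-2/p} V`, and dividing by `M^{1-2/p}`
leaves `M^{2/p} ≤ 2AV`. -/
theorem le_of_le_rpow_mul {p M A V W : ℝ} (hp : 2 ≤ p) (hM : 0 ≤ M) (hA : 0 < A) (hV : 0 ≤ V)
    (hW : 0 ≤ W) (h : M ≤ A * (M ^ ((p - 2) / p) * V + W)) :
    M ≤ ((2 * A) ^ (p / 2) + 2 * A) * (V ^ (p / 2) + W) := by
  have hV2 : 0 ≤ V ^ (p / 2) := by positivity
  have hA2 : 0 ≤ (2 * A) ^ (p / 2) := by positivity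
  rcases le_total (M ^ ((p - 2) / p) * V) W with h1 | h1
  · nlinarith [mul_nonneg hA2 hV2, mul_nonneg hA2 hW, mul_nonneg hA.le hV2]
  · rcases hM.eq_or_lt with h0 | h0
    · rw [← h0]
      positivity
    have h2 : M ≤ 2 * A * (M ^ ((p - 2) / p) * V) := by nlinarith
    have h3 : M = M ^ ((p - 2) / p) * M ^ (2 / p) := by
      rw [← Real.rpow_add h0]
      have : (p - 2) / p + 2 / p = 1 := by field_simp; ring
      rw [this, Real.rpow_one]
    have h4 : 0 < M ^ ((p - 2) / p) := by positivity
    have h5 : M ^ (2 / p) ≤ 2 * A * V := by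
      refine le_of_mul_le_mul_left ?_ h4
      calc M ^ ((p - 2) / p) * M ^ (2 / p) = M := h3.symm
        _ ≤ _ := by linarith
    have h6 : M ≤ (2 * A * V) ^ (p / 2) := by
      have := Real.rpow_le_rpow (by positivity) h5 (by linarith : 0 ≤ p / 2)
      rw [← Real.rpow_mul hM] at this
      have h7 : 2 / p * (p / 2) = 1 := by field_simp
      rwa [h7, Real.rpow_one] at this
    rw [Real.mul_rpow (by positivity) hV] at h6
    nlinarith [mul_nonneg hA2 hW, mul_nonneg hA.le hV2, mul_nonneg hA.le hW]

/-- **Rosenthal's inequality** for sums of independent centred random variables. -/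
theorem rosenthal {p : ℝ} (hp : 2 ≤ p) {ι : Type*} {X : ι → Ω → ℝ} (hX : ∀ i, Measurable (X i))
    (hind : iIndepFun X P) (hXi : ∀ i, Integrable (fun ω => |X i ω| ^ p) P)
    (hX0 : ∀ i, ∫ ω, X i ω ∂P = 0) (s : Finset ι) :
    ∫ ω, |∑ i ∈ s, X i ω| ^ p ∂P ≤
      ((2 * expansionConst p) ^ (p / 2) + 2 * expansionConst p) *
        ((∑ i ∈ s, ∫ ω, X i ω ^ 2 ∂P) ^ (p / 2) + ∑ i ∈ s, ∫ ω, |X i ω| ^ p ∂P) := by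
  classical
  -- `M` is the largest moment among all subsums rather than that of the full sum. It therefore
  -- controls every partial sum met in the induction, and the resulting inequality for `M` closes on
  -- itself.
  obtain ⟨s₀, hs₀, hmax⟩ := Finset.exists_max_image s.powerset
    (fun t => ∫ ω, |∑ i ∈ t, X i ω| ^ p ∂P) ⟨s, by simp⟩
  set M := ∫ ω, |∑ i ∈ s₀, X i ω| ^ p ∂P with hM
  have hc := one_le_expansionConst hp
  have hM0 : 0 ≤ M := integral_nonneg fun ω => by positivity
  have hV : ∀ i, 0 ≤ ∫ ω, X i ω ^ 2 ∂P := fun i => integral_nonneg fun ω => sq_nonneg _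
  have hW : ∀ i, 0 ≤ ∫ ω, |X i ω| ^ p ∂P := fun i => integral_nonneg fun ω => by positivity
  have key : ∀ t : Finset ι, t ⊆ s → Integrable (fun ω => |∑ i ∈ t, X i ω| ^ p) P ∧
      ∫ ω, |∑ i ∈ t, X i ω| ^ p ∂P ≤ ∑ i ∈ t, expansionConst p *
        (M ^ ((p - 2) / p) * ∫ ω, X i ω ^ 2 ∂P + ∫ ω, |X i ω| ^ p ∂P) := by
    intro t
    induction t using Finset.induction_on with
    | empty =>
      intro _
      have : (0 : ℝ) ^ p = 0 := Real.zero_rpow (by linarith)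
      simp [this]
    | insert a t ha ih =>
      intro hts
      obtain ⟨h1, h2⟩ := ih ((Finset.subset_insert a t).trans hts)
      have hi : IndepFun (fun ω => ∑ i ∈ t, X i ω) (X a) P := by
        have := hind.indepFun_finsetSum_of_notMem hX ha
        convert! this using 1
        ext ω
        simp
      have h3 := integral_abs_add_rpow_le hp (S := fun ω => ∑ i ∈ t, X i ω)
        (Finset.measurable_sum _ fun i _ => hX i) (hX a) hi h1 (hXi a) (hX0 a)
      have h4 : ∀ ω, ∑ i ∈ insert a t, X i ω = ∑ i ∈ t, X i ω + X a ω := by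
        intro ω
        rw [Finset.sum_insert ha, add_comm]
      simp_rw [h4]
      refine ⟨h3.1, h3.2.trans ?_⟩
      rw [Finset.sum_insert ha, add_comm]
      have h5 : ∫ ω, |∑ i ∈ t, X i ω| ^ p ∂P ≤ M :=
        hmax t (Finset.mem_powerset.2 ((Finset.subset_insert a t).trans hts))
      have h6 : 0 ≤ ∫ ω, |∑ i ∈ t, X i ω| ^ p ∂P := integral_nonneg fun ω => by positivity
      have h7 : 0 ≤ (p - 2) / p := div_nonneg (by linarith) (by linarith)
      have h8 := hV a
      gcongr
  have h1 := (key s₀ (Finset.mem_powerset.1 hs₀)).2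
  have h2 : M ≤ expansionConst p * (M ^ ((p - 2) / p) * (∑ i ∈ s, ∫ ω, X i ω ^ 2 ∂P) +
      ∑ i ∈ s, ∫ ω, |X i ω| ^ p ∂P) := by
    refine h1.trans ?_
    rw [← Finset.mul_sum, Finset.mul_sum s, ← Finset.sum_add_distrib]
    refine mul_le_mul_of_nonneg_left ?_ (by linarith)
    refine Finset.sum_le_sum_of_subset_of_nonneg (Finset.mem_powerset.1 hs₀) fun i _ _ => ?_
    have := hV i
    have := hW i
    positivity
  refine (hmax s (by simp)).trans ?_
  exact le_of_le_rpow_mul hp hM0 (by linarith) (Finset.sum_nonneg fun i _ => hV i)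
    (Finset.sum_nonneg fun i _ => hW i) h2

end Rosenthal

end LevyColored

namespace LevyColored

/-! ### Compensated integrals of simple functions -/

section LevelSum

variable {Z : Type*} [MeasurableSpace Z]

/-- `∫ |F| ^ q dm` for a simple function `F`. -/
noncomputable def levelSum (m : Measure Z) (F : SimpleFunc Z ℝ) (q : ℝ) : ℝ :=
  ∑ c ∈ F.range, |c| ^ q * (m (F ⁻¹' {c})).toReal

theorem levelSum_nonneg (m : Measure Z) (F : SimpleFunc Z ℝ) (q : ℝ) : 0 ≤ levelSum m F q :=
  Finset.sum_nonneg fun c _ => by positivity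

theorem eLpNorm_simpleFunc {m : Measure Z} {F : SimpleFunc Z ℝ} (hF : MemLp F 2 m) {q : ℝ}
    (hq : 0 < q) : eLpNorm F (ENNReal.ofReal q) m = ENNReal.ofReal (levelSum m F q ^ (1 / q)) := by
  have hfin : ∀ c : ℝ, c ≠ 0 → m (F ⁻¹' {c}) < ⊤ :=
    SimpleFunc.measure_preimage_lt_top_of_memLp two_ne_zero ENNReal.ofNat_ne_top F hF
  have h1 : ∫⁻ z, ‖F z‖ₑ ^ q ∂m = ENNReal.ofReal (levelSum m F q) := by
    have h2 := SimpleFunc.map_lintegral (μ := m) (fun c : ℝ => ‖c‖ₑ ^ q) F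
    rw [← SimpleFunc.lintegral_eq_lintegral] at h2
    simp only [SimpleFunc.coe_map, Function.comp_def] at h2
    rw [h2, levelSum, ENNReal.ofReal_sum_of_nonneg fun c _ => by positivity]
    refine Finset.sum_congr rfl fun c _ => ?_
    -- Only the level `0` can have infinite measure; there `toReal` returns `0`, harmlessly, since
    -- `|0|^q = 0`.
    rcases eq_or_ne c 0 with rfl | hc
    · simp [hq, hq.ne']
    · rw [ENNReal.ofReal_mul (by positivity), ENNReal.ofReal_toReal (hfin c hc).ne,
        ← ENNReal.ofReal_rpow_of_nonneg (abs_nonneg c) hq.le, ← Real.norm_eq_abs,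
        ofReal_norm]
  rw [eLpNorm_eq_lintegral_rpow_enorm_toReal (by simpa using hq) ENNReal.ofReal_ne_top,
    ENNReal.toReal_ofReal hq.le, h1, ENNReal.ofReal_rpow_of_nonneg (levelSum_nonneg _ _ _)
    (by positivity)]

/-- With `a_c = c² m(F = c)` this is the inclusion of `ℓ¹` in `ℓ^{p/2}`: each `a_c` is at most the
total, so `a_c^{p/2}` is at most `a_c` times the total to the power `p/2 - 1`. -/
theorem levelSum_two_rpow {m : Measure Z} (F : SimpleFunc Z ℝ) {p : ℝ} (hp : 2 ≤ p) :
    ∑ c ∈ F.range, |c| ^ p * (m (F ⁻¹' {c})).toReal ^ (p / 2) ≤ levelSum m F 2 ^ (p / 2) := by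
  set a : ℝ → ℝ := fun c => |c| ^ (2 : ℝ) * (m (F ⁻¹' {c})).toReal with ha
  have ha0 : ∀ c, 0 ≤ a c := fun c => by positivity
  have h1 : ∀ c ∈ F.range, |c| ^ p * (m (F ⁻¹' {c})).toReal ^ (p / 2) ≤
      a c * levelSum m F 2 ^ (p / 2 - 1) := by
    intro c hc
    have h2 : |c| ^ p * (m (F ⁻¹' {c})).toReal ^ (p / 2) = a c ^ (p / 2) := by
      rw [ha, Real.mul_rpow (by positivity) (by positivity), ← Real.rpow_mul (abs_nonneg _)]
      congr 2
      ring
    rw [h2]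
    rcases (ha0 c).eq_or_lt with h | h
    · rw [← h, Real.zero_rpow (by linarith), zero_mul]
    · have h3 : a c ^ (p / 2) = a c * a c ^ (p / 2 - 1) := by
        rw [Real.rpow_sub h, Real.rpow_one]
        field_simp
      rw [h3]
      refine mul_le_mul_of_nonneg_left (Real.rpow_le_rpow h.le ?_ (by linarith)) h.le
      exact Finset.single_le_sum (f := a) (fun c _ => ha0 c) hc
  refine (Finset.sum_le_sum h1).trans ?_
  rw [← Finset.sum_mul]
  change levelSum m F 2 * _ ≤ _
  rcases (levelSum_nonneg m F 2).eq_or_lt with h | h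
  · rw [← h, zero_mul]
    exact Real.zero_rpow_nonneg _
  · rw [Real.rpow_sub h, Real.rpow_one]
    field_simp
    exact le_rfl

end LevelSum

section Compensated

/-- The contribution of the level `c` to the compensated integral of `F`. -/
noncomputable def levelTerm {Z : Type} [MeasurableSpace Z] {Ω : Type u} (m : Measure Z) (N : Ω → Measure Z) (F : SimpleFunc Z ℝ) (c : ℝ)
    (ω : Ω) : ℝ :=
  c * ((N ω (F ⁻¹' {c})).toReal - (m (F ⁻¹' {c})).toReal)

theorem simpleCompensated_eq_sum {Z : Type} [MeasurableSpace Z] {Ω : Type u} (m : Measure Z) (N : Ω → Measure Z) (F : SimpleFunc Z ℝ) (ω : Ω) :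
    simpleCompensated m N F ω = ∑ c : F.range, levelTerm m N F c ω :=
  (Finset.sum_coe_sort F.range fun c => levelTerm m N F c ω).symm

variable {Z : Type} [MeasurableSpace Z] {Ω : Type u} {mΩ : MeasurableSpace Ω} {P : Measure Ω}
  {m : Measure Z} {N : Ω → Measure Z}

theorem measurable_levelTerm (hN : IsPoissonRandomMeasure P m N) (F : SimpleFunc Z ℝ) (c : ℝ) :
    Measurable (levelTerm m N F c) :=
  (((hN.measurable _ (F.measurableSet_fiber c)).ennreal_toReal).sub_const _).const_mul _

theorem iIndepFun_levelTerm (hN : IsPoissonRandomMeasure P m N) (F : SimpleFunc Z ℝ) :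
    iIndepFun (fun c : F.range => levelTerm m N F c) P := by
  let e := F.range.equivFin
  have h := hN.indep F.range.card (fun i => F ⁻¹' {((e.symm i : F.range) : ℝ)})
    (fun i => F.measurableSet_fiber _) (by
      intro i j hij
      refine Set.disjoint_left.2 fun z h1 h2 => hij ?_
      have : ((e.symm i : F.range) : ℝ) = e.symm j := h1.symm.trans h2
      exact e.symm.injective (Subtype.ext this))
  have h2 := (h.precomp e.injective).comp
    (fun (c : F.range) (x : ℝ≥0∞) => (c : ℝ) * (x.toReal - (m (F ⁻¹' {(c : ℝ)})).toReal))
    (fun c => by fun_prop)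
  simp only [Equiv.symm_apply_apply] at h2
  exact h2

variable [IsProbabilityMeasure P]

theorem isCentredPoisson_compensated (hN : IsPoissonRandomMeasure P m N) {B : Set Z}
    (hB : MeasurableSet B) (hm : m B < ⊤) :
    IsCentredPoisson P (m B).toReal (fun ω => (N ω B).toReal - (m B).toReal) := by
  have h := isCentredPoisson_of_law (r := (m B).toNNReal) (hN.measurable B hB)
    (fun k => hN.law B hB hm k)
  exact h

theorem memLp_levelTerm (hN : IsPoissonRandomMeasure P m N) {F : SimpleFunc Z ℝ}
    (hF : MemLp F 2 m) (c : ℝ) (q : ℝ≥0) : MemLp (levelTerm m N F c) q P := by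
  rcases eq_or_ne c 0 with rfl | hc
  · have : levelTerm m N F 0 = fun _ => 0 := by
      ext ω
      simp [levelTerm]
    rw [this]
    exact MemLp.zero'
  · have hfin := SimpleFunc.measure_preimage_lt_top_of_memLp two_ne_zero ENNReal.ofNat_ne_top F
      hF c hc
    exact ((isCentredPoisson_compensated hN (F.measurableSet_fiber c) hfin).memLp q).const_mul c

theorem integral_levelTerm (hN : IsPoissonRandomMeasure P m N) {F : SimpleFunc Z ℝ}
    (hF : MemLp F 2 m) (c : ℝ) : ∫ ω, levelTerm m N F c ω ∂P = 0 := by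
  unfold levelTerm
  rcases eq_or_ne c 0 with rfl | hc
  · simp
  · have hfin := SimpleFunc.measure_preimage_lt_top_of_memLp two_ne_zero ENNReal.ofNat_ne_top F
      hF c hc
    rw [integral_const_mul,
      (isCentredPoisson_compensated hN (F.measurableSet_fiber c) hfin).integral_eq_zero, mul_zero]

theorem integral_levelTerm_sq (hN : IsPoissonRandomMeasure P m N) {F : SimpleFunc Z ℝ}
    (hF : MemLp F 2 m) (c : ℝ) :
    ∫ ω, levelTerm m N F c ω ^ 2 ∂P = |c| ^ (2 : ℝ) * (m (F ⁻¹' {c})).toReal := by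
  unfold levelTerm
  rcases eq_or_ne c 0 with rfl | hc
  · simp
  · have hfin := SimpleFunc.measure_preimage_lt_top_of_memLp two_ne_zero ENNReal.ofNat_ne_top F
      hF c hc
    simp_rw [mul_pow]
    rw [integral_const_mul,
      (isCentredPoisson_compensated hN (F.measurableSet_fiber c) hfin).integral_sq, Real.rpow_two,
      sq_abs]

theorem memLp_simpleCompensated (hN : IsPoissonRandomMeasure P m N) {F : SimpleFunc Z ℝ}
    (hF : MemLp F 2 m) (q : ℝ≥0) : MemLp (simpleCompensated m N F) q P := by
  have : simpleCompensated m N F = fun ω => ∑ c : F.range, levelTerm m N F c ω := by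
    ext ω
    exact simpleCompensated_eq_sum m N F ω
  rw [this]
  exact memLp_finsetSum _ fun c _ => memLp_levelTerm hN hF c q

theorem integral_simpleCompensated_sq (hN : IsPoissonRandomMeasure P m N) {F : SimpleFunc Z ℝ}
    (hF : MemLp F 2 m) : ∫ ω, simpleCompensated m N F ω ^ 2 ∂P = levelSum m F 2 := by
  have h2 : ∀ c : F.range, MemLp (levelTerm m N F c) 2 P := fun c => memLp_levelTerm hN hF c 2
  have hv := IndepFun.variance_sum (s := Finset.univ) (X := fun c : F.range => levelTerm m N F c)
    (fun c _ => h2 c) (fun i _ j _ hij => (iIndepFun_levelTerm hN F).indepFun hij)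
  have h0 : ∫ ω, ∑ c : F.range, levelTerm m N F c ω ∂P = 0 := by
    rw [integral_finsetSum _ fun c _ => (h2 c).integrable (by norm_num)]
    exact Finset.sum_eq_zero fun c _ => integral_levelTerm hN hF c
  rw [variance_of_integral_eq_zero (by
    exact Finset.aemeasurable_sum _ fun c _ => (measurable_levelTerm hN F c).aemeasurable)
    (by simpa using h0)] at hv
  simp_rw [simpleCompensated_eq_sum]
  simp only [Finset.sum_apply] at hv
  rw [hv, levelSum, ← Finset.sum_coe_sort F.range fun c =>
    |c| ^ (2 : ℝ) * (m (F ⁻¹' {c})).toReal]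
  refine Finset.sum_congr rfl fun c _ => ?_
  rw [variance_of_integral_eq_zero (measurable_levelTerm hN F c).aemeasurable
    (integral_levelTerm hN hF c), integral_levelTerm_sq hN hF]

theorem eLpNorm_simpleCompensated_two (hN : IsPoissonRandomMeasure P m N) {F : SimpleFunc Z ℝ}
    (hF : MemLp F 2 m) : eLpNorm (simpleCompensated m N F) 2 P = eLpNorm F 2 m := by
  have h1 := eLpNorm_simpleFunc hF (q := 2) two_pos
  have h2 := (memLp_simpleCompensated hN hF 2).eLpNorm_eq_integral_rpow_norm
    (by norm_num) (by norm_num)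
  simp only [ENNReal.ofReal_ofNat] at h1
  simp only [ENNReal.coe_ofNat, ENNReal.toReal_ofNat, Real.rpow_two, Real.norm_eq_abs,
    sq_abs] at h2
  rw [h1, h2, integral_simpleCompensated_sq hN hF, one_div]

end Compensated

/-- Rosenthal's inequality for the independent level terms. Their variances add up to `‖F‖_2²`.
Their `p`-th moments contribute `‖F‖_p^p` and the sum of `|c|^p m(F = c)^{p/2}`, which
`levelSum_two_rpow` absorbs into `‖F‖_2^p`. -/
theorem exists_eLpNorm_simpleCompensated_le {p : ℝ} (hp : 2 ≤ p) : ∃ B : ℝ, 0 < B ∧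
    ∀ (Z : Type) [MeasurableSpace Z] (Ω : Type u) [MeasurableSpace Ω] (P : Measure Ω)
      [IsProbabilityMeasure P] (m : Measure Z) (N : Ω → Measure Z), IsPoissonRandomMeasure P m N →
      ∀ F : SimpleFunc Z ℝ, MemLp F 2 m →
      eLpNorm (simpleCompensated m N F) (ENNReal.ofReal p) P ≤
        ENNReal.ofReal B * (eLpNorm F 2 m + eLpNorm F (ENNReal.ofReal p) m) := by
  obtain ⟨C, hC, hCm⟩ := exists_integral_abs_rpow_le.{u} hp
  set K := (2 * expansionConst p) ^ (p / 2) + 2 * expansionConst p with hK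
  have hc := one_le_expansionConst hp
  have hK0 : 0 < K := by positivity
  refine ⟨(K * (1 + C)) ^ (1 / p), by positivity, ?_⟩
  intro Z _ Ω _ P _ m N hN F hF
  have hp0 : 0 < p := by linarith
  have hfin : ∀ c : ℝ, c ≠ 0 → m (F ⁻¹' {c}) < ⊤ :=
    SimpleFunc.measure_preimage_lt_top_of_memLp two_ne_zero ENNReal.ofNat_ne_top F hF
  have hmem : ∀ c : ℝ, MemLp (levelTerm m N F c) (ENNReal.ofReal p) P := fun c =>
    memLp_levelTerm hN hF c p.toNNReal
  have hint : ∀ c : ℝ, Integrable (fun ω => |levelTerm m N F c ω| ^ p) P := by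
    intro c
    have := (hmem c).integrable_norm_rpow (by simpa using hp0) ENNReal.ofReal_ne_top
    simpa [ENNReal.toReal_ofReal hp0.le] using this
  have hros := rosenthal hp (X := fun c : F.range => levelTerm m N F c)
    (fun c => measurable_levelTerm hN F c) (iIndepFun_levelTerm hN F) (fun c => hint c)
    (fun c => integral_levelTerm hN hF c) Finset.univ
  have hV : ∑ c : F.range, ∫ ω, levelTerm m N F c ω ^ 2 ∂P = levelSum m F 2 := by
    rw [levelSum, ← Finset.sum_coe_sort F.range fun c =>
      |c| ^ (2 : ℝ) * (m (F ⁻¹' {c})).toReal]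
    exact Finset.sum_congr rfl fun c _ => integral_levelTerm_sq hN hF c
  have hW : ∑ c : F.range, ∫ ω, |levelTerm m N F c ω| ^ p ∂P ≤
      C * (levelSum m F p + levelSum m F 2 ^ (p / 2)) := by
    calc ∑ c : F.range, ∫ ω, |levelTerm m N F c ω| ^ p ∂P
        ≤ ∑ c : F.range, C * (|(c : ℝ)| ^ p * (m (F ⁻¹' {(c : ℝ)})).toReal +
            |(c : ℝ)| ^ p * (m (F ⁻¹' {(c : ℝ)})).toReal ^ (p / 2)) := by
          refine Finset.sum_le_sum fun c _ => ?_
          rcases eq_or_ne (c : ℝ) 0 with h0 | h0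
          · simp [levelTerm, h0, Real.zero_rpow hp0.ne']
          · have h1 := hCm Ω P _ _ ENNReal.toReal_nonneg
              (isCentredPoisson_compensated hN (F.measurableSet_fiber (c : ℝ)) (hfin c h0))
            have h2 : ∀ ω, |levelTerm m N F c ω| ^ p = |(c : ℝ)| ^ p *
                |(N ω (F ⁻¹' {(c : ℝ)})).toReal - (m (F ⁻¹' {(c : ℝ)})).toReal| ^ p := by
              intro ω
              rw [levelTerm, abs_mul, Real.mul_rpow (abs_nonneg _) (abs_nonneg _)]
            simp_rw [h2]
            rw [integral_const_mul]
            have := mul_le_mul_of_nonneg_left h1 (by positivity : 0 ≤ |(c : ℝ)| ^ p)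
            linarith
      _ = C * (levelSum m F p +
            ∑ c ∈ F.range, |c| ^ p * (m (F ⁻¹' {c})).toReal ^ (p / 2)) := by
          rw [← Finset.mul_sum, Finset.sum_add_distrib, levelSum,
            ← Finset.sum_coe_sort F.range fun c => |c| ^ p * (m (F ⁻¹' {c})).toReal,
            ← Finset.sum_coe_sort F.range fun c => |c| ^ p * (m (F ⁻¹' {c})).toReal ^ (p / 2)]
      _ ≤ _ := by
          have := levelSum_two_rpow (m := m) F hp
          gcongr
  set V := levelSum m F 2 with hVdef
  set W := levelSum m F p with hWdef
  have hV0 : 0 ≤ V := levelSum_nonneg _ _ _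
  have hW0 : 0 ≤ W := levelSum_nonneg _ _ _
  have hVp : 0 ≤ V ^ (p / 2) := by positivity
  rw [hV] at hros
  have h1 : ∫ ω, |simpleCompensated m N F ω| ^ p ∂P ≤ K * (1 + C) * (V ^ (p / 2) + W) := by
    simp_rw [simpleCompensated_eq_sum]
    refine hros.trans ?_
    calc K * (V ^ (p / 2) + ∑ c : F.range, ∫ ω, |levelTerm m N F c ω| ^ p ∂P)
        ≤ K * (V ^ (p / 2) + C * (W + V ^ (p / 2))) := by gcongr
      _ ≤ K * ((1 + C) * (V ^ (p / 2) + W)) := by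
          refine mul_le_mul_of_nonneg_left ?_ hK0.le
          nlinarith
      _ = _ := by ring
  have h2 := (memLp_simpleCompensated hN hF p.toNNReal).eLpNorm_eq_integral_rpow_norm
    (by simpa using hp0) (by norm_num)
  change eLpNorm (simpleCompensated m N F) (ENNReal.ofReal p) P = _ at h2
  have h3 : ((p.toNNReal : ℝ≥0∞)).toReal = p := ENNReal.toReal_ofReal hp0.le
  rw [h3] at h2
  have h4 := eLpNorm_simpleFunc hF (q := 2) two_pos
  simp only [ENNReal.ofReal_ofNat] at h4
  rw [h2, h4, eLpNorm_simpleFunc hF hp0, ← ENNReal.ofReal_add (by positivity) (by positivity),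
    ← ENNReal.ofReal_mul (by positivity)]
  refine ENNReal.ofReal_le_ofReal ?_
  have hi : 1 / p ≤ 1 := by
    rw [div_le_one hp0]
    linarith
  calc (∫ ω, ‖simpleCompensated m N F ω‖ ^ p ∂P) ^ p⁻¹
      ≤ (K * (1 + C) * (V ^ (p / 2) + W)) ^ p⁻¹ :=
        Real.rpow_le_rpow (integral_nonneg fun ω => by positivity) h1 (by positivity)
    _ = (K * (1 + C)) ^ (1 / p) * (V ^ (p / 2) + W) ^ (1 / p) := by
        rw [Real.mul_rpow (by positivity) (by positivity), one_div]
    _ ≤ (K * (1 + C)) ^ (1 / p) * ((V ^ (p / 2)) ^ (1 / p) + W ^ (1 / p)) := by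
        refine mul_le_mul_of_nonneg_left ?_ (by positivity)
        exact Real.rpow_add_le_add_rpow hVp hW0 (by positivity) hi
    _ = _ := by
        rw [← Real.rpow_mul hV0]
        have : p / 2 * (1 / p) = 1 / 2 := by field_simp
        rw [this]

end LevyColored

namespace LevyColored

/-! ### Compensated integrals of square integrable functions -/

theorem eLpNorm_fun_sub_comm {α : Type*} [MeasurableSpace α] {μ : Measure α} {p : ℝ≥0∞}
    {E : Type*} [NormedAddCommGroup E] (a b : α → E) :
    eLpNorm (fun x => a x - b x) p μ = eLpNorm (fun x => b x - a x) p μ :=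
  eLpNorm_sub_comm a b p μ

theorem eLpNorm_sub_le_three {α : Type*} [MeasurableSpace α] {μ : Measure α} {p : ℝ≥0∞}
    (hp : 1 ≤ p) {E : Type*} [NormedAddCommGroup E] {a b c d : α → E}
    (ha : AEStronglyMeasurable a μ) (hb : AEStronglyMeasurable b μ)
    (hc : AEStronglyMeasurable c μ) (hd : AEStronglyMeasurable d μ) :
    eLpNorm (fun x => a x - b x) p μ ≤ eLpNorm (fun x => c x - a x) p μ +
      eLpNorm (fun x => c x - d x) p μ + eLpNorm (fun x => d x - b x) p μ := by
  have h1 : (fun x => a x - b x) = (a - c) + (c - d) + (d - b) := by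
    ext x
    simp
  have h2 : eLpNorm (fun x => c x - a x) p μ = eLpNorm (a - c) p μ := by
    rw [← eLpNorm_neg]
    congr 1
    ext x
    simp
  rw [h1, h2]
  exact (eLpNorm_add_le ((ha.sub hc).add (hc.sub hd)) (hd.sub hb) hp).trans
    (add_le_add (eLpNorm_add_le (ha.sub hc) (hc.sub hd) hp) le_rfl)

theorem exists_tendsto_eLpNorm_of_cauchy {α : Type*} [MeasurableSpace α] {μ : Measure α}
    {E : Type*} [NormedAddCommGroup E] [CompleteSpace E]
    {f : ℕ → α → E} (hf : ∀ n, MemLp (f n) 2 μ) {a : ℕ → ℝ≥0∞} (ha : Tendsto a atTop (𝓝 0))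
    (h : ∀ n k, eLpNorm (fun x => f n x - f k x) 2 μ ≤ a n + a k) :
    ∃ g : α → E, MemLp g 2 μ ∧ Tendsto (fun n => eLpNorm (fun x => f n x - g x) 2 μ) atTop (𝓝 0) := by
  have hc : CauchySeq (fun n => (hf n).toLp (f n)) := by
    rw [EMetric.cauchySeq_iff]
    intro ε hε
    have hε2 : 0 < ε / 2 := ENNReal.half_pos hε.ne'
    obtain ⟨n₀, hn₀⟩ := eventually_atTop.1 (ha.eventually (gt_mem_nhds hε2))
    refine ⟨n₀, fun n hn k hk => ?_⟩
    rw [Lp.edist_toLp_toLp]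
    calc eLpNorm (f n - f k) 2 μ ≤ a n + a k := h n k
      _ < ε / 2 + ε / 2 := ENNReal.add_lt_add (hn₀ n hn) (hn₀ k hk)
      _ = ε := ENNReal.add_halves ε
  obtain ⟨g, hg⟩ := cauchySeq_tendsto_of_complete hc
  refine ⟨g, Lp.memLp g, ?_⟩
  have h2 := tendsto_iff_edist_tendsto_0.1 hg
  refine h2.congr fun n => ?_
  rw [Lp.edist_def]
  refine eLpNorm_congr_ae ?_
  filter_upwards [(hf n).coeFn_toLp] with x hx
  simp [hx]

theorem IsCompensatedIntegral.congr {Z : Type} [MeasurableSpace Z]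
    {Ω : Type u} {mΩ : MeasurableSpace Ω} {P : Measure Ω} {m : Measure Z} {N : Ω → Measure Z}
    {f g : Z → ℝ} {Y : Ω → ℝ}
    (hf : IsCompensatedIntegral P m N f Y) (hfg : f =ᵐ[m] g) :
    IsCompensatedIntegral P m N g Y := by
  obtain ⟨hf, hY, F, hF, hFf, hFY⟩ := hf
  refine ⟨hf.ae_eq hfg, hY, F, hF, hFf.congr fun n => eLpNorm_congr_ae ?_, hFY⟩
  filter_upwards [hfg] with z hz
  rw [hz]

section Compensated

variable {Z : Type} [MeasurableSpace Z] {Ω : Type u} {mΩ : MeasurableSpace Ω} {P : Measure Ω}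
  [IsProbabilityMeasure P] {m : Measure Z} {N : Ω → Measure Z}

theorem ae_lt_top_of_isPoissonRandomMeasure (hN : IsPoissonRandomMeasure P m N) {B : Set Z}
    (hB : MeasurableSet B) (hm : m B < ⊤) : ∀ᵐ ω ∂P, N ω B < ⊤ := by
  have h := map_eq_map_poissonMeasure (r := (m B).toNNReal) (hN.measurable B hB)
    (fun k => hN.law B hB hm k)
  have h2 : P.map (fun ω => N ω B) {⊤} = 0 := by
    rw [h, Measure.map_apply (by fun_prop) (measurableSet_singleton _)]
    have : (Nat.cast : ℕ → ℝ≥0∞) ⁻¹' {⊤} = ∅ := by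
      ext n
      simp
    rw [this, measure_empty]
  rw [Measure.map_apply (hN.measurable B hB) (measurableSet_singleton _)] at h2
  filter_upwards [measure_eq_zero_iff_ae_notMem.1 h2] with ω hω
  exact lt_top_iff_ne_top.2 hω

/-- The defining sum runs over the range of `F`, which hides additivity in `F`. Written almost
surely as a difference of two integrals, the compensated integral is visibly linear. -/
theorem simpleCompensated_ae_eq (hN : IsPoissonRandomMeasure P m N) {F : SimpleFunc Z ℝ}
    (hF : MemLp F 2 m) : ∀ᵐ ω ∂P, Integrable F (N ω) ∧
      simpleCompensated m N F ω = ∫ z, F z ∂(N ω) - ∫ z, F z ∂m := by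
  have hfin : ∀ c : ℝ, c ≠ 0 → m (F ⁻¹' {c}) < ⊤ :=
    SimpleFunc.measure_preimage_lt_top_of_memLp two_ne_zero ENNReal.ofNat_ne_top F hF
  have hmi : Integrable F m := SimpleFunc.integrable_iff.2 hfin
  have h : ∀ᵐ ω ∂P, ∀ c ∈ F.range, c ≠ 0 → N ω (F ⁻¹' {c}) < ⊤ := by
    rw [Filter.eventually_all_finset]
    intro c _
    by_cases hc : c = 0
    · simp [hc]
    · filter_upwards [ae_lt_top_of_isPoissonRandomMeasure hN (F.measurableSet_fiber c)
        (hfin c hc)] with ω hω _ using hω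
  filter_upwards [h] with ω hω
  have hNi : Integrable F (N ω) := by
    refine SimpleFunc.integrable_iff.2 fun c hc => ?_
    by_cases hr : c ∈ F.range
    · exact hω c hr hc
    · rw [SimpleFunc.mem_range] at hr
      have : F ⁻¹' {c} = ∅ := by
        ext z
        simp only [mem_preimage, mem_singleton_iff, mem_empty_iff_false, iff_false]
        exact fun h => hr ⟨z, h⟩
      simp [this]
  refine ⟨hNi, ?_⟩
  rw [← SimpleFunc.integral_eq_integral F hNi, ← SimpleFunc.integral_eq_integral F hmi,
    SimpleFunc.integral_eq, SimpleFunc.integral_eq, ← Finset.sum_sub_distrib, simpleCompensated]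
  refine Finset.sum_congr rfl fun c _ => ?_
  simp only [smul_eq_mul, Measure.real]
  ring

theorem simpleCompensated_sub (hN : IsPoissonRandomMeasure P m N) {F G : SimpleFunc Z ℝ}
    (hF : MemLp F 2 m) (hG : MemLp G 2 m) :
    (fun ω => simpleCompensated m N F ω - simpleCompensated m N G ω) =ᵐ[P]
      simpleCompensated m N (F - G) := by
  have hFG : MemLp (F - G : SimpleFunc Z ℝ) 2 m := by
    rw [SimpleFunc.coe_sub]
    exact hF.sub hG
  have hi : ∀ {F : SimpleFunc Z ℝ}, MemLp F 2 m → Integrable F m := fun {F} hF =>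
    SimpleFunc.integrable_iff.2
      (SimpleFunc.measure_preimage_lt_top_of_memLp two_ne_zero ENNReal.ofNat_ne_top F hF)
  filter_upwards [simpleCompensated_ae_eq hN hF, simpleCompensated_ae_eq hN hG,
    simpleCompensated_ae_eq hN hFG] with ω h1 h2 h3
  rw [h1.2, h2.2, h3.2, SimpleFunc.coe_sub]
  simp only [Pi.sub_apply]
  rw [integral_sub h1.1 h2.1, integral_sub (hi hF) (hi hG)]
  ring

theorem eLpNorm_simpleCompensated_sub (hN : IsPoissonRandomMeasure P m N) {F G : SimpleFunc Z ℝ}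
    (hF : MemLp F 2 m) (hG : MemLp G 2 m) :
    eLpNorm (fun ω => simpleCompensated m N F ω - simpleCompensated m N G ω) 2 P =
      eLpNorm (fun z => F z - G z) 2 m := by
  have hFG : MemLp (F - G : SimpleFunc Z ℝ) 2 m := by
    rw [SimpleFunc.coe_sub]
    exact hF.sub hG
  rw [eLpNorm_congr_ae (simpleCompensated_sub hN hF hG), eLpNorm_simpleCompensated_two hN hFG]
  rfl

/-- The isometry passes from simple functions to limits by two triangle inequalities, one for each
direction. Stated for differences it also contains the uniqueness of the integral. -/
theorem IsCompensatedIntegral.eLpNorm_sub (hN : IsPoissonRandomMeasure P m N) {f g : Z → ℝ}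
    {Y W : Ω → ℝ} (hf : IsCompensatedIntegral P m N f Y) (hg : IsCompensatedIntegral P m N g W) :
    eLpNorm (fun ω => Y ω - W ω) 2 P = eLpNorm (fun z => f z - g z) 2 m := by
  obtain ⟨hf, hY, F, hF, hFf, hFY⟩ := hf
  obtain ⟨hg, hW, G, hG, hGg, hGW⟩ := hg
  have hI : ∀ {F : SimpleFunc Z ℝ}, MemLp F 2 m → AEStronglyMeasurable (simpleCompensated m N F) P :=
    fun hF => (memLp_simpleCompensated hN hF 2).1
  refine le_antisymm ?_ ?_
  · have h : ∀ n, eLpNorm (fun ω => Y ω - W ω) 2 P ≤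
        eLpNorm (fun ω => simpleCompensated m N (F n) ω - Y ω) 2 P +
        (eLpNorm (fun z => F n z - f z) 2 m + eLpNorm (fun z => f z - g z) 2 m +
          eLpNorm (fun z => G n z - g z) 2 m) +
        eLpNorm (fun ω => simpleCompensated m N (G n) ω - W ω) 2 P := by
      intro n
      refine (eLpNorm_sub_le_three one_le_two hY hW (hI (hF n)) (hI (hG n))).trans ?_
      gcongr
      rw [eLpNorm_simpleCompensated_sub hN (hF n) (hG n)]
      refine (eLpNorm_sub_le_three one_le_two (hF n).1 (hG n).1 hf.1 hg.1).trans ?_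
      rw [eLpNorm_fun_sub_comm f, eLpNorm_fun_sub_comm g]
    have hlim := (hFY.add ((hFf.add (tendsto_const_nhds
      (x := eLpNorm (fun z => f z - g z) 2 m))).add hGg)).add hGW
    simp only [zero_add, add_zero] at hlim
    exact ge_of_tendsto' hlim h
  · have h : ∀ n, eLpNorm (fun z => f z - g z) 2 m ≤
        eLpNorm (fun z => F n z - f z) 2 m +
        (eLpNorm (fun ω => simpleCompensated m N (F n) ω - Y ω) 2 P +
          eLpNorm (fun ω => Y ω - W ω) 2 P +
          eLpNorm (fun ω => simpleCompensated m N (G n) ω - W ω) 2 P) +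
        eLpNorm (fun z => G n z - g z) 2 m := by
      intro n
      refine (eLpNorm_sub_le_three one_le_two hf.1 hg.1 (hF n).1 (hG n).1).trans ?_
      gcongr
      rw [← eLpNorm_simpleCompensated_sub hN (hF n) (hG n)]
      refine (eLpNorm_sub_le_three one_le_two (hI (hF n)) (hI (hG n)) hY hW).trans ?_
      rw [eLpNorm_fun_sub_comm Y, eLpNorm_fun_sub_comm W]
    have hlim := (hFf.add ((hFY.add (tendsto_const_nhds
      (x := eLpNorm (fun ω => Y ω - W ω) 2 P))).add hGW)).add hGg
    simp only [zero_add, add_zero] at hlim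
    exact ge_of_tendsto' hlim h

theorem isCompensatedIntegral_simpleFunc (hN : IsPoissonRandomMeasure P m N)
    {F : SimpleFunc Z ℝ} (hF : MemLp F 2 m) :
    IsCompensatedIntegral P m N F (simpleCompensated m N F) :=
  ⟨hF, (memLp_simpleCompensated hN hF 2).1, fun _ => F, fun _ => hF, by simp, by simp⟩

/-- A diagonal argument: each `W n` is replaced by the integral of a simple function that is within
`1/(n+1)` of it on both sides of the isometry. -/
theorem isCompensatedIntegral_of_tendsto (hN : IsPoissonRandomMeasure P m N)
    {f : ℕ → Z → ℝ} {g : Z → ℝ}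
    {W : ℕ → Ω → ℝ} {Y : Ω → ℝ} (h : ∀ n, IsCompensatedIntegral P m N (f n) (W n))
    (hg : MemLp g 2 m) (hY : AEStronglyMeasurable Y P)
    (hfg : Tendsto (fun n => eLpNorm (fun z => f n z - g z) 2 m) atTop (𝓝 0))
    (hWY : Tendsto (fun n => eLpNorm (fun ω => W n ω - Y ω) 2 P) atTop (𝓝 0)) :
    IsCompensatedIntegral P m N g Y := by
  have hsel : ∀ n, ∃ F : SimpleFunc Z ℝ, MemLp F 2 m ∧
      eLpNorm (fun z => F z - f n z) 2 m < ((n : ℝ≥0∞) + 1)⁻¹ ∧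
      eLpNorm (fun ω => simpleCompensated m N F ω - W n ω) 2 P < ((n : ℝ≥0∞) + 1)⁻¹ := by
    intro n
    obtain ⟨_, _, F, hF, hFf, hFW⟩ := h n
    have hpos : 0 < ((n : ℝ≥0∞) + 1)⁻¹ := by simp
    obtain ⟨k, hk1, hk2⟩ := ((hFf.eventually (gt_mem_nhds hpos)).and
      (hFW.eventually (gt_mem_nhds hpos))).exists
    exact ⟨F k, hF k, hk1, hk2⟩
  choose F hF h1 h2 using hsel
  have hinv : Tendsto (fun n : ℕ => ((n : ℝ≥0∞) + 1)⁻¹) atTop (𝓝 0) := by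
    have := (tendsto_add_atTop_iff_nat 1).2 ENNReal.tendsto_inv_nat_nhds_zero
    simpa using this
  refine ⟨hg, hY, F, hF, ?_, ?_⟩
  · have hlim := hinv.add hfg
    rw [add_zero] at hlim
    refine tendsto_of_tendsto_of_tendsto_of_le_of_le tendsto_const_nhds hlim
      (fun n => bot_le) fun n => ?_
    have : (fun z => F n z - g z) = (fun z => F n z - f n z) + fun z => f n z - g z := by
      ext z
      simp
    rw [this]
    exact (eLpNorm_add_le ((hF n).1.sub (h n).1.1) ((h n).1.1.sub hg.1) one_le_two).trans
      (add_le_add (h1 n).le le_rfl)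
  · have hlim := hinv.add hWY
    rw [add_zero] at hlim
    refine tendsto_of_tendsto_of_tendsto_of_le_of_le tendsto_const_nhds hlim
      (fun n => bot_le) fun n => ?_
    have : (fun ω => simpleCompensated m N (F n) ω - Y ω) =
        (fun ω => simpleCompensated m N (F n) ω - W n ω) + fun ω => W n ω - Y ω := by
      ext z
      simp
    rw [this]
    exact (eLpNorm_add_le ((memLp_simpleCompensated hN (hF n) 2).1.sub (h n).2.1)
      ((h n).2.1.sub hY) one_le_two).trans (add_le_add (h2 n).le le_rfl)

end Compensated

/-- The simple functions in the definition of the integral converge only in `L²`. Others are chosen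
that converge to `f` in `L²` and in `L^p`; along a subsequence their integrals converge almost
surely, and Fatou's lemma transfers the bound. -/
theorem exists_eLpNorm_compensatedIntegral_le {p : ℝ} (hp : 2 ≤ p) : ∃ B : ℝ, 0 < B ∧
    ∀ (Z : Type) [MeasurableSpace Z] (Ω : Type u) [MeasurableSpace Ω] (P : Measure Ω)
      [IsProbabilityMeasure P] (m : Measure Z) (N : Ω → Measure Z), IsPoissonRandomMeasure P m N →
      ∀ (f : Z → ℝ) (Y : Ω → ℝ), IsCompensatedIntegral P m N f Y → MemLp f (ENNReal.ofReal p) m →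
      eLpNorm Y (ENNReal.ofReal p) P ≤
        ENNReal.ofReal B * (eLpNorm f 2 m + eLpNorm f (ENNReal.ofReal p) m) := by
  obtain ⟨B, hB, hBs⟩ := exists_eLpNorm_simpleCompensated_le.{u} hp
  refine ⟨B, hB, ?_⟩
  intro Z _ Ω _ P _ m N hN f Y hfY hfp
  have hp1 : 1 ≤ ENNReal.ofReal p := by
    rw [← ENNReal.ofReal_one]
    exact ENNReal.ofReal_le_ofReal (by linarith)
  have hf2 := hfY.1
  set g := hf2.1.mk f with hg
  have hgm : Measurable g := hf2.1.stronglyMeasurable_mk.measurable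
  have hfg : f =ᵐ[m] g := hf2.1.ae_eq_mk
  have hgY := hfY.congr hfg
  have hgp : MemLp g (ENNReal.ofReal p) m := hfp.ae_eq hfg
  have hg2 := hgY.1
  rw [eLpNorm_congr_ae hfg, eLpNorm_congr_ae hfg]
  let F : ℕ → SimpleFunc Z ℝ := SimpleFunc.approxOn g hgm univ 0 (mem_univ _)
  have hF2 : ∀ n, MemLp (F n) 2 m := fun n =>
    SimpleFunc.memLp_approxOn hgm hg2 (mem_univ _) MemLp.zero' n
  have hconv : ∀ q : ℝ≥0∞, q ≠ ⊤ → MemLp g q m →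
      Tendsto (fun n => eLpNorm (fun z => F n z - g z) q m) atTop (𝓝 0) := fun q hq hgq =>
    SimpleFunc.tendsto_approxOn_Lp_eLpNorm hgm (mem_univ _) hq (by simp) (by simpa using hgq.2)
  have hc2 := hconv 2 (by norm_num) hg2
  have hcp := hconv _ ENNReal.ofReal_ne_top hgp
  -- The isometry shows that the new approximations have the same limit `Y`.
  have hcY : Tendsto (fun n => eLpNorm (simpleCompensated m N (F n) - Y) 2 P) atTop (𝓝 0) := by
    refine hc2.congr fun n => ?_
    exact ((isCompensatedIntegral_simpleFunc hN (hF2 n)).eLpNorm_sub hN hgY).symm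
  have hIm : ∀ n, AEStronglyMeasurable (simpleCompensated m N (F n)) P := fun n =>
    (memLp_simpleCompensated hN (hF2 n) 2).1
  obtain ⟨ns, hns, hae⟩ := (tendstoInMeasure_of_tendsto_eLpNorm two_ne_zero hIm hgY.2.1
    hcY).exists_seq_tendsto_ae
  refine (Lp.eLpNorm_lim_le_liminf_eLpNorm (fun n => hIm (ns n)) Y hae).trans ?_
  have hb : ∀ n, eLpNorm (simpleCompensated m N (F (ns n))) (ENNReal.ofReal p) P ≤
      ENNReal.ofReal B * ((eLpNorm (fun z => F (ns n) z - g z) 2 m + eLpNorm g 2 m) +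
        (eLpNorm (fun z => F (ns n) z - g z) (ENNReal.ofReal p) m +
          eLpNorm g (ENNReal.ofReal p) m)) := by
    intro n
    refine (hBs Z Ω P m N hN (F (ns n)) (hF2 _)).trans ?_
    have hsum : (F (ns n) : Z → ℝ) = (fun z => F (ns n) z - g z) + g := by
      ext z
      simp
    have hadd : ∀ q : ℝ≥0∞, 1 ≤ q → eLpNorm (F (ns n)) q m ≤
        eLpNorm (fun z => F (ns n) z - g z) q m + eLpNorm g q m := by
      intro q hq
      conv_lhs => rw [hsum]
      exact eLpNorm_add_le ((hF2 _).1.sub hg2.1) hg2.1 hq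
    gcongr
    · exact hadd 2 one_le_two
    · exact hadd _ hp1
  have hlim : Tendsto (fun n => ENNReal.ofReal B *
      ((eLpNorm (fun z => F (ns n) z - g z) 2 m + eLpNorm g 2 m) +
        (eLpNorm (fun z => F (ns n) z - g z) (ENNReal.ofReal p) m +
          eLpNorm g (ENNReal.ofReal p) m))) atTop
      (𝓝 (ENNReal.ofReal B * ((0 + eLpNorm g 2 m) + (0 + eLpNorm g (ENNReal.ofReal p) m)))) := by
    refine ENNReal.Tendsto.const_mul ?_ (Or.inr ENNReal.ofReal_ne_top)
    exact ((hc2.comp hns.tendsto_atTop).add_const _).add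
      ((hcp.comp hns.tendsto_atTop).add_const _)
  rw [zero_add, zero_add] at hlim
  calc liminf (fun n => eLpNorm (simpleCompensated m N (F (ns n))) (ENNReal.ofReal p) P) atTop
      ≤ liminf (fun n => ENNReal.ofReal B *
      ((eLpNorm (fun z => F (ns n) z - g z) 2 m + eLpNorm g 2 m) +
        (eLpNorm (fun z => F (ns n) z - g z) (ENNReal.ofReal p) m +
          eLpNorm g (ENNReal.ofReal p) m))) atTop := liminf_le_liminf (Eventually.of_forall hb)
    _ = _ := hlim.liminf_eq

end LevyColored

namespace LevyColored

/-! ### Minkowski's integral inequality and Young's convolution inequality -/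

/-- The usual duality proof of Minkowski's inequality: write `F^p = F^{p-1} F`, exchange the
integrals, apply Hölder and divide by `A^{1/q}`. Truncation at `n` on a finite measure space makes
`A` finite so that the division is legitimate; monotone convergence removes it. -/
theorem lintegral_rpow_lintegral_le {α β : Type*} [MeasurableSpace α] [MeasurableSpace β]
    {μ : Measure α} [IsFiniteMeasure μ] {ν : Measure β} [SFinite ν] {f : α → β → ℝ≥0∞}
    (hf : Measurable (Function.uncurry f)) {p : ℝ} (hp : 1 < p) :
    (∫⁻ x, (∫⁻ y, f x y ∂ν) ^ p ∂μ) ^ (1 / p) ≤ ∫⁻ y, (∫⁻ x, f x y ^ p ∂μ) ^ (1 / p) ∂ν := by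
  have hp0 : 0 < p := by linarith
  set R := ∫⁻ y, (∫⁻ x, f x y ^ p ∂μ) ^ (1 / p) ∂ν with hR
  set F : α → ℝ≥0∞ := fun x => ∫⁻ y, f x y ∂ν with hF
  have hFm : Measurable F := hf.lintegral_prod_right'
  have hpq : p.HolderConjugate (Real.conjExponent p) := Real.HolderConjugate.conjExponent hp
  set q := Real.conjExponent p with hq
  have hfy : ∀ y, Measurable fun x => f x y := fun y => hf.comp (measurable_id.prodMk measurable_const)
  have hfx : ∀ x, Measurable fun y => f x y := fun x => hf.comp (measurable_const.prodMk measurable_id)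
  have key : ∀ n : ℕ, ∫⁻ x, min (F x) n ^ p ∂μ ≤ R ^ p := by
    intro n
    set G : α → ℝ≥0∞ := fun x => min (F x) n with hG
    have hGm : Measurable G := hFm.min measurable_const
    set A := ∫⁻ x, G x ^ p ∂μ with hA
    have hAfin : A ≠ ⊤ := by
      have h1 : A ≤ ∫⁻ _, (n : ℝ≥0∞) ^ p ∂μ :=
        lintegral_mono fun x => ENNReal.rpow_le_rpow (min_le_right _ _) hp0.le
      rw [lintegral_const] at h1
      refine (h1.trans_lt (ENNReal.mul_lt_top ?_ (measure_lt_top μ _))).ne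
      exact ENNReal.rpow_lt_top_of_nonneg hp0.le (ENNReal.natCast_ne_top n)
    have h1 : A ≤ ∫⁻ x, ∫⁻ y, G x ^ (p - 1) * f x y ∂ν ∂μ := by
      refine lintegral_mono fun x => ?_
      rw [lintegral_const_mul _ (hfx x)]
      calc G x ^ p = G x ^ (p - 1) * G x := by
            conv_rhs => rw [← ENNReal.rpow_one (G x), ← ENNReal.rpow_mul, one_mul,
              ← ENNReal.rpow_add_of_nonneg _ _ (by linarith : 0 ≤ p - 1) zero_le_one]
            ring_nf
        _ ≤ G x ^ (p - 1) * F x := by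
            gcongr
            exact min_le_left _ _
    have h2 : ∫⁻ x, ∫⁻ y, G x ^ (p - 1) * f x y ∂ν ∂μ = ∫⁻ y, ∫⁻ x, G x ^ (p - 1) * f x y ∂μ ∂ν := by
      refine lintegral_lintegral_swap ?_
      exact (((hGm.comp measurable_fst).pow_const _).mul hf).aemeasurable
    have h3 : ∀ y, ∫⁻ x, G x ^ (p - 1) * f x y ∂μ ≤ (∫⁻ x, f x y ^ p ∂μ) ^ (1 / p) * A ^ (1 / q) := by
      intro y
      have := ENNReal.lintegral_mul_le_Lp_mul_Lq μ hpq (hfy y).aemeasurable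
        (hGm.pow_const (p - 1)).aemeasurable
      have e : ∀ x, (G x ^ (p - 1)) ^ q = G x ^ p := by
        intro x
        rw [← ENNReal.rpow_mul, hpq.sub_one_mul_conj]
      simp_rw [e] at this
      refine le_trans (le_of_eq ?_) this
      refine lintegral_congr fun x => ?_
      simp [mul_comm]
    have h4 : A ≤ R * A ^ (1 / q) := by
      refine (h1.trans_eq h2).trans ((lintegral_mono h3).trans ?_)
      rw [lintegral_mul_const]
      exact ((hf.comp measurable_swap).pow_const p).lintegral_prod_right'.pow_const _
    rcases eq_or_ne A 0 with h0 | h0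
    · rw [h0]
      exact bot_le
    have h5 : A = A ^ (1 / p) * A ^ (1 / q) := by
      rw [← ENNReal.rpow_add _ _ h0 hAfin, one_div, one_div, hpq.inv_add_inv_eq_one,
        ENNReal.rpow_one]
    have h6 : A ^ (1 / p) ≤ R := by
      have h7 : A ^ (1 / q) ≠ 0 := by
        simp [ENNReal.rpow_eq_zero_iff, h0, hAfin]
      have h8 : A ^ (1 / q) ≠ ⊤ := ENNReal.rpow_ne_top_of_nonneg (one_div_nonneg.2 hpq.symm.nonneg) hAfin
      rw [← ENNReal.mul_le_mul_iff_left h7 h8, ← h5]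
      exact h4
    calc A = (A ^ (1 / p)) ^ p := by
          rw [← ENNReal.rpow_mul, one_div_mul_cancel hp0.ne', ENNReal.rpow_one]
      _ ≤ R ^ p := ENNReal.rpow_le_rpow h6 hp0.le
  have hmono : ∫⁻ x, F x ^ p ∂μ ≤ R ^ p := by
    have h1 : ∀ x, F x ^ p = ⨆ n : ℕ, min (F x) n ^ p := by
      intro x
      have h2 : Tendsto (fun n : ℕ => min (F x) n ^ p) atTop (𝓝 (F x ^ p)) := by
        have h3 : Tendsto (fun n : ℕ => min (F x) (n : ℝ≥0∞)) atTop (𝓝 (min (F x) ⊤)) :=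
          tendsto_const_nhds.min ENNReal.tendsto_nat_nhds_top
        rw [min_eq_left le_top] at h3
        exact (ENNReal.continuous_rpow_const.tendsto _).comp h3
      refine tendsto_nhds_unique h2 (tendsto_atTop_iSup ?_)
      intro a b hab
      refine ENNReal.rpow_le_rpow (min_le_min le_rfl ?_) hp0.le
      exact_mod_cast hab
    simp_rw [h1]
    rw [lintegral_iSup (fun n => (hFm.min measurable_const).pow_const p)]
    · exact iSup_le key
    · intro a b hab x
      refine ENNReal.rpow_le_rpow (min_le_min le_rfl ?_) hp0.le
      exact_mod_cast hab
  calc (∫⁻ x, F x ^ p ∂μ) ^ (1 / p) ≤ (R ^ p) ^ (1 / p) :=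
        ENNReal.rpow_le_rpow hmono (by positivity)
    _ = R := by rw [← ENNReal.rpow_mul, mul_one_div_cancel hp0.ne', ENNReal.rpow_one]

theorem eLpNorm_integral_le {α β : Type*} [MeasurableSpace α] [MeasurableSpace β]
    {μ : Measure α} [IsFiniteMeasure μ] {ν : Measure β} [SFinite ν] {f : β → α → ℝ}
    (hf : Measurable (Function.uncurry f)) {p : ℝ} (hp : 1 < p) :
    eLpNorm (fun x => ∫ y, f y x ∂ν) (ENNReal.ofReal p) μ ≤
      ∫⁻ y, eLpNorm (f y) (ENNReal.ofReal p) μ ∂ν := by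
  have hp0 : 0 < p := by linarith
  have h0 : ENNReal.ofReal p ≠ 0 := by simpa using hp0
  have e : ∀ g : α → ℝ, eLpNorm g (ENNReal.ofReal p) μ = (∫⁻ x, ‖g x‖ₑ ^ p ∂μ) ^ (1 / p) := by
    intro g
    rw [eLpNorm_eq_lintegral_rpow_enorm_toReal h0 ENNReal.ofReal_ne_top, ENNReal.toReal_ofReal hp0.le]
  simp_rw [e]
  have h1 := lintegral_rpow_lintegral_le (μ := μ) (ν := ν) (f := fun x y => ‖f y x‖ₑ)
    ((hf.comp measurable_swap).enorm) hp
  refine le_trans (ENNReal.rpow_le_rpow (lintegral_mono fun x => ?_) (by positivity)) h1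
  exact ENNReal.rpow_le_rpow (enorm_integral_le_lintegral_enorm _) hp0.le

/-- **Young's convolution inequality**. -/
theorem lintegral_convolution_rpow_le {E : Type*} [NormedAddCommGroup E] [MeasurableSpace E]
    [BorelSpace E] [SecondCountableTopology E] {μ : Measure E} [SFinite μ] [μ.IsAddLeftInvariant]
    [μ.IsNegInvariant] {f g : E → ℝ≥0∞} (hf : Measurable f) (hg : Measurable g)
    {p q r : ℝ} (hp : 1 ≤ p) (hq : 1 ≤ q) (hr : 1 ≤ r) (h : 1 / r + 1 / q = 1 + 1 / p) :
    (∫⁻ x, (∫⁻ y, f y * g (x - y) ∂μ) ^ p ∂μ) ^ (1 / p) ≤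
      (∫⁻ x, f x ^ r ∂μ) ^ (1 / r) * (∫⁻ x, g x ^ q ∂μ) ^ (1 / q) := by
  have hp0 : 0 < p := by linarith
  have hq0 : 0 < q := by linarith
  have hr0 : 0 < r := by linarith
  have hq1 : 1 / q ≤ 1 := by rw [div_le_one hq0]; exact hq
  have hr1 : 1 / r ≤ 1 := by rw [div_le_one hr0]; exact hr
  -- The exponents of a threefold Hölder inequality: `a + b + c = 1`, and `f g = (f^r g^q)^a (f^r)^b
  -- (g^q)^c`. Only the first factor still depends on `x` after integration in `y`.
  set a := 1 / p with ha
  set b := 1 / r - 1 / p with hb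
  set c := 1 / q - 1 / p with hc
  have ha0 : 0 ≤ a := by positivity
  have hb0 : 0 ≤ b := by linarith
  have hc0 : 0 ≤ c := by linarith
  set A := ∫⁻ x, f x ^ r ∂μ with hA
  set B := ∫⁻ x, g x ^ q ∂μ with hB
  have hsub : ∀ x, Measurable fun y => g (x - y) := fun x => hg.comp (measurable_const.sub measurable_id)
  have hgB : ∀ x, ∫⁻ y, g (x - y) ^ q ∂μ = B := by
    intro x
    exact lintegral_sub_left_eq_self (fun y => g y ^ q) x
  have key : ∀ x, ∫⁻ y, f y * g (x - y) ∂μ ≤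
      (∫⁻ y, f y ^ r * g (x - y) ^ q ∂μ) ^ a * A ^ b * B ^ c := by
    intro x
    have hh := ENNReal.lintegral_prod_norm_pow_le (μ := μ) (Finset.univ : Finset (Fin 3))
      (f := ![fun y => f y ^ r * g (x - y) ^ q, fun y => f y ^ r, fun y => g (x - y) ^ q])
      (by
        intro i _
        fin_cases i
        · exact ((hf.pow_const r).mul ((hsub x).pow_const q)).aemeasurable
        · exact (hf.pow_const r).aemeasurable
        · exact ((hsub x).pow_const q).aemeasurable)
      (p := ![a, b, c]) (by
        simp only [Fin.sum_univ_three, Matrix.cons_val_zero, Matrix.cons_val_one, Matrix.cons_val]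
        linarith)
      (by
        intro i _
        fin_cases i
        · exact ha0
        · exact hb0
        · exact hc0)
    simp only [Fin.prod_univ_three, Matrix.cons_val_zero, Matrix.cons_val_one, Matrix.cons_val,
      hgB] at hh
    refine le_trans (le_of_eq (lintegral_congr fun y => ?_)) hh
    rw [ENNReal.mul_rpow_of_nonneg _ _ ha0]
    simp only [← ENNReal.rpow_mul]
    have e1 : f y = f y ^ (r * a) * f y ^ (r * b) := by
      rw [← ENNReal.rpow_add_of_nonneg _ _ (by positivity) (by positivity)]
      have : r * a + r * b = 1 := by
        rw [ha, hb]
        field_simp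
        ring
      rw [this, ENNReal.rpow_one]
    have e2 : g (x - y) = g (x - y) ^ (q * a) * g (x - y) ^ (q * c) := by
      rw [← ENNReal.rpow_add_of_nonneg _ _ (by positivity) (by positivity)]
      have : q * a + q * c = 1 := by
        rw [ha, hc]
        field_simp
        ring
      rw [this, ENNReal.rpow_one]
    conv_lhs => rw [e1, e2]
    ring
  have hm2 : Measurable (Function.uncurry fun x y => f y ^ r * g (x - y) ^ q) :=
    ((hf.comp measurable_snd).pow_const r).mul
      ((hg.comp (measurable_fst.sub measurable_snd)).pow_const q)
  have hAB : ∫⁻ x, ∫⁻ y, f y ^ r * g (x - y) ^ q ∂μ ∂μ = A * B := by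
    rw [lintegral_lintegral_swap hm2.aemeasurable]
    have : ∀ y, ∫⁻ x, f y ^ r * g (x - y) ^ q ∂μ = f y ^ r * B := by
      intro y
      have hy : Measurable fun x => g (x - y) ^ q := by fun_prop
      rw [lintegral_const_mul _ hy]
      congr 1
      exact lintegral_sub_right_eq_self (fun x => g x ^ q) y
    simp_rw [this]
    rw [lintegral_mul_const _ (hf.pow_const r)]
  have h1 : ∫⁻ x, (∫⁻ y, f y * g (x - y) ∂μ) ^ p ∂μ ≤ A * B * (A ^ b * B ^ c) ^ p := by
    calc ∫⁻ x, (∫⁻ y, f y * g (x - y) ∂μ) ^ p ∂μ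
        ≤ ∫⁻ x, (∫⁻ y, f y ^ r * g (x - y) ^ q ∂μ) * (A ^ b * B ^ c) ^ p ∂μ := by
          refine lintegral_mono fun x => ?_
          refine (ENNReal.rpow_le_rpow (key x) hp0.le).trans (le_of_eq ?_)
          rw [mul_assoc, ENNReal.mul_rpow_of_nonneg _ _ hp0.le, ← ENNReal.rpow_mul, ha,
            one_div_mul_cancel hp0.ne', ENNReal.rpow_one]
      _ = A * B * (A ^ b * B ^ c) ^ p := by
          have hy : Measurable fun x => ∫⁻ y, f y ^ r * g (x - y) ^ q ∂μ :=
            hm2.lintegral_prod_right'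
          rw [lintegral_mul_const _ hy, hAB]
  refine (ENNReal.rpow_le_rpow h1 ha0).trans (le_of_eq ?_)
  rw [ENNReal.mul_rpow_of_nonneg _ _ ha0, ENNReal.mul_rpow_of_nonneg _ _ ha0, ← ENNReal.rpow_mul,
    ha, mul_one_div_cancel hp0.ne', ENNReal.rpow_one]
  have e1 : A ^ (1 / r) = A ^ (1 / p) * A ^ b := by
    rw [← ENNReal.rpow_add_of_nonneg _ _ ha0 hb0]
    congr 1
    rw [hb]
    ring
  have e2 : B ^ (1 / q) = B ^ (1 / p) * B ^ c := by
    rw [← ENNReal.rpow_add_of_nonneg _ _ ha0 hc0]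
    congr 1
    rw [hc]
    ring
  rw [e1, e2]
  ring

end LevyColored

open scoped Convolution
namespace LevyColored

/-! ### Tools on Fourier transforms and Schwartz functions -/

section Tools

variable {d : ℕ}

theorem integral_fourier_mul_eq {f g : Eu d → ℂ} (hf : Integrable f) (hg : Integrable g) :
    ∫ ξ, 𝓕 f ξ * g ξ = ∫ x, f x * 𝓕 g x := by
  have h := VectorFourier.integral_fourierIntegral_smul_eq_flip (μ := (volume : Measure (Eu d)))
    (ν := (volume : Measure (Eu d))) (L := innerₗ (Eu d)) (e := Real.fourierChar)
    (f := f) (g := g) Real.continuous_fourierChar continuous_inner hf hg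
  rw [flip_innerₗ] at h
  exact h

theorem integral_fourierInv_mul_eq {f g : Eu d → ℂ} (hf : Integrable f) (hg : Integrable g) :
    ∫ ξ, 𝓕⁻ f ξ * g ξ = ∫ x, f x * 𝓕⁻ g x := by
  have h := integral_fourier_mul_eq hf hg.comp_neg
  have h1 : ∀ ξ, 𝓕⁻ f ξ = 𝓕 f (-ξ) := fun ξ => Real.fourierInv_eq_fourier_neg f ξ
  have h2 : ∀ x, 𝓕⁻ g x = 𝓕 (fun y => g (-y)) x := fun x => by
    rw [Real.fourierInv_eq_fourier_comp_neg]
  simp_rw [h1, h2, ← h]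
  rw [← integral_neg_eq_self (fun ξ => 𝓕 f (-ξ) * g ξ)]
  simp

theorem norm_fourier_le_integral (f : Eu d → ℂ) (ξ : Eu d) : ‖𝓕 f ξ‖ ≤ ∫ x, ‖f x‖ :=
  VectorFourier.norm_fourierIntegral_le_integral_norm _ _ _ _ _

theorem norm_fourierInv_le_integral (f : Eu d → ℂ) (ξ : Eu d) : ‖𝓕⁻ f ξ‖ ≤ ∫ x, ‖f x‖ := by
  rw [Real.fourierInv_eq_fourier_neg]
  exact norm_fourier_le_integral f _

theorem continuous_fourier {f : Eu d → ℂ} (hf : Integrable f) : Continuous (𝓕 f) :=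
  VectorFourier.fourierIntegral_continuous Real.continuous_fourierChar continuous_inner hf

/-- The Schwartz function `ξ ↦ exp (- 2 π i y · ξ) φ ξ`. -/
noncomputable def modulate (y : Eu d) (φ : 𝓢(Eu d, ℂ)) : 𝓢(Eu d, ℂ) := 𝓕⁻ (shift y (𝓕 φ))

theorem fourier_modulate (y : Eu d) (φ : 𝓢(Eu d, ℂ)) : 𝓕 (modulate y φ) = shift y (𝓕 φ) :=
  FourierTransform.fourier_fourierInv_eq _

theorem modulate_apply (y : Eu d) (φ : 𝓢(Eu d, ℂ)) (ξ : Eu d) :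
    modulate y φ ξ = Real.fourierChar (-⟪ξ, y⟫) • φ ξ := by
  have h1 : modulate y φ ξ = 𝓕⁻ (fun x : Eu d => ((𝓕 φ) (y + x) : ℂ)) ξ := by
    rw [modulate, SchwartzMap.fourierInv_coe]
    refine congrFun (congrArg _ ?_) ξ
    ext x
    exact shift_apply _ _ _
  have h2 : φ ξ = 𝓕⁻ (fun x : Eu d => ((𝓕 φ) x : ℂ)) ξ := by
    have : (𝓕⁻ (𝓕 φ)) ξ = φ ξ := by rw [FourierTransform.fourierInv_fourier_eq]
    rw [← this, SchwartzMap.fourierInv_coe]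
  rw [h1, h2, Real.fourierInv_eq, Real.fourierInv_eq]
  refine Eq.trans ?_ (integral_smul ((Real.fourierChar (-⟪ξ, y⟫) : Circle) : ℂ) _)
  refine Eq.trans ?_ (integral_add_left_eq_self
    (fun v => Real.fourierChar (-⟪ξ, y⟫) • Real.fourierChar ⟪v, ξ⟫ • (𝓕 φ) v) y)
  refine integral_congr_ae (ae_of_all _ fun v => ?_)
  simp only [Circle.smul_def, smul_eq_mul]
  rw [← mul_assoc, ← Circle.coe_mul, ← AddChar.map_add_eq_mul]
  congr 4
  rw [inner_add_left, real_inner_comm y ξ]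
  ring

/-- A smooth cutoff function, equal to `1` on the ball of radius `R + 1`. -/
theorem exists_cutoff (R : ℝ) : ∃ χ : 𝓢(Eu d, ℂ), ∀ x, ‖x‖ ≤ R → χ x = 1 := by
  let b : ContDiffBump (0 : Eu d) := ⟨|R| + 1, |R| + 2, by positivity, by linarith⟩
  have hc : HasCompactSupport (fun x => ((b x : ℝ) : ℂ)) :=
    b.hasCompactSupport.comp_left (g := fun t : ℝ => (t : ℂ)) (by simp)
  refine ⟨hc.toSchwartzMap (Complex.ofRealCLM.contDiff.comp b.contDiff), fun x hx => ?_⟩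
  change ((b x : ℝ) : ℂ) = 1
  rw [b.one_of_mem_closedBall]
  · simp
  · rw [mem_closedBall_zero_iff]
    change ‖x‖ ≤ |R| + 1
    linarith [le_abs_self R]

theorem locallyIntegrable_of_integrable_mul {g : Eu d → ℂ}
    (h : ∀ φ : 𝓢(Eu d, ℂ), Integrable (fun x => g x * φ x)) : LocallyIntegrable g := by
  rw [locallyIntegrable_iff]
  intro K hK
  obtain ⟨R, hR⟩ := hK.isBounded.exists_norm_le
  obtain ⟨χ, hχ⟩ := exists_cutoff (d := d) R
  refine (h χ).integrableOn.congr_fun_ae (s := K) ?_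
  filter_upwards [ae_restrict_mem hK.measurableSet] with x hx
  rw [hχ x (hR x hx), mul_one]

theorem ae_eq_zero_of_integral_mul_schwartz {g : Eu d → ℂ} (hg : LocallyIntegrable g)
    (h : ∀ φ : 𝓢(Eu d, ℂ), HasCompactSupport φ → ∫ x, g x * φ x = 0) : g =ᵐ[volume] 0 := by
  refine ae_eq_zero_of_integral_contDiff_smul_eq_zero hg fun ψ hψ hc => ?_
  have hc2 : HasCompactSupport (fun x => ((ψ x : ℝ) : ℂ)) :=
    hc.comp_left (g := fun t : ℝ => (t : ℂ)) (by simp)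
  have := h (hc2.toSchwartzMap (Complex.ofRealCLM.contDiff.comp hψ)) hc2
  rw [← this]
  refine integral_congr_ae (ae_of_all _ fun x => ?_)
  change ψ x • g x = g x * ((ψ x : ℝ) : ℂ)
  rw [Complex.real_smul, mul_comm]

theorem integral_mul_fourier_eq {f : Eu d → ℂ} (hf : MemLp f 2 volume) (φ : 𝓢(Eu d, ℂ)) :
    ∫ x, f x * (𝓕 φ) x = ∫ x, (𝓕 (hf.toLp f) : Lp ℂ 2 (volume : Measure (Eu d))) x * φ x := by
  have h2 := congrArg (fun T : 𝓢'(Eu d, ℂ) => T φ)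
    (Lp.fourier_toTemperedDistribution_eq (hf.toLp f))
  simp only [TemperedDistribution.fourier_apply, Lp.toTemperedDistribution_apply,
    smul_eq_mul] at h2
  simp_rw [mul_comm _ (φ _)]
  rw [← h2]
  refine integral_congr_ae ?_
  filter_upwards [hf.coeFn_toLp] with x hx
  rw [hx, mul_comm]

/-- The hypothesis says that the Plancherel transform of `f` annihilates every test function, so it
vanishes, and its norm is that of `f`. Testing only with compactly supported frequencies is what
makes locally bounded symbols sufficient later. -/
theorem ae_eq_zero_of_integral_mul_fourier {f : Eu d → ℂ} (hf : MemLp f 2 volume)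
    (h : ∀ φ : 𝓢(Eu d, ℂ), HasCompactSupport φ → ∫ x, f x * (𝓕 φ) x = 0) :
    f =ᵐ[volume] 0 := by
  set F : Lp ℂ 2 (volume : Measure (Eu d)) := hf.toLp f with hF
  have h3 : (𝓕 F : Lp ℂ 2 (volume : Measure (Eu d))) =ᵐ[volume] 0 := by
    refine ae_eq_zero_of_integral_mul_schwartz
      ((Lp.memLp (𝓕 F)).locallyIntegrable one_le_two) fun φ hφ => ?_
    rw [← integral_mul_fourier_eq hf, h φ hφ]
  have h4 : (𝓕 F : Lp ℂ 2 (volume : Measure (Eu d))) = 0 := (Lp.eq_zero_iff_ae_eq_zero).2 h3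
  have h5 : F = 0 := by
    rw [← norm_eq_zero, ← Lp.norm_fourier_eq, h4, norm_zero]
  have h6 := (Lp.eq_zero_iff_ae_eq_zero).1 h5
  exact hf.coeFn_toLp.symm.trans h6

theorem exists_one_add_sq_pow_mul_norm_le (ψ : 𝓢(Eu d, ℂ)) (k : ℕ) :
    ∃ C : ℝ, 0 ≤ C ∧ ∀ x, (1 + ‖x‖ ^ 2) ^ k * ‖ψ x‖ ≤ C := by
  have h := SchwartzMap.one_add_le_sup_seminorm_apply (𝕜 := ℝ) (m := (2 * k, 0)) (k := 2 * k)
    (n := 0) le_rfl le_rfl ψ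
  simp only [norm_iteratedFDeriv_zero] at h
  refine ⟨_, le_trans ?_ (h 0), fun x => le_trans ?_ (h x)⟩
  · positivity
  · gcongr
    rw [pow_mul]
    gcongr
    nlinarith [norm_nonneg x]

end Tools

end LevyColored

namespace LevyColored

/-! ### Functionals with a locally bounded Fourier transform -/

section Mollifier

variable {d : ℕ}

/-- A sequence of bump functions concentrating at the origin. -/
noncomputable def bump (d n : ℕ) : ContDiffBump (0 : Eu d) :=
  ⟨1 / (2 * ((n : ℝ) + 1)), 1 / ((n : ℝ) + 1), by positivity, by
    rw [div_lt_div_iff_of_pos_left one_pos (by positivity) (by positivity)]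
    linarith [(Nat.cast_nonneg n : (0 : ℝ) ≤ n)]⟩

/-- The corresponding mollifiers. -/
noncomputable def mollifier (d n : ℕ) (x : Eu d) : ℝ := (bump d n).normed volume x

theorem tendsto_bump_rOut (d : ℕ) : Tendsto (fun n => (bump d n).rOut) atTop (𝓝 0) :=
  tendsto_one_div_add_atTop_nhds_zero_nat

theorem bump_rOut_le_one (d n : ℕ) : (bump d n).rOut ≤ 1 := by
  change 1 / ((n : ℝ) + 1) ≤ 1
  rw [div_le_one (by positivity)]
  linarith [(Nat.cast_nonneg n : (0 : ℝ) ≤ n)]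

/-- The bounded ratio of the radii is required by Lebesgue differentiation, hence by the almost
everywhere convergence of the mollifications. -/
theorem bump_rOut_le (d n : ℕ) : (bump d n).rOut ≤ 2 * (bump d n).rIn := by
  change 1 / ((n : ℝ) + 1) ≤ 2 * (1 / (2 * ((n : ℝ) + 1)))
  have : (0 : ℝ) < n + 1 := by positivity
  field_simp
  exact le_rfl

theorem mollifier_nonneg (d n : ℕ) (x : Eu d) : 0 ≤ mollifier d n x :=
  (bump d n).nonneg_normed x

theorem integrable_mollifier (d n : ℕ) : Integrable (mollifier d n) :=
  (bump d n).integrable_normed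

theorem integral_mollifier (d n : ℕ) : ∫ x, mollifier d n x = 1 := (bump d n).integral_normed

theorem mollifier_eq_zero {n : ℕ} {x : Eu d} (hx : 1 < ‖x‖) : mollifier d n x = 0 := by
  have h : x ∉ Function.support (mollifier d n) := by
    have := (bump d n).support_normed_eq (μ := (volume : Measure (Eu d)))
    change x ∉ Function.support ((bump d n).normed volume)
    rw [this, mem_ball_zero_iff, not_lt]
    exact (bump_rOut_le_one d n).trans hx.le
  simpa using h

theorem contDiff_mollifier (d n : ℕ) : ContDiff ℝ (⊤ : ℕ∞) (mollifier d n) :=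
  (bump d n).contDiff_normed

theorem hasCompactSupport_mollifier (d n : ℕ) : HasCompactSupport (mollifier d n) :=
  (bump d n).hasCompactSupport_normed

/-- Regularization of a function. -/
noncomputable def mollify (n : ℕ) (g : Eu d → ℂ) (x : Eu d) : ℂ :=
  ∫ t, (mollifier d n t : ℂ) * g (x - t)

theorem mollify_eq_convolution (n : ℕ) (g : Eu d → ℂ) :
    mollify n g = (bump d n).normed volume ⋆[ContinuousLinearMap.lsmul ℝ ℝ, volume] g := by
  ext x
  simp only [mollify, convolution, ContinuousLinearMap.lsmul_apply, Complex.real_smul]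
  rfl

theorem ae_tendsto_mollify {g : Eu d → ℂ} (hg : LocallyIntegrable g) :
    ∀ᵐ x, Tendsto (fun n => mollify n g x) atTop (𝓝 (g x)) := by
  have := ContDiffBump.ae_convolution_tendsto_right_of_locallyIntegrable
    (φ := fun n => bump d n) (l := atTop) (K := 2) (tendsto_bump_rOut d)
    (Eventually.of_forall fun n => bump_rOut_le d n) hg
  simpa only [mollify_eq_convolution] using this

theorem norm_mollify_le {g : Eu d → ℂ} {M : ℝ} (hM : ∀ᵐ x, ‖g x‖ ≤ M) (n : ℕ) (x : Eu d) :
    ‖mollify n g x‖ ≤ M := by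
  have h1 : ∀ᵐ t, ‖g (x - t)‖ ≤ M :=
    ((volume : Measure (Eu d)).measurePreserving_sub_left x).quasiMeasurePreserving.ae hM
  calc ‖mollify n g x‖ ≤ ∫ t, mollifier d n t * M := by
        refine norm_integral_le_of_norm_le ((integrable_mollifier d n).mul_const M) ?_
        filter_upwards [h1] with t ht
        rw [norm_mul, Complex.norm_real, Real.norm_of_nonneg (mollifier_nonneg d n t)]
        exact mul_le_mul_of_nonneg_left ht (mollifier_nonneg d n t)
    _ = M := by rw [integral_mul_const, integral_mollifier, one_mul]

theorem contDiff_mollify {g : Eu d → ℂ} (hg : LocallyIntegrable g) (n : ℕ) :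
    ContDiff ℝ (⊤ : ℕ∞) (mollify n g) := by
  rw [mollify_eq_convolution]
  exact (bump d n).hasCompactSupport_normed.contDiff_convolution_left _
    (bump d n).contDiff_normed hg

theorem hasCompactSupport_mollify {g : Eu d → ℂ} (hg : HasCompactSupport g) (n : ℕ) :
    HasCompactSupport (mollify n g) := by
  rw [mollify_eq_convolution]
  exact (bump d n).hasCompactSupport_normed.convolution _ hg

theorem mollify_eq_zero {g : Eu d → ℂ} {R : ℝ} (hg : ∀ x, R < ‖x‖ → g x = 0) (n : ℕ) {x : Eu d}
    (hx : R + 1 < ‖x‖) : mollify n g x = 0 := by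
  have : ∀ t, (mollifier d n t : ℂ) * g (x - t) = 0 := by
    intro t
    rcases lt_or_ge 1 ‖t‖ with h | h
    · rw [mollifier_eq_zero h]
      simp
    · rw [hg (x - t) (by linarith [norm_sub_norm_le x t]), mul_zero]
  simp [mollify, this]

theorem fourier_mollify {g : Eu d → ℂ} (hg : Integrable g) (n : ℕ) (y : Eu d) :
    𝓕 (mollify n g) y = 𝓕 (fun x => (mollifier d n x : ℂ)) y * 𝓕 g y := by
  have h := Real.fourier_mul_convolution_eq (integrable_mollifier d n).ofReal hg y
  refine Eq.trans ?_ h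
  refine congrFun (congrArg _ ?_) y
  ext x
  simp [mollify, convolution]

/-- The Fourier transform of a mollifier at `y` is the mollification at `0` of the continuous
character `x ↦ e(⟪x, y⟫)`, whose value there is `1`. -/
theorem tendsto_fourier_mollifier (y : Eu d) :
    Tendsto (fun n => 𝓕 (fun x => (mollifier d n x : ℂ)) y) atTop (𝓝 1) := by
  have hc : Continuous fun x : Eu d => ((Real.fourierChar ⟪x, y⟫ : Circle) : ℂ) := by
    have := Real.continuous_fourierChar
    fun_prop
  have h := ContDiffBump.convolution_tendsto_right_of_continuous (φ := fun n => bump d n)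
    (l := atTop) (μ := (volume : Measure (Eu d))) (tendsto_bump_rOut d) hc 0
  simp only [inner_zero_left, AddChar.map_zero_eq_one, Circle.coe_one] at h
  refine h.congr fun n => ?_
  rw [Real.fourier_eq]
  simp only [convolution, ContinuousLinearMap.lsmul_apply, Complex.real_smul, zero_sub,
    inner_neg_left, Circle.smul_def, smul_eq_mul]
  refine integral_congr_ae (ae_of_all _ fun t => ?_)
  simp only [mollifier]
  ring

theorem norm_fourier_mollifier_le (n : ℕ) (y : Eu d) :
    ‖𝓕 (fun x => (mollifier d n x : ℂ)) y‖ ≤ 1 := by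
  refine (norm_fourier_le_integral _ y).trans (le_of_eq ?_)
  rw [← integral_mollifier d n]
  refine integral_congr_ae (ae_of_all _ fun x => ?_)
  simp only [Complex.norm_real]
  exact Real.norm_of_nonneg (mollifier_nonneg d n x)

end Mollifier

/-! ### Locally bounded symbols and the convolution theorem -/

section Symbol

variable {d : ℕ}

/-- The Fourier transform of `T` is locally bounded. -/
def HasLocallyBoundedFourier (T : 𝓢(Eu d, ℂ) → ℂ) : Prop :=
  ∀ R : ℝ, ∃ C : ℝ, ∀ φ : 𝓢(Eu d, ℂ), (∀ ξ, R < ‖ξ‖ → φ ξ = 0) → ‖T (𝓕 φ)‖ ≤ C * ∫ ξ, ‖φ ξ‖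

theorem HasFourier.locallyIntegrable {T : 𝓢(Eu d, ℂ) → ℂ} {s : Eu d → ℂ} (hs : HasFourier T s) :
    LocallyIntegrable (fun ξ => s ((2 * Real.pi) • ξ)) :=
  locallyIntegrable_of_integrable_mul fun φ => (hs.2 φ).1

/-- Testing with translated mollifiers, which have unit `L¹` norm, bounds every mollification of the
symbol by the same constant; almost everywhere these converge to the symbol. The mollifiers have
radius at most `1`, whence the use of the constant for `R + 1`. -/
theorem HasLocallyBoundedFourier.ae_norm_le {T : 𝓢(Eu d, ℂ) → ℂ}
    (hT : HasLocallyBoundedFourier T) {s : Eu d → ℂ} (hs : HasFourier T s) (R : ℝ) :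
    ∃ C : ℝ, ∀ᵐ ξ : Eu d, ‖ξ‖ ≤ R → ‖s ((2 * Real.pi) • ξ)‖ ≤ C := by
  obtain ⟨C, hC⟩ := hT (R + 1)
  refine ⟨C, ?_⟩
  filter_upwards [ae_tendsto_mollify hs.locallyIntegrable] with ξ hξ hR
  refine le_of_tendsto hξ.norm (Eventually.of_forall fun n => ?_)
  have hc : HasCompactSupport (fun t => ((mollifier d n (ξ - t) : ℝ) : ℂ)) := by
    have h1 : HasCompactSupport (fun t => mollifier d n (ξ - t)) :=
      (hasCompactSupport_mollifier d n).comp_homeomorph (Homeomorph.subLeft ξ)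
    exact h1.comp_left (g := fun t : ℝ => (t : ℂ)) (by simp)
  have hd : ContDiff ℝ (⊤ : ℕ∞) (fun t => ((mollifier d n (ξ - t) : ℝ) : ℂ)) :=
    Complex.ofRealCLM.contDiff.comp ((contDiff_mollifier d n).comp (contDiff_const.sub contDiff_id))
  have h1 := hC (hc.toSchwartzMap hd) (by
    intro t ht
    change ((mollifier d n (ξ - t) : ℝ) : ℂ) = 0
    rw [mollifier_eq_zero (by
      have := norm_sub_norm_le t ξ
      rw [norm_sub_rev] at this
      linarith)]
    simp)
  rw [(hs.2 _).2] at h1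
  have h2 : ∫ t, ‖(hc.toSchwartzMap hd) t‖ = 1 := by
    rw [← integral_mollifier d n, ← integral_sub_left_eq_self (mollifier d n) volume ξ]
    refine integral_congr_ae (ae_of_all _ fun t => ?_)
    change ‖((mollifier d n (ξ - t) : ℝ) : ℂ)‖ = _
    rw [Complex.norm_real]
    exact Real.norm_of_nonneg (mollifier_nonneg d n _)
  rw [h2, mul_one] at h1
  refine le_trans (le_of_eq ?_) h1
  congr 1
  rw [mollify, ← integral_sub_left_eq_self _ volume ξ]
  refine integral_congr_ae (ae_of_all _ fun t => ?_)
  simp only [sub_sub_cancel]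
  exact mul_comm _ _

/-- The convolution theorem: the Fourier transform of `T * κ` is the product of the Fourier
transforms. -/
theorem integral_mul_shift_fourier {T : 𝓢(Eu d, ℂ) → ℂ} (hT : HasLocallyBoundedFourier T)
    {s : Eu d → ℂ} (hs : HasFourier T s) {κ : Eu d → ℝ≥0∞} {h : Eu d → ℂ}
    (hκ : HasFourier (funPairing κ) h) (φ : 𝓢(Eu d, ℂ)) (hφ : HasCompactSupport φ)
    (hint : Integrable (fun y => ((κ y).toReal : ℂ) * T (shift y (𝓕 φ)))) :
    ∫ y, ((κ y).toReal : ℂ) * T (shift y (𝓕 φ)) =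
      ∫ ξ, h ((2 * Real.pi) • ξ) * (s ((2 * Real.pi) • ξ) * φ ξ) := by
  -- The product of the symbol and the test function is bounded with compact support, but it need
  -- not be smooth, so the Fourier identity for `κ` cannot be applied to it directly. It is applied
  -- to the mollifications of `q`, and both sides pass to the limit.
  set q : Eu d → ℂ := fun ξ => s ((2 * Real.pi) • ξ) * φ ξ with hq
  have hqi : Integrable q := (hs.2 φ).1
  obtain ⟨R, hR⟩ : ∃ R : ℝ, ∀ x, R < ‖x‖ → φ x = 0 := by
    obtain ⟨R, hR⟩ := hφ.isCompact.isBounded.exists_norm_le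
    refine ⟨R, fun x hx => ?_⟩
    by_contra h0
    exact absurd (hR x (subset_tsupport _ h0)) (not_le.2 hx)
  have hqR : ∀ x, R < ‖x‖ → q x = 0 := fun x hx => by rw [hq]; simp [hR x hx]
  have hqc : HasCompactSupport q := hφ.mul_left
  obtain ⟨C, hC⟩ := hT.ae_norm_le hs R
  obtain ⟨D, hD0, hD⟩ := exists_one_add_sq_pow_mul_norm_le φ 0
  simp only [pow_zero, one_mul] at hD
  have hqM : ∀ᵐ x, ‖q x‖ ≤ |C| * D := by
    filter_upwards [hC] with x hx
    rcases lt_or_ge R ‖x‖ with h1 | h1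
    · rw [hqR x h1, norm_zero]
      positivity
    · rw [hq, norm_mul]
      exact mul_le_mul ((hx h1).trans (le_abs_self C)) (hD x) (norm_nonneg _) (abs_nonneg _)
  have hu : ∀ y, T (shift y (𝓕 φ)) = 𝓕 q y := by
    intro y
    rw [← fourier_modulate, (hs.2 _).2, Real.fourier_eq]
    refine integral_congr_ae (ae_of_all _ fun ξ => ?_)
    simp only [modulate_apply, hq, Circle.smul_def, smul_eq_mul]
    ring
  have key : ∀ n, ∫ y, ((κ y).toReal : ℂ) * (𝓕 (fun x => (mollifier d n x : ℂ)) y * 𝓕 q y) =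
      ∫ ξ, h ((2 * Real.pi) • ξ) * mollify n q ξ := by
    intro n
    have hc := hasCompactSupport_mollify hqc n
    have hd := contDiff_mollify hqi.locallyIntegrable n
    have h1 := (hκ.2 (hc.toSchwartzMap hd)).2
    refine Eq.trans ?_ h1
    rw [funPairing]
    refine integral_congr_ae (ae_of_all _ fun y => ?_)
    simp only
    rw [← fourier_mollify hqi n y]
    congr 1
  -- Mollifying multiplies `𝓕 q` by a factor of modulus at most `1`, so the limiting integrand,
  -- integrable by assumption, dominates.
  have hl : Tendsto (fun n => ∫ y, ((κ y).toReal : ℂ) *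
      (𝓕 (fun x => (mollifier d n x : ℂ)) y * 𝓕 q y)) atTop
      (𝓝 (∫ y, ((κ y).toReal : ℂ) * T (shift y (𝓕 φ)))) := by
    refine tendsto_integral_of_dominated_convergence
      (fun y => ‖((κ y).toReal : ℂ) * T (shift y (𝓕 φ))‖) (fun n => ?_) hint.norm (fun n => ?_) ?_
    · have h1 : (fun y => ((κ y).toReal : ℂ) * (𝓕 (fun x => (mollifier d n x : ℂ)) y * 𝓕 q y)) =
          fun y => 𝓕 (fun x => (mollifier d n x : ℂ)) y * (((κ y).toReal : ℂ) * T (shift y (𝓕 φ))) := by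
        ext y
        rw [hu y]
        ring
      rw [h1]
      exact (continuous_fourier (integrable_mollifier d n).ofReal).aestronglyMeasurable.mul
        hint.aestronglyMeasurable
    · refine ae_of_all _ fun y => ?_
      rw [hu y, norm_mul, norm_mul, norm_mul]
      refine mul_le_mul_of_nonneg_left ?_ (norm_nonneg _)
      exact mul_le_of_le_one_left (norm_nonneg _) (norm_fourier_mollifier_le n y)
    · refine ae_of_all _ fun y => ?_
      have := ((tendsto_fourier_mollifier y).mul_const (𝓕 q y)).const_mul ((κ y).toReal : ℂ)
      rw [one_mul] at this
      rw [hu y]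
      exact this
  -- On this side the mollifications share the bound of `q` and vanish outside the ball of radius `R
  -- + 1`, on which `h` is integrable.
  have hr : Tendsto (fun n => ∫ ξ, h ((2 * Real.pi) • ξ) * mollify n q ξ) atTop
      (𝓝 (∫ ξ, h ((2 * Real.pi) • ξ) * q ξ)) := by
    have hli := hκ.locallyIntegrable
    have hib : Integrable (fun ξ => (Metric.closedBall (0 : Eu d) (R + 1)).indicator
        (fun ξ => h ((2 * Real.pi) • ξ)) ξ) :=
      (integrable_indicator_iff measurableSet_closedBall).2
        (hli.integrableOn_isCompact (isCompact_closedBall _ _))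
    refine tendsto_integral_of_dominated_convergence
      (fun ξ => ‖(Metric.closedBall (0 : Eu d) (R + 1)).indicator
        (fun ξ => h ((2 * Real.pi) • ξ)) ξ‖ * (|C| * D)) (fun n => ?_) (hib.norm.mul_const _)
      (fun n => ae_of_all _ fun ξ => ?_) ?_
    · exact hli.aestronglyMeasurable.mul
        (contDiff_mollify hqi.locallyIntegrable n).continuous.aestronglyMeasurable
    · rcases lt_or_ge (R + 1) ‖ξ‖ with h1 | h1
      · rw [mollify_eq_zero hqR n h1, mul_zero, norm_zero]
        positivity
      · rw [indicator_of_mem (by simpa using h1), norm_mul]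
        exact mul_le_mul_of_nonneg_left (norm_mollify_le hqM n ξ) (norm_nonneg _)
    · filter_upwards [ae_tendsto_mollify hqi.locallyIntegrable] with ξ hξ
      exact hξ.const_mul _
  simp_rw [key] at hl
  exact tendsto_nhds_unique hl hr

end Symbol

/-! ### Convolution of tempered kernels with rapidly decreasing functions -/

section Pairing

variable {d : ℕ}

theorem IsTempered.integrable {κ : Eu d → ℝ≥0∞} (hκ : IsTempered κ) :
    ∃ k : ℕ, Integrable (fun y => (κ y).toReal * ((1 + ‖y‖ ^ 2) ^ k)⁻¹) := by
  obtain ⟨hm, k, hk⟩ := hκ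
  refine ⟨k, ?_⟩
  have h1 := integrable_toReal_of_lintegral_ne_top
    (f := fun x => κ x * ENNReal.ofReal ((1 + ‖x‖ ^ 2) ^ (-(k : ℝ)))) (by fun_prop) hk.ne
  refine h1.congr (ae_of_all _ fun y => ?_)
  simp only
  rw [ENNReal.toReal_mul, ENNReal.toReal_ofReal (by positivity), Real.rpow_neg (by positivity),
    Real.rpow_natCast]

/-- Peetre's inequality. It lets the decay of a test function at `y + x` compensate the growth of
`κ` at `y`, at the cost of a polynomial weight in `x`. -/
theorem one_add_sq_le_mul (x y : Eu d) :
    1 + ‖y‖ ^ 2 ≤ 2 * (1 + ‖x‖ ^ 2) * (1 + ‖y + x‖ ^ 2) := by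
  have h1 : ‖y‖ ≤ ‖y + x‖ + ‖x‖ := by
    calc ‖y‖ = ‖(y + x) - x‖ := by simp
      _ ≤ _ := norm_sub_le _ _
  have h2 : ‖y‖ ^ 2 ≤ (‖y + x‖ + ‖x‖) ^ 2 := by gcongr
  nlinarith [sq_nonneg (‖y + x‖ - ‖x‖), sq_nonneg (‖x‖ * ‖y + x‖)]

/-- The convolution of `κ` with a rapidly decreasing function. -/
theorem convolution_pairing {κ : Eu d → ℝ≥0∞} (hκ : IsTempered κ) {a : Eu d → ℂ}
    (ha : Measurable a) (hai : ∀ k : ℕ, Integrable (fun x => (1 + ‖x‖ ^ 2) ^ k * ‖a x‖))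
    (ψ : 𝓢(Eu d, ℂ)) :
    Integrable (fun y => ((κ y).toReal : ℂ) * ∫ x, a x * ψ (y + x)) ∧
    Integrable (fun x => (∫ y, a (x - y) * ((κ y).toReal : ℂ)) * ψ x) ∧
    ∫ y, ((κ y).toReal : ℂ) * ∫ x, a x * ψ (y + x) =
      ∫ x, (∫ y, a (x - y) * ((κ y).toReal : ℂ)) * ψ x := by
  have hκm := hκ.1
  obtain ⟨k, hk⟩ := hκ.integrable
  obtain ⟨C, hC0, hC⟩ := exists_one_add_sq_pow_mul_norm_le ψ k
  have hψc := ψ.continuous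
  have hF : Integrable (fun z : Eu d × Eu d => ((κ z.1).toReal : ℂ) * (a z.2 * ψ (z.1 + z.2)))
      (volume.prod volume) := by
    refine ((hk.mul_prod (hai k)).const_mul (2 ^ k * C)).mono' ?_ (ae_of_all _ fun z => ?_)
    · have : Measurable fun z : Eu d × Eu d => ((κ z.1).toReal : ℂ) * (a z.2 * ψ (z.1 + z.2)) := by
        have := hψc.measurable
        fun_prop
      exact this.aestronglyMeasurable
    · obtain ⟨y, x⟩ := z
      simp only [norm_mul, Complex.norm_real, Real.norm_of_nonneg ENNReal.toReal_nonneg]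
      have h1 : (1 + ‖y‖ ^ 2) ^ k ≤ 2 ^ k * (1 + ‖x‖ ^ 2) ^ k * (1 + ‖y + x‖ ^ 2) ^ k := by
        rw [← mul_pow, ← mul_pow]
        exact pow_le_pow_left₀ (by positivity) (one_add_sq_le_mul x y) k
      have h2 : (1 + ‖y‖ ^ 2) ^ k * ‖ψ (y + x)‖ ≤ 2 ^ k * C * (1 + ‖x‖ ^ 2) ^ k := by
        calc (1 + ‖y‖ ^ 2) ^ k * ‖ψ (y + x)‖
            ≤ 2 ^ k * (1 + ‖x‖ ^ 2) ^ k * (1 + ‖y + x‖ ^ 2) ^ k * ‖ψ (y + x)‖ := by gcongr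
          _ = 2 ^ k * (1 + ‖x‖ ^ 2) ^ k * ((1 + ‖y + x‖ ^ 2) ^ k * ‖ψ (y + x)‖) := by ring
          _ ≤ 2 ^ k * (1 + ‖x‖ ^ 2) ^ k * C := by
              gcongr
              exact hC _
          _ = _ := by ring
      have h3 : ‖ψ (y + x)‖ ≤ ((1 + ‖y‖ ^ 2) ^ k)⁻¹ * (2 ^ k * C * (1 + ‖x‖ ^ 2) ^ k) := by
        rw [inv_mul_eq_div, le_div_iff₀ (by positivity), mul_comm]
        exact h2
      calc (κ y).toReal * (‖a x‖ * ‖ψ (y + x)‖)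
          ≤ (κ y).toReal * (‖a x‖ * (((1 + ‖y‖ ^ 2) ^ k)⁻¹ * (2 ^ k * C * (1 + ‖x‖ ^ 2) ^ k))) := by
            gcongr
        _ = _ := by ring
  -- The shear `(y, x) ↦ (y, y + x)` carries the absolutely integrable pairing to the form in which
  -- Fubini produces the convolution.
  have hshear := measurePreserving_prod_add (volume : Measure (Eu d)) (volume : Measure (Eu d))
  have hG : Integrable (fun z : Eu d × Eu d => ((κ z.1).toReal : ℂ) * (a (z.2 - z.1) * ψ z.2))
      (volume.prod volume) := by
    have hm : Measurable fun z : Eu d × Eu d => ((κ z.1).toReal : ℂ) * (a (z.2 - z.1) * ψ z.2) := by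
      have := hψc.measurable
      fun_prop
    refine (hshear.integrable_comp hm.aestronglyMeasurable).1 ?_
    refine hF.congr (ae_of_all _ fun z => ?_)
    simp
  have e1 : ∀ y, ∫ x, ((κ y).toReal : ℂ) * (a x * ψ (y + x)) =
      ((κ y).toReal : ℂ) * ∫ x, a x * ψ (y + x) := fun y => integral_const_mul _ _
  have e2 : ∀ x, ∫ y, ((κ y).toReal : ℂ) * (a (x - y) * ψ x) =
      (∫ y, a (x - y) * ((κ y).toReal : ℂ)) * ψ x := by
    intro x
    rw [← integral_mul_const]
    refine integral_congr_ae (ae_of_all _ fun y => ?_)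
    ring
  refine ⟨?_, ?_, ?_⟩
  · have := hF.integral_prod_left
    simpa only [e1] using this
  · have := hG.integral_prod_right
    simpa only [e2] using this
  · simp_rw [← e1, ← e2]
    refine Eq.trans ?_ (integral_integral_swap
      (f := fun y x => ((κ y).toReal : ℂ) * (a (x - y) * ψ x)) hG)
    refine integral_congr_ae (ae_of_all _ fun y => ?_)
    simp only
    rw [← integral_add_left_eq_self (fun x => ((κ y).toReal : ℂ) * (a (x - y) * ψ x)) y]
    simp only [add_sub_cancel_left]

end Pairing

end LevyColored

namespace LevyColored

/-! ### Moments of the noise -/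

section Intensity

variable {d : ℕ} {ν : Measure ℝ}

/-- The measure `z² ν` is finite, and `ν` has density `|z|^{-2}` with respect to it because `{0}` is
null. This is what permits Fubini on the intensity. -/
theorem IsJumpMeasure.sFinite (hν : IsJumpMeasure ν) : SFinite ν := by
  have hf : Measurable fun z : ℝ => ‖z‖ₑ ^ (2 : ℝ) := by fun_prop
  have h0 : ∀ᵐ z ∂ν, ‖z‖ₑ ^ (2 : ℝ) ≠ 0 := by
    have : ∀ᵐ z ∂ν, z ≠ 0 := by
      rw [ae_iff]
      simpa using hν.1
    filter_upwards [this] with z hz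
    simpa using hz
  have : IsFiniteMeasure (ν.withDensity fun z => ‖z‖ₑ ^ (2 : ℝ)) :=
    isFiniteMeasure_withDensity hν.2.ne
  have h := withDensity_inv_same hf h0 (ae_of_all _ fun z => by simp)
  rw [← h]
  infer_instance

theorem IsJumpMeasure.eq_zero (hν : IsJumpMeasure ν) (h : moment ν 2 = 0) : ν = 0 := by
  rw [moment, lintegral_eq_zero_iff (by fun_prop)] at h
  rw [← Measure.measure_univ_eq_zero]
  have h1 : ν (univ \ {0}) = 0 := by
    refine measure_mono_null ?_ h
    intro z hz
    simpa using hz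
  have : (univ : Set ℝ) = (univ \ {0}) ∪ {0} := by simp
  rw [this]
  exact measure_union_null h1 hν.1

theorem eLpNorm_ofReal_eq {α F : Type*} [MeasurableSpace α] [NormedAddCommGroup F]
    {μ : Measure α} (f : α → F) {p : ℝ} (hp : 0 < p) :
    eLpNorm f (ENNReal.ofReal p) μ = (∫⁻ x, ‖f x‖ₑ ^ p ∂μ) ^ (1 / p) := by
  rw [eLpNorm_eq_lintegral_rpow_enorm_toReal (by simpa using hp) ENNReal.ofReal_ne_top,
    ENNReal.toReal_ofReal hp.le]

theorem eLpNorm_mul_intensity (hν : IsJumpMeasure ν) {f : Eu d → ℝ}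
    (hf : AEStronglyMeasurable f) {p : ℝ} (hp : 0 < p) :
    eLpNorm (fun q : Eu d × ℝ => f q.1 * q.2) (ENNReal.ofReal p) (intensity d ν) =
      eLpNorm f (ENNReal.ofReal p) volume * moment ν p ^ (1 / p) := by
  have := hν.sFinite
  rw [eLpNorm_ofReal_eq _ hp, eLpNorm_ofReal_eq _ hp, moment, ← ENNReal.mul_rpow_of_nonneg _ _
    (by positivity : 0 ≤ 1 / p), intensity, ← lintegral_prod_mul (by fun_prop) (by fun_prop)]
  simp_rw [enorm_mul, ENNReal.mul_rpow_of_nonneg _ _ hp.le]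

theorem aestronglyMeasurable_mul_intensity (hν : IsJumpMeasure ν) {f : Eu d → ℝ}
    (hf : AEStronglyMeasurable f) :
    AEStronglyMeasurable (fun q : Eu d × ℝ => f q.1 * q.2) (intensity d ν) := by
  have := hν.sFinite
  exact hf.comp_fst.mul (by fun_prop)

end Intensity

/-! ### The spectral norm as a bound for convolutions with `κ` -/

section Spectral

variable {d : ℕ}

theorem hasFourier_kernelFourier {κ : Eu d → ℝ≥0∞} (h : ∃ h, HasFourier (funPairing κ) h) :
    HasFourier (funPairing κ) (kernelFourier κ) := by
  rw [kernelFourier, dif_pos h]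
  exact h.choose_spec

theorem exists_hasFourier_of_spectralNormSq_lt {κ : Eu d → ℝ≥0∞} {T : 𝓢(Eu d, ℂ) → ℂ} {ε : ℝ≥0∞}
    (h : spectralNormSq κ T < ε) :
    ∃ g, HasFourier T g ∧ ∫⁻ ξ, ‖g ξ‖ₑ ^ 2 ∂(spectralMeasure κ) < ε := by
  simpa only [spectralNormSq, iInf_lt_iff, exists_prop] using h

theorem lintegral_comp_const_smul (f : Eu d → ℝ≥0∞) {r : ℝ} (hr : 0 < r) :
    ∫⁻ x, f (r • x) = ENNReal.ofReal (r ^ (-(d : ℝ))) * ∫⁻ x, f x := by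
  have h := Measure.map_addHaar_smul (volume : Measure (Eu d)) hr.ne'
  have e : (fun x : Eu d => r • x) = (Homeomorph.smulOfNeZero r hr.ne').toMeasurableEquiv := rfl
  have h2 := lintegral_map_equiv (μ := (volume : Measure (Eu d))) f
    (Homeomorph.smulOfNeZero r hr.ne').toMeasurableEquiv
  rw [← e] at h2
  change _ = ∫⁻ x, f (r • x) at h2
  rw [← h2]
  change ∫⁻ x, f x ∂(Measure.map (r • ·) volume) = _
  rw [h, lintegral_smul_measure, finrank_euclideanSpace_fin, abs_of_pos (by positivity),
    Real.rpow_neg hr.le, Real.rpow_natCast, smul_eq_mul]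

/-- The constant `(2π)^{-d}` of the spectral measure is the Jacobian of `ξ ↦ 2πξ`, which relates the
two conventions for the Fourier transform. -/
theorem lintegral_spectralMeasure {κ : Eu d → ℝ≥0∞} (hκ : ∃ h, HasFourier (funPairing κ) h)
    {g : Eu d → ℂ} (hg : AEStronglyMeasurable g) :
    ∫⁻ ξ, ‖kernelFourier κ ((2 * Real.pi) • ξ) * g ((2 * Real.pi) • ξ)‖ₑ ^ 2 =
      ∫⁻ ξ, ‖g ξ‖ₑ ^ 2 ∂(spectralMeasure κ) := by
  have hm := (hasFourier_kernelFourier hκ).1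
  rw [lintegral_comp_const_smul (fun ξ => ‖kernelFourier κ ξ * g ξ‖ₑ ^ 2) (by positivity),
    spectralMeasure, lintegral_withDensity_eq_lintegral_mul₀ (by fun_prop) (by fun_prop),
    ← lintegral_const_mul' _ _ ENNReal.ofReal_ne_top]
  refine lintegral_congr fun ξ => ?_
  simp only [Pi.mul_apply, enorm_mul]
  ring

/-- The convolution theorem followed by Cauchy–Schwarz: tested against `𝓕 φ`, the convolution with
`κ` is controlled by the spectral norm alone. The norm being an infimum, the bound is phrased with
an `ε` strictly above it. -/
theorem enorm_integral_mul_shift_fourier_le {κ : Eu d → ℝ≥0∞}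
    (hκ : ∃ h, HasFourier (funPairing κ) h) {T : 𝓢(Eu d, ℂ) → ℂ} (hT : HasLocallyBoundedFourier T)
    {ε : ℝ≥0∞} (hε : spectralNormSq κ T < ε) (φ : 𝓢(Eu d, ℂ)) (hφ : HasCompactSupport φ)
    (hint : Integrable (fun y => ((κ y).toReal : ℂ) * T (shift y (𝓕 φ)))) :
    ‖∫ y, ((κ y).toReal : ℂ) * T (shift y (𝓕 φ))‖ₑ ≤
      ε ^ (1 / 2 : ℝ) * (∫⁻ x, ‖φ x‖ₑ ^ (2 : ℝ)) ^ (1 / 2 : ℝ) := by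
  obtain ⟨g, hg, hgε⟩ := exists_hasFourier_of_spectralNormSq_lt hε
  have hm := (hasFourier_kernelFourier hκ).1
  have hgm := hg.1
  rw [integral_mul_shift_fourier hT hg (hasFourier_kernelFourier hκ) φ hφ hint]
  refine (enorm_integral_le_lintegral_enorm _).trans ?_
  simp_rw [← mul_assoc, enorm_mul (_ * _) (φ _)]
  have hq : Measure.QuasiMeasurePreserving (fun x : Eu d => (2 * Real.pi) • x) volume volume := by
    refine ⟨by fun_prop, ?_⟩
    rw [Measure.map_addHaar_smul _ (by positivity)]
    exact Measure.smul_absolutelyContinuous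
  have h1 : AEMeasurable (fun ξ : Eu d =>
      ‖kernelFourier κ ((2 * Real.pi) • ξ) * g ((2 * Real.pi) • ξ)‖ₑ) :=
    ((hm.mul hgm).comp_quasiMeasurePreserving hq).enorm
  have h2 := ENNReal.lintegral_mul_le_Lp_mul_Lq (volume : Measure (Eu d))
    Real.HolderConjugate.two_two h1 (g := fun ξ => ‖φ ξ‖ₑ) φ.continuous.measurable.enorm.aemeasurable
  refine h2.trans ?_
  gcongr
  refine le_of_eq_of_le ?_ hgε.le
  rw [← lintegral_spectralMeasure hκ hgm]
  simp only [ENNReal.rpow_two]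

end Spectral

/-! ### Noise integrals as Lévy integrals -/

section Identification

variable {d : ℕ}

theorem hasLocallyBoundedFourier_integral {a : Eu d → ℂ} (ha : Integrable a) :
    HasLocallyBoundedFourier (fun ψ => ∫ x, a x * ψ x) := by
  refine fun R => ⟨∫ x, ‖a x‖, fun φ _ => ?_⟩
  rw [← integral_mul_const]
  refine norm_integral_le_of_norm_le (ha.norm.mul_const _) (ae_of_all _ fun x => ?_)
  rw [norm_mul]
  gcongr
  exact norm_fourier_le_integral (fun x => φ x) x

theorem HasLocallyBoundedFourier.sub {S T : 𝓢(Eu d, ℂ) → ℂ} (hS : HasLocallyBoundedFourier S)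
    (hT : HasLocallyBoundedFourier T) : HasLocallyBoundedFourier (fun ψ => S ψ - T ψ) := by
  intro R
  obtain ⟨C, hC⟩ := hS R
  obtain ⟨D, hD⟩ := hT R
  refine ⟨C + D, fun φ hφ => ?_⟩
  rw [add_mul]
  exact (norm_sub_le _ _).trans (add_le_add (hC φ hφ) (hD φ hφ))

/-- The convolution of the functional `S` with `κ` is the function `g`. -/
def HasConvolution (S : 𝓢(Eu d, ℂ) → ℂ) (κ : Eu d → ℝ≥0∞) (g : Eu d → ℂ) : Prop :=
  AEStronglyMeasurable g volume ∧ ∀ φ : 𝓢(Eu d, ℂ),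
    Integrable (fun y => ((κ y).toReal : ℂ) * S (shift y φ)) volume ∧
    Integrable (fun y => g y * φ y) volume ∧
      ∫ y, ((κ y).toReal : ℂ) * S (shift y φ) = ∫ y, g y * φ y

theorem measurable_testConv {κ : Eu d → ℝ≥0∞} (hκ : Measurable κ) (φ : 𝓢(Eu d, ℝ)) :
    Measurable (testConv φ κ) := by
  have : Measurable (Function.uncurry fun x y : Eu d => φ (x - y) * (κ y).toReal) := by
    have := φ.continuous.measurable
    unfold Function.uncurry
    fun_prop
  exact (this.stronglyMeasurable.integral_prod_right (ν := volume)).measurable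

theorem hasConvolution_of_integrable {κ : Eu d → ℝ≥0∞} (hκ : IsTempered κ) {a : Eu d → ℂ}
    (ha : Measurable a) (hai : ∀ k : ℕ, Integrable (fun x => (1 + ‖x‖ ^ 2) ^ k * ‖a x‖)) :
    HasConvolution (fun ψ => ∫ x, a x * ψ x) κ (fun x => ∫ y, a (x - y) * ((κ y).toReal : ℂ)) := by
  refine ⟨?_, fun ψ => ?_⟩
  · have hκm := hκ.1
    have : Measurable (Function.uncurry fun x y : Eu d => a (x - y) * ((κ y).toReal : ℂ)) := by
      unfold Function.uncurry
      fun_prop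
    exact (this.stronglyMeasurable.integral_prod_right (ν := volume)).aestronglyMeasurable
  · simp only [shift_apply]
    exact convolution_pairing hκ ha hai ψ

theorem integrable_one_add_sq_pow_mul_schwartz (φ : 𝓢(Eu d, ℝ)) (k : ℕ) :
    Integrable (fun x => (1 + ‖x‖ ^ 2) ^ k * ‖((φ x : ℝ) : ℂ)‖) := by
  have h := SchwartzMap.integrable
    (SchwartzMap.smulLeftCLM ℝ (fun x : Eu d => (1 + ‖x‖ ^ 2) ^ k) φ) (μ := volume)
  have ht : (fun x : Eu d => (1 + ‖x‖ ^ 2) ^ k).HasTemperateGrowth := by fun_prop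
  refine h.norm.congr (ae_of_all _ fun x => ?_)
  simp only [SchwartzMap.smulLeftCLM_apply_apply ht, norm_smul, Complex.norm_real]
  rw [Real.norm_of_nonneg (by positivity)]

theorem hasConvolution_testConv {κ : Eu d → ℝ≥0∞} (hκ : IsTempered κ) (φ : 𝓢(Eu d, ℝ)) :
    HasConvolution (fun ψ => ∫ x, ((φ x : ℝ) : ℂ) * ψ x) κ
      (fun x => ((testConv φ κ x : ℝ) : ℂ)) := by
  have hm := φ.continuous.measurable
  have h := hasConvolution_of_integrable hκ (a := fun x => ((φ x : ℝ) : ℂ)) (by fun_prop)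
    (integrable_one_add_sq_pow_mul_schwartz φ)
  convert h using 2 with x
  refine (integral_complex_ofReal (f := fun y => φ (x - y) * (κ y).toReal)).symm.trans ?_
  simp

theorem HasConvolution.sub {S T : 𝓢(Eu d, ℂ) → ℂ} {κ : Eu d → ℝ≥0∞} {g k : Eu d → ℂ}
    (hS : HasConvolution S κ g) (hT : HasConvolution T κ k) :
    HasConvolution (fun ψ => S ψ - T ψ) κ (fun x => g x - k x) := by
  refine ⟨hS.1.sub hT.1, fun φ => ?_⟩
  obtain ⟨h1, h2, h3⟩ := hS.2 φ
  obtain ⟨k1, k2, k3⟩ := hT.2 φ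
  simp only [mul_sub, sub_mul]
  exact ⟨h1.sub k1, h2.sub k2, by rw [integral_sub h1 k1, integral_sub h2 k2, h3, k3]⟩

theorem enorm_integral_sub_mul_fourier_le {κ : Eu d → ℝ≥0∞} (hκ : IsTempered κ)
    (hκf : ∃ h, HasFourier (funPairing κ) h) {S : 𝓢(Eu d, ℂ) → ℂ} (hS : HasLocallyBoundedFourier S)
    {g : Eu d → ℂ} (hg : HasConvolution S κ g) (φ : 𝓢(Eu d, ℝ)) {ε : ℝ≥0∞}
    (hε : spectralNormSq κ (fun ψ => (∫ x, ((φ x : ℝ) : ℂ) * ψ x) - S ψ) < ε)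
    (ψ : 𝓢(Eu d, ℂ)) (hψ : HasCompactSupport ψ) :
    ‖∫ x, (((testConv φ κ x : ℝ) : ℂ) - g x) * (𝓕 ψ) x‖ₑ ≤
      ε ^ (1 / 2 : ℝ) * (∫⁻ x, ‖ψ x‖ₑ ^ (2 : ℝ)) ^ (1 / 2 : ℝ) := by
  have h1 := (hasConvolution_testConv hκ φ).sub hg
  have h2 : Integrable (fun x => ((φ x : ℝ) : ℂ)) := φ.integrable.ofReal
  rw [← (h1.2 (𝓕 ψ)).2.2]
  exact enorm_integral_mul_shift_fourier_le hκf ((hasLocallyBoundedFourier_integral h2).sub hS)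
    hε ψ hψ (h1.2 (𝓕 ψ)).1

variable {Ω : Type u} {mΩ : MeasurableSpace Ω} {P : Measure Ω} [IsProbabilityMeasure P]
  {ν : Measure ℝ} {N : Ω → Measure (Eu d × ℝ)} {κ : Eu d → ℝ≥0∞} {S : 𝓢(Eu d, ℂ) → ℂ} {Y : Ω → ℝ}

theorem eLpNorm_mul_intensity_two (hν : IsJumpMeasure ν) {f : Eu d → ℝ}
    (hf : AEStronglyMeasurable f) :
    eLpNorm (fun q : Eu d × ℝ => f q.1 * q.2) 2 (intensity d ν) =
      eLpNorm f 2 volume * moment ν 2 ^ (1 / 2 : ℝ) := by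
  have h := eLpNorm_mul_intensity hν hf two_pos
  rwa [ENNReal.ofReal_ofNat] at h

/-- The integral of `S` with respect to the noise is the Lévy integral of `S * κ`. -/
theorem IsNoiseIntegral.isLevyIntegral (hν : IsJumpMeasure ν) (hν0 : moment ν 2 ≠ 0)
    (hN : IsPoissonRandomMeasure P (intensity d ν) N) (hκ : IsTempered κ)
    (hκf : ∃ h, HasFourier (funPairing κ) h) (hS : HasLocallyBoundedFourier S)
    (hY : IsNoiseIntegral P ν N κ S Y) {g : Eu d → ℂ} (hg : HasConvolution S κ g)
    (hg2 : MemLp g 2 volume) : IsLevyIntegral P ν N (fun x => (g x).re) Y := by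
  obtain ⟨hYm, φ, W, -, hW, hφ, hWY⟩ := hY
  set c : ℕ → Eu d → ℝ := fun n => testConv (φ n) κ with hc
  have hcm : ∀ n, AEStronglyMeasurable (c n) volume := fun n =>
    (measurable_testConv hκ.1 (φ n)).aestronglyMeasurable
  set M : ℝ≥0∞ := moment ν 2 ^ (1 / 2 : ℝ) with hM
  have hM0 : M ≠ 0 := by
    rw [hM]
    simpa using hν0
  have hMt : M ≠ ⊤ := by
    rw [hM]
    simpa using hν.2.ne
  have hc2 : ∀ n, MemLp (c n) 2 volume := by
    intro n
    refine ⟨hcm n, ?_⟩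
    have h1 := (hW n).1.2
    rw [eLpNorm_mul_intensity_two hν (hcm n)] at h1
    exact (ENNReal.mul_lt_top_iff.1 h1).elim (fun h => h.1) fun h => h.elim
      (fun h => by rw [h]; exact ENNReal.zero_lt_top) fun h => absurd h hM0
  -- The isometry read backwards: convergence of the integrals `W n` forces the convolutions `c n`
  -- to be Cauchy in `L²(ℝᵈ)`. Dividing by `M` uses that the second moment of `ν` is neither zero
  -- nor infinite.
  have hcc : ∀ n k, eLpNorm (fun x => c n x - c k x) 2 volume ≤
      eLpNorm (fun ω => W n ω - Y ω) 2 P * M⁻¹ + eLpNorm (fun ω => W k ω - Y ω) 2 P * M⁻¹ := by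
    intro n k
    have h1 := IsCompensatedIntegral.eLpNorm_sub hN (hW n) (hW k)
    have h3 : eLpNorm (fun ω => W n ω - W k ω) 2 P =
        eLpNorm (fun x => c n x - c k x) 2 volume * M := by
      refine h1.trans (Eq.trans ?_ (eLpNorm_mul_intensity_two hν ((hcm n).sub (hcm k))))
      congr 1
      ext q
      simp [hc, sub_mul]
    rw [← add_mul, ← div_eq_mul_inv, ENNReal.le_div_iff_mul_le (Or.inl hM0) (Or.inl hMt), ← h3]
    have h4 : (fun ω => W n ω - W k ω) = (fun ω => W n ω - Y ω) + fun ω => Y ω - W k ω := by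
      ext ω
      simp
    rw [h4, eLpNorm_fun_sub_comm (fun ω => W k ω) Y]
    exact eLpNorm_add_le ((hW n).2.1.sub hYm) (hYm.sub (hW k).2.1) one_le_two
  obtain ⟨h₀, hh₀, hlim⟩ := exists_tendsto_eLpNorm_of_cauchy hc2
    (by simpa using ENNReal.Tendsto.mul_const hWY (Or.inr (ENNReal.inv_ne_top.2 hM0))) hcc
  have hh₀c : MemLp (fun x => ((h₀ x : ℝ) : ℂ)) 2 volume := hh₀.ofReal
  -- The `L²` limit `h₀` is compared with `g` in the weak sense, through `c n`: the difference `h₀ -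
  -- c n` is small in `L²`, and `c n - g` is the convolution of `κ` with a functional of small
  -- spectral norm.
  have hpair : ∀ ψ : 𝓢(Eu d, ℂ), HasCompactSupport ψ →
      ∫ x, (((h₀ x : ℝ) : ℂ) - g x) * (𝓕 ψ) x = 0 := by
    intro ψ hψ
    set A := (∫⁻ x, ‖ψ x‖ₑ ^ (2 : ℝ)) ^ (1 / 2 : ℝ) with hA
    have hA2 : A ≠ ⊤ := by
      have := (ψ.memLp (ENNReal.ofReal 2) volume).2
      rw [eLpNorm_ofReal_eq _ two_pos] at this
      exact this.ne
    set B := eLpNorm (𝓕 ψ : 𝓢(Eu d, ℂ)) 2 volume with hB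
    have hBt : B ≠ ⊤ := ((𝓕 ψ : 𝓢(Eu d, ℂ)).memLp 2 volume).2.ne
    have hψ2 := (𝓕 ψ : 𝓢(Eu d, ℂ)).memLp 2 volume
    set s : ℕ → ℝ≥0∞ := fun n => spectralNormSq κ (fun ψ => (∫ x, ((φ n x : ℝ) : ℂ) * ψ x) - S ψ)
    -- The term `1/n` provides the strict inequality required by a norm defined as an infimum; for
    -- this `s n` must be finite, which holds eventually.
    have hb : ∀ᶠ n in atTop, ‖∫ x, (((h₀ x : ℝ) : ℂ) - g x) * (𝓕 ψ) x‖ₑ ≤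
        eLpNorm (fun x => c n x - h₀ x) 2 volume * B +
          (s n + (n : ℝ≥0∞)⁻¹) ^ (1 / 2 : ℝ) * A := by
      filter_upwards [hφ.eventually_lt_const ENNReal.zero_lt_top, eventually_gt_atTop 0] with n hn hn0
      have hcn : MemLp (fun x => ((c n x : ℝ) : ℂ)) 2 volume := (hc2 n).ofReal
      have h1 := enorm_integral_sub_mul_fourier_le hκ hκf hS hg (φ n)
        (ε := s n + (n : ℝ≥0∞)⁻¹) (ENNReal.lt_add_right hn.ne (by simp)) ψ hψ
      have i1 : Integrable (fun x => (((h₀ x : ℝ) : ℂ) - ((c n x : ℝ) : ℂ)) * (𝓕 ψ) x) :=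
        (hh₀c.sub hcn).integrable_mul hψ2
      have i2 : Integrable (fun x => (((c n x : ℝ) : ℂ) - g x) * (𝓕 ψ) x) :=
        (hcn.sub hg2).integrable_mul hψ2
      have e : ∫ x, (((h₀ x : ℝ) : ℂ) - g x) * (𝓕 ψ) x =
          (∫ x, (((h₀ x : ℝ) : ℂ) - ((c n x : ℝ) : ℂ)) * (𝓕 ψ) x) +
            ∫ x, (((c n x : ℝ) : ℂ) - g x) * (𝓕 ψ) x := by
        rw [← integral_add i1 i2]
        refine integral_congr_ae (ae_of_all _ fun x => ?_)
        ring
      rw [e]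
      refine (enorm_add_le _ _).trans (add_le_add ?_ h1)
      refine (enorm_integral_le_lintegral_enorm _).trans ?_
      simp_rw [enorm_mul]
      have h2 := ENNReal.lintegral_mul_le_Lp_mul_Lq (volume : Measure (Eu d))
        Real.HolderConjugate.two_two (hh₀c.1.sub hcn.1).enorm
        (g := fun ξ => ‖(𝓕 ψ) ξ‖ₑ) (𝓕 ψ).continuous.measurable.enorm.aemeasurable
      refine h2.trans (le_of_eq ?_)
      rw [← eLpNorm_ofReal_eq _ two_pos, ← eLpNorm_ofReal_eq _ two_pos, ENNReal.ofReal_ofNat]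
      congr 1
      rw [eLpNorm_fun_sub_comm]
      refine eLpNorm_congr_norm_ae (ae_of_all _ fun x => ?_)
      simp only [Pi.sub_apply]
      rw [← Complex.ofReal_sub, Complex.norm_real, norm_sub_rev]
    have hl : Tendsto (fun n => eLpNorm (fun x => c n x - h₀ x) 2 volume * B +
        (s n + (n : ℝ≥0∞)⁻¹) ^ (1 / 2 : ℝ) * A) atTop (𝓝 0) := by
      have l1 := ENNReal.Tendsto.mul_const hlim (Or.inr hBt)
      have l2 : Tendsto (fun n => (s n + (n : ℝ≥0∞)⁻¹) ^ (1 / 2 : ℝ)) atTop (𝓝 0) := by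
        have := (hφ.add ENNReal.tendsto_inv_nat_nhds_zero).ennrpow_const (1 / 2 : ℝ)
        simpa using this
      have l3 := ENNReal.Tendsto.mul_const l2 (Or.inr hA2)
      simpa using l1.add l3
    have := ge_of_tendsto hl hb
    simpa using this
  have hae : (fun x => ((h₀ x : ℝ) : ℂ) - g x) =ᵐ[volume] 0 :=
    ae_eq_zero_of_integral_mul_fourier (hh₀c.sub hg2) hpair
  -- As a limit of real functions `h₀` is real, so `g` is real almost everywhere and taking its real
  -- part loses nothing.
  have hre : h₀ =ᵐ[volume] fun x => (g x).re := by
    filter_upwards [hae] with x hx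
    have := sub_eq_zero.1 hx
    rw [← this, Complex.ofReal_re]
  have hgre : MemLp (fun x => (g x).re) 2 volume := hh₀.ae_eq hre
  refine isCompensatedIntegral_of_tendsto hN hW ⟨aestronglyMeasurable_mul_intensity hν hgre.1, ?_⟩
    hYm ?_ hWY
  · rw [eLpNorm_mul_intensity_two hν hgre.1]
    exact ENNReal.mul_lt_top hgre.2 hMt.lt_top
  · have := ENNReal.Tendsto.mul_const hlim (Or.inr hMt)
    rw [zero_mul] at this
    refine this.congr fun n => ?_
    have h5 : eLpNorm (fun x => c n x - h₀ x) 2 volume =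
        eLpNorm (fun x => c n x - (g x).re) 2 volume := by
      refine eLpNorm_congr_ae ?_
      filter_upwards [hre] with x hx
      rw [hx]
    rw [h5]
    refine (eLpNorm_mul_intensity_two hν ((hcm n).sub hgre.1)).symm.trans ?_
    congr 1
    ext q
    simp [hc, sub_mul]

/-- Every integral with respect to the noise vanishes if there are no jumps. -/
theorem IsNoiseIntegral.eLpNorm_eq_zero (hν : ν = 0)
    (hN : IsPoissonRandomMeasure P (intensity d ν) N) (hY : IsNoiseIntegral P ν N κ S Y)
    (p : ℝ≥0∞) : eLpNorm Y p P = 0 := by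
  obtain ⟨hYm, φ, W, -, hW, -, hWY⟩ := hY
  obtain ⟨B, -, hB⟩ := exists_eLpNorm_compensatedIntegral_le.{u} le_rfl
  have hI : intensity d ν = 0 := by
    rw [intensity, hν, Measure.prod_zero]
  have h0 : ∀ n, W n =ᵐ[P] 0 := by
    intro n
    have h1 := hB _ Ω P _ N hN _ _ (hW n) (by rw [hI]; simp)
    rw [hI] at h1
    simp only [eLpNorm_measure_zero, add_zero, mul_zero, nonpos_iff_eq_zero] at h1
    exact (eLpNorm_eq_zero_iff (hW n).2.1 (by simp)).1 h1
  have h1 : ∀ n, eLpNorm (fun ω => W n ω - Y ω) 2 P = eLpNorm Y 2 P := by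
    intro n
    rw [← eLpNorm_neg]
    refine eLpNorm_congr_ae ?_
    filter_upwards [h0 n] with ω hω
    simp [hω]
  simp_rw [h1] at hWY
  have h2 := tendsto_nhds_unique hWY tendsto_const_nhds
  have h3 := (eLpNorm_eq_zero_iff hYm two_ne_zero).1 h2.symm
  rw [eLpNorm_congr_ae h3, eLpNorm_zero]

end Identification

end LevyColored

namespace LevyColored

/-! ### Distributions with rapid decrease -/

section RapidDecrease

variable {d : ℕ}

theorem contDiff_one_add_sq_rpow (r : ℝ) :
    ContDiff ℝ (⊤ : ℕ∞) (fun x : Eu d => (1 + ‖x‖ ^ 2) ^ r) :=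
  ContDiff.rpow_const_of_ne (contDiff_const.add (contDiff_norm_sq ℝ)) fun x => by positivity

theorem fderiv_one_add_sq_rpow (r : ℝ) :
    fderiv ℝ (fun x : Eu d => (1 + ‖x‖ ^ 2) ^ r) =
      fun x => (1 + ‖x‖ ^ 2) ^ (r - 1) • ((2 * r) • innerSL ℝ (E := Eu d)) x := by
  ext1 x
  have h1 := ((hasStrictFDerivAt_norm_sq (F := Eu d) x).hasFDerivAt.const_add 1).rpow_const
    (p := r) (Or.inl (by positivity))
  rw [h1.fderiv]
  ext v
  simp
  ring

theorem norm_iteratedFDeriv_clm_le {E F : Type*} [NormedAddCommGroup E] [NormedSpace ℝ E]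
    [NormedAddCommGroup F] [NormedSpace ℝ F] (L : E →L[ℝ] F) (l : ℕ) (x : E) :
    ‖iteratedFDeriv ℝ l L x‖ ≤ ‖L‖ * (1 + ‖x‖) := by
  rcases l with _ | _ | l
  · rw [norm_iteratedFDeriv_zero]
    refine (L.le_opNorm x).trans ?_
    gcongr
    linarith
  · rw [zero_add, norm_iteratedFDeriv_one, L.fderiv]
    exact le_mul_of_one_le_right (norm_nonneg _) (by linarith [norm_nonneg x])
  · rw [← norm_iteratedFDeriv_fderiv]
    have : fderiv ℝ L = fun _ => L := by
      ext1 y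
      exact L.fderiv
    rw [this, iteratedFDeriv_succ_const]
    simp only [Pi.zero_apply, norm_zero]
    positivity

/-- The derivative of the power `r` is `2r x` times the power `r - 1`. By Leibniz's rule and
induction, with `r` varying, one linear factor `1 + |x| ≤ 2 (1 + |x|²)` restores the exponent. -/
theorem exists_norm_iteratedFDeriv_one_add_sq_rpow_le (j : ℕ) : ∀ r : ℝ, ∃ C : ℝ, 0 ≤ C ∧
    ∀ x : Eu d, ‖iteratedFDeriv ℝ j (fun x : Eu d => (1 + ‖x‖ ^ 2) ^ r) x‖ ≤
      C * (1 + ‖x‖ ^ 2) ^ r := by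
  induction j using Nat.strong_induction_on with
  | _ j ih =>
    intro r
    rcases j with _ | j
    · refine ⟨1, zero_le_one, fun x => ?_⟩
      rw [norm_iteratedFDeriv_zero, Real.norm_of_nonneg (by positivity), one_mul]
    · have ih' : ∀ i, ∃ C : ℝ, 0 ≤ C ∧ (i ≤ j → ∀ x : Eu d,
          ‖iteratedFDeriv ℝ i (fun x : Eu d => (1 + ‖x‖ ^ 2) ^ (r - 1)) x‖ ≤
            C * (1 + ‖x‖ ^ 2) ^ (r - 1)) := by
        intro i
        by_cases hi : i ≤ j
        · obtain ⟨C, hC0, hC⟩ := ih i (by omega) (r - 1)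
          exact ⟨C, hC0, fun _ => hC⟩
        · exact ⟨0, le_rfl, fun h => absurd h hi⟩
      choose C hC0 hC using ih'
      set L : Eu d →L[ℝ] Eu d →L[ℝ] ℝ := (2 * r) • innerSL ℝ (E := Eu d) with hL
      have hsum : 0 ≤ ∑ i ∈ Finset.range (j + 1), (j.choose i : ℝ) * C i * ‖L‖ :=
        Finset.sum_nonneg fun i _ => by
          have := hC0 i
          positivity
      refine ⟨(∑ i ∈ Finset.range (j + 1), (j.choose i : ℝ) * C i * ‖L‖) * 2,
        mul_nonneg hsum two_pos.le, fun x => ?_⟩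
      rw [← norm_iteratedFDeriv_fderiv, fderiv_one_add_sq_rpow]
      refine (norm_iteratedFDeriv_smul_le (contDiff_one_add_sq_rpow (r - 1)) L.contDiff x
        (mod_cast le_top)).trans ?_
      have h2 : (1 + ‖x‖ ^ 2) ^ (r - 1) * (1 + ‖x‖) ≤ 2 * (1 + ‖x‖ ^ 2) ^ r := by
        have h3 : (1 + ‖x‖ ^ 2) ^ r = (1 + ‖x‖ ^ 2) ^ (r - 1) * (1 + ‖x‖ ^ 2) := by
          rw [← Real.rpow_add_one (by positivity), sub_add_cancel]
        rw [h3, mul_left_comm]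
        gcongr
        nlinarith [sq_nonneg (‖x‖ - 1)]
      calc _ ≤ ∑ i ∈ Finset.range (j + 1), (j.choose i : ℝ) * (C i * (1 + ‖x‖ ^ 2) ^ (r - 1)) *
            (‖L‖ * (1 + ‖x‖)) := by
            refine Finset.sum_le_sum fun i hi => ?_
            have := hC i (by simpa [Nat.lt_succ_iff] using hi) x
            have h0 := hC0 i
            gcongr
            exact norm_iteratedFDeriv_clm_le L _ x
        _ = (∑ i ∈ Finset.range (j + 1), (j.choose i : ℝ) * C i * ‖L‖) *
            ((1 + ‖x‖ ^ 2) ^ (r - 1) * (1 + ‖x‖)) := by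
            rw [Finset.sum_mul]
            exact Finset.sum_congr rfl fun i _ => by ring
        _ ≤ _ := by
            rw [mul_assoc]
            gcongr

/-- Bernstein's inequality: each derivative of the Fourier transform brings down a frequency, of
size at most `2πR` on the support of `φ`. Only the `L¹` norm of `φ` enters. -/
theorem norm_iteratedFDeriv_fourier_le {φ : 𝓢(Eu d, ℂ)} {R : ℝ}
    (hφ : ∀ ξ, R < ‖ξ‖ → φ ξ = 0) (j : ℕ) (x : Eu d) :
    ‖iteratedFDeriv ℝ j (𝓕 φ : 𝓢(Eu d, ℂ)) x‖ ≤ (2 * Real.pi * R) ^ j * ∫ ξ, ‖φ ξ‖ := by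
  have h := Real.iteratedFDeriv_fourier (N := ⊤) (n := j) (f := fun ξ => φ ξ)
    (fun n _ => φ.integrable_pow_mul volume n) φ.continuous.aestronglyMeasurable (mod_cast le_top)
  have e : ((𝓕 φ : 𝓢(Eu d, ℂ)) : Eu d → ℂ) = 𝓕 (fun ξ => φ ξ) := SchwartzMap.fourier_coe φ
  rw [e, h]
  refine (VectorFourier.norm_fourierIntegral_le_integral_norm _ _ _ _ _).trans ?_
  rw [← integral_const_mul]
  refine integral_mono_of_nonneg (ae_of_all _ fun _ => norm_nonneg _)
    (φ.integrable.norm.const_mul _) (ae_of_all _ fun ξ => ?_)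
  refine (VectorFourier.norm_fourierPowSMulRight_le _ _ _ _).trans ?_
  rcases lt_or_ge R ‖ξ‖ with h1 | h1
  · simp [hφ ξ h1]
  · rw [← mul_pow]
    have h2 : ‖innerSL ℝ (E := Eu d)‖ ≤ 1 := norm_innerSL_le ..
    refine mul_le_mul_of_nonneg_right (pow_le_pow_left₀ (by positivity) ?_ j) (norm_nonneg _)
    exact mul_le_mul (mul_le_of_le_one_right (by positivity) h2) h1 (norm_nonneg _) (by positivity)

/-- The decay assumption is applied with weight exponent `(d + 1) / 2` to `(1 + |x|²)^{-(d+1)/2} 𝓕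
φ`. By Leibniz's rule and Bernstein's inequality, its derivatives are at most a constant times
`‖φ‖₁` times the integrable weight `(1 + |x|²)^{-(d+1)/2}`. -/
theorem RapidDecrease.hasLocallyBoundedFourier {S : 𝓢'(Eu d, ℂ)} (hS : RapidDecrease S) :
    HasLocallyBoundedFourier (fun φ => S φ) := by
  intro R
  obtain ⟨C, m, hC⟩ := hS (d + 1)
  set r : ℝ := ((d + 1 : ℕ) : ℝ) / 2 with hr
  choose K hK0 hK using fun j => exists_norm_iteratedFDeriv_one_add_sq_rpow_le (d := d) j (-r)
  have hI : Integrable (fun x : Eu d => (1 + ‖x‖ ^ 2) ^ (-r)) := by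
    have := integrable_rpow_neg_one_add_norm_sq (E := Eu d) (μ := volume) (r := ((d + 1 : ℕ) : ℝ))
      (by simp)
    simpa only [hr, neg_div] using this
  set A : ℕ → ℝ := fun j => ∑ i ∈ Finset.range (j + 1),
    (j.choose i : ℝ) * K i * (2 * Real.pi * |R|) ^ (j - i) with hA
  have hA0 : ∀ j, 0 ≤ A j := fun j => Finset.sum_nonneg fun i _ => by
    have := hK0 i
    positivity
  set I := ∫ x : Eu d, (1 + ‖x‖ ^ 2) ^ (-r) with hI'
  refine ⟨|C| * ∑ j ∈ Finset.range (m + 1), A j * I, fun φ hφ => ?_⟩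
  have hg1 := Function.hasTemperateGrowth_one_add_norm_sq_rpow (Eu d) r
  have hg2 := Function.hasTemperateGrowth_one_add_norm_sq_rpow (Eu d) (-r)
  have e : SchwartzMap.smulLeftCLM ℂ (fun x : Eu d => (1 + ‖x‖ ^ 2) ^ r)
      (SchwartzMap.smulLeftCLM ℂ (fun x : Eu d => (1 + ‖x‖ ^ 2) ^ (-r)) (𝓕 φ)) = 𝓕 φ := by
    ext x
    rw [SchwartzMap.smulLeftCLM_apply_apply hg1, SchwartzMap.smulLeftCLM_apply_apply hg2, smul_smul,
      ← Real.rpow_add (by positivity), add_neg_cancel, Real.rpow_zero, one_smul]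
  have h1 := hC (SchwartzMap.smulLeftCLM ℂ (fun x : Eu d => (1 + ‖x‖ ^ 2) ^ (-r)) (𝓕 φ))
  rw [e] at h1
  refine h1.trans ((mul_le_mul_of_nonneg_right (le_abs_self C)
    (Finset.sum_nonneg fun _ _ => integral_nonneg fun _ => norm_nonneg _)).trans ?_)
  rw [mul_assoc, Finset.sum_mul]
  gcongr with j hj
  have hφ' : ∀ ξ, |R| < ‖ξ‖ → φ ξ = 0 := fun ξ hξ => hφ ξ ((le_abs_self R).trans_lt hξ)
  rw [mul_right_comm, hI', ← integral_const_mul]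
  refine integral_mono_of_nonneg (ae_of_all _ fun _ => norm_nonneg _)
    (hI.const_mul _) (ae_of_all _ fun x => ?_)
  simp only
  rw [SchwartzMap.smulLeftCLM_apply hg2]
  refine (norm_iteratedFDeriv_smul_le (contDiff_one_add_sq_rpow (-r)) (SchwartzMap.smooth _ ⊤) x
    (mod_cast le_top)).trans ?_
  calc _ ≤ ∑ i ∈ Finset.range (j + 1), (j.choose i : ℝ) * (K i * (1 + ‖x‖ ^ 2) ^ (-r)) *
        ((2 * Real.pi * |R|) ^ (j - i) * ∫ ξ, ‖φ ξ‖) := by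
        refine Finset.sum_le_sum fun i _ => ?_
        have h0 := hK0 i
        gcongr
        · exact hK i x
        · exact norm_iteratedFDeriv_fourier_le hφ' _ x
    _ = _ := by
        rw [hA, Finset.sum_mul, Finset.sum_mul]
        exact Finset.sum_congr rfl fun i _ => by ring

end RapidDecrease

/-! ### Reflected and translated functionals -/

section Reflect

variable {d : ℕ}

theorem reflect_fourier (φ : 𝓢(Eu d, ℂ)) : reflect (𝓕 φ) = 𝓕 (reflect φ) := by
  ext z
  rw [reflect_apply, SchwartzMap.fourier_coe, SchwartzMap.fourier_coe,
    ← Real.fourierInv_eq_fourier_neg, Real.fourierInv_eq_fourier_comp_neg]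
  rfl

theorem HasLocallyBoundedFourier.reflect_shift {S : 𝓢(Eu d, ℂ) → ℂ}
    (hS : HasLocallyBoundedFourier S) (x : Eu d) :
    HasLocallyBoundedFourier (fun φ => S (reflect (shift x φ))) := by
  intro R
  obtain ⟨C, hC⟩ := hS R
  refine ⟨C, fun φ hφ => ?_⟩
  have h := hC (reflect (modulate x φ)) (fun ξ hξ => by
    rw [reflect_apply, modulate_apply, hφ _ (by rwa [norm_neg]), smul_zero])
  rw [← reflect_fourier, fourier_modulate] at h
  refine h.trans (le_of_eq ?_)
  congr 1
  rw [← integral_neg_eq_self (fun ξ => ‖φ ξ‖)]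
  refine integral_congr_ae (ae_of_all _ fun ξ => ?_)
  simp only [reflect_apply, modulate_apply, Circle.norm_smul]

/-- The source of the reflected kernel in the moment inequality: convolving `S(x - ·)` with `κ` at
`y` is convolving `S` with `κ(-·)` at `x - y`. -/
theorem HasConvolution.reflect_shift {S : 𝓢(Eu d, ℂ) → ℂ} {κ : Eu d → ℝ≥0∞} {g : Eu d → ℂ}
    (h : HasConvolution S (reflectKernel κ) g) (x : Eu d) :
    HasConvolution (fun φ => S (reflect (shift x φ))) κ (fun y => g (x - y)) := by
  have hmp := (volume : Measure (Eu d)).measurePreserving_sub_left x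
  refine ⟨h.1.comp_measurePreserving hmp, fun φ => ?_⟩
  obtain ⟨h1, h2, h3⟩ := h.2 (reflect (shift x φ))
  have e1 : ∀ y, reflect (shift x (shift (-y) φ)) = shift y (reflect (shift x φ)) := by
    intro y
    ext z
    simp only [reflect_apply, shift_apply]
    congr 1
    abel
  have e2 : (fun y => ((κ (-y)).toReal : ℂ) * S (shift y (reflect (shift x φ)))) =
      fun y => ((κ (-y)).toReal : ℂ) * S (reflect (shift x (shift (-y) φ))) := by
    simp_rw [e1]
  have e3 : (fun y => g (x - y) * φ (x - (x - y))) = fun y => g (x - y) * φ y := by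
    simp
  simp only [reflectKernel] at h1 h3
  simp only [reflect_apply, shift_apply, ← sub_eq_add_neg] at h2 h3
  rw [e2] at h1 h3
  refine ⟨?_, ?_, ?_⟩
  · have := h1.comp_neg
    simpa only [neg_neg] using this
  · have := h2.comp_sub_left x
    simpa only [sub_sub_cancel] using this
  · rw [← integral_neg_eq_self, h3, ← integral_sub_left_eq_self _ volume x]
    simp only [sub_sub_cancel]

theorem HasConvolution.ae_eq {S : 𝓢(Eu d, ℂ) → ℂ} {κ : Eu d → ℝ≥0∞} {g k : Eu d → ℂ}
    (hg : HasConvolution S κ g) (hk : HasConvolution S κ k) : g =ᵐ[volume] k := by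
  have h1 : LocallyIntegrable (fun x => g x - k x) :=
    (locallyIntegrable_of_integrable_mul fun φ => (hg.2 φ).2.1).sub
      (locallyIntegrable_of_integrable_mul fun φ => (hk.2 φ).2.1)
  have h2 := ae_eq_zero_of_integral_mul_schwartz h1 fun φ _ => by
    simp only [sub_mul]
    rw [integral_sub (hg.2 φ).2.1 (hk.2 φ).2.1, ← (hg.2 φ).2.2, ← (hk.2 φ).2.2, sub_self]
  filter_upwards [h2] with x hx
  exact sub_eq_zero.1 hx

theorem convNorm_eq {S : 𝓢'(Eu d, ℂ)} {κ : Eu d → ℝ≥0∞} {g : Eu d → ℂ} (hg : HasConv S κ g)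
    (p : ℝ) : convNorm S κ p = eLpNorm g (ENNReal.ofReal p) volume := by
  refine le_antisymm (iInf₂_le g hg) (le_iInf₂ fun k hk => le_of_eq ?_)
  exact eLpNorm_congr_ae (HasConvolution.ae_eq (S := fun φ => S φ) hg hk)

theorem convNorm_eq_top {S : 𝓢'(Eu d, ℂ)} {κ : Eu d → ℝ≥0∞} (h : ¬ ∃ g, HasConv S κ g) (p : ℝ) :
    convNorm S κ p = ⊤ := by
  simp only [convNorm, iInf_eq_top]
  exact fun g hg => absurd ⟨g, hg⟩ h

theorem convNorm_le_of_forall {S : 𝓢'(Eu d, ℂ)} {κ κ' : Eu d → ℝ≥0∞}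
    (h : ∀ g, HasConv S κ g → ∃ g', HasConv S κ' g' ∧
      ∀ p : ℝ≥0∞, eLpNorm g' p volume = eLpNorm g p volume) (p : ℝ) :
    convNorm S κ' p ≤ convNorm S κ p := by
  refine le_iInf₂ fun g hg => ?_
  obtain ⟨g', hg', he⟩ := h g hg
  rw [← he]
  exact iInf₂_le g' hg'

theorem convNorm_reflectKernel_le_of_even {S : 𝓢'(Eu d, ℂ)} (hS : EvenDistribution S)
    (κ : Eu d → ℝ≥0∞) (p : ℝ) : convNorm S (reflectKernel κ) p ≤ convNorm S κ p := by
  refine convNorm_le_of_forall (fun g hg => ⟨fun y => g (-y), ⟨?_, fun φ => ?_⟩, fun p => ?_⟩) p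
  · exact hg.1.comp_measurePreserving (Measure.measurePreserving_neg volume)
  · obtain ⟨h1, h2, h3⟩ := hg.2 (reflect φ)
    have e1 : ∀ y, S (shift (-y) φ) = S (shift y (reflect φ)) := by
      intro y
      rw [← hS]
      congr 1
      ext z
      simp only [reflect_apply, shift_apply]
      congr 1
      abel
    simp only [← e1, reflect_apply] at h1 h2 h3
    simp only [reflectKernel]
    refine ⟨by simpa only [neg_neg] using h1.comp_neg, by simpa only [neg_neg] using h2.comp_neg, ?_⟩
    rw [← integral_neg_eq_self, ← integral_neg_eq_self (fun y => g (-y) * φ y)]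
    simpa only [neg_neg] using h3
  · exact eLpNorm_comp_measurePreserving hg.1 (Measure.measurePreserving_neg volume)

theorem HasConv.congr_kernel {S : 𝓢'(Eu d, ℂ)} {κ κ' : Eu d → ℝ≥0∞} {g : Eu d → ℂ}
    (h : HasConv S κ g) (hκ : κ =ᵐ[volume] κ') : HasConv S κ' g := by
  refine ⟨h.1, fun φ => ?_⟩
  obtain ⟨h1, h2, h3⟩ := h.2 φ
  have e : (fun y => ((κ y).toReal : ℂ) * S (shift y φ)) =ᵐ[volume]
      fun y => ((κ' y).toReal : ℂ) * S (shift y φ) := by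
    filter_upwards [hκ] with y hy
    rw [hy]
  exact ⟨h1.congr e, h2, by rw [← integral_congr_ae e, h3]⟩

theorem convNorm_reflectKernel_le_of_symm (S : 𝓢'(Eu d, ℂ)) {κ : Eu d → ℝ≥0∞}
    (hκ : ∀ᵐ x, κ (-x) = κ x) (p : ℝ) : convNorm S (reflectKernel κ) p ≤ convNorm S κ p := by
  refine convNorm_le_of_forall (fun g hg => ⟨g, hg.congr_kernel ?_, fun _ => rfl⟩) p
  filter_upwards [hκ] with x hx
  exact hx.symm

end Reflect

end LevyColored

namespace LevyColored

/-! ### The moment inequality -/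

section Moment

theorem exists_eLpNorm_noiseIntegral_le {p : ℝ} (hp : 2 ≤ p) : ∃ B : ℝ, 0 < B ∧
    ∀ (d : ℕ) (ν : Measure ℝ), IsJumpMeasure ν → moment ν p < ⊤ →
    ∀ κ : Eu d → ℝ≥0∞, IsTempered κ → (∃ h, HasFourier (funPairing κ) h) →
    ∀ S : 𝓢'(Eu d, ℂ), HasLocallyBoundedFourier (fun φ => S φ) →
    ∀ (Ω : Type u) [MeasurableSpace Ω] (P : Measure Ω) [IsProbabilityMeasure P]
      (N : Ω → Measure (Eu d × ℝ)), IsPoissonRandomMeasure P (intensity d ν) N →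
    ∀ (x : Eu d) (Y : Ω → ℝ), IsNoiseIntegral P ν N κ (fun φ => S (reflect (shift x φ))) Y →
      eLpNorm Y (ENNReal.ofReal p) P ≤
        ENNReal.ofReal B * max (moment ν 2 ^ (1 / 2 : ℝ)) (moment ν p ^ (1 / p)) *
          (convNorm S (reflectKernel κ) 2 + convNorm S (reflectKernel κ) p) := by
  obtain ⟨B, hB0, hB⟩ := exists_eLpNorm_compensatedIntegral_le.{u} hp
  refine ⟨B, hB0, ?_⟩
  intro d ν hν hνp κ hκ hκf S hS Ω _ P _ N hN x Y hY
  have hp0 : 0 < p := by linarith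
  set A := max (moment ν 2 ^ (1 / 2 : ℝ)) (moment ν p ^ (1 / p)) with hA
  by_cases hν0 : moment ν 2 = 0
  · rw [hY.eLpNorm_eq_zero (hν.eq_zero hν0) hN]
    exact bot_le
  -- Once the constant is nonzero, the cases where the convolution is not a function or has an
  -- infinite norm are trivial, the right side being `∞`.
  have hA0 : ENNReal.ofReal B * A ≠ 0 := by
    refine mul_ne_zero (by simpa using hB0) ?_
    have : 0 < moment ν 2 ^ (1 / 2 : ℝ) := by
      rw [pos_iff_ne_zero]
      simpa using hν0
    exact (this.trans_le (le_max_left _ _)).ne'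
  by_cases hex : ∃ g, HasConv S (reflectKernel κ) g
  swap
  · rw [convNorm_eq_top hex, top_add, ENNReal.mul_top hA0]
    exact le_top
  obtain ⟨g, hg⟩ := hex
  rw [convNorm_eq hg, convNorm_eq hg]
  by_cases hg2 : eLpNorm g (ENNReal.ofReal 2) volume = ⊤
  · rw [hg2, top_add, ENNReal.mul_top hA0]
    exact le_top
  by_cases hgp : eLpNorm g (ENNReal.ofReal p) volume = ⊤
  · rw [hgp, add_top, ENNReal.mul_top hA0]
    exact le_top
  have hconv := HasConvolution.reflect_shift (S := fun φ => S φ) hg x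
  have hmp := (volume : Measure (Eu d)).measurePreserving_sub_left x
  have hre : ∀ q : ℝ≥0∞, eLpNorm (fun y => (g (x - y)).re) q volume ≤ eLpNorm g q volume := by
    intro q
    rw [← eLpNorm_comp_measurePreserving hg.1 hmp]
    exact eLpNorm_mono fun y => Complex.abs_re_le_norm _
  have hrem : AEStronglyMeasurable (fun y => (g (x - y)).re) volume :=
    Complex.continuous_re.comp_aestronglyMeasurable hconv.1
  have hg2' : MemLp (fun y => g (x - y)) 2 volume := by
    refine ⟨hconv.1, ?_⟩
    rw [ENNReal.ofReal_ofNat] at hg2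
    exact (eLpNorm_comp_measurePreserving hg.1 hmp).trans_lt (lt_top_iff_ne_top.2 hg2)
  have hL := hY.isLevyIntegral hν hν0 hN hκ hκf (hS.reflect_shift x) hconv hg2'
  have hLp := eLpNorm_mul_intensity hν hrem hp0
  have hL2 := eLpNorm_mul_intensity hν hrem two_pos
  have hmem : MemLp (fun q : Eu d × ℝ => (g (x - q.1)).re * q.2) (ENNReal.ofReal p)
      (intensity d ν) := by
    refine ⟨aestronglyMeasurable_mul_intensity hν hrem, ?_⟩
    rw [hLp]
    exact ENNReal.mul_lt_top ((hre _).trans_lt (lt_top_iff_ne_top.2 hgp))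
      (ENNReal.rpow_lt_top_of_nonneg (by positivity) hνp.ne)
  refine (hB _ Ω P _ N hN _ Y hL hmem).trans ?_
  rw [mul_assoc (ENNReal.ofReal B) A, mul_add A]
  rw [ENNReal.ofReal_ofNat] at hL2 ⊢
  rw [hLp, hL2]
  refine mul_le_mul_right (add_le_add ?_ ?_) _
  · rw [mul_comm]
    exact mul_le_mul' (le_max_left _ _) (hre _)
  · rw [mul_comm]
    exact mul_le_mul' (le_max_right _ _) (hre _)

theorem lintegral_Ioo_comp_sub (K : ℝ → ℝ≥0∞) (t : ℝ) :
    ∫⁻ s in Ioo 0 t, K (t - s) = ∫⁻ s in Ioo 0 t, K s := by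
  have h := ((volume : Measure ℝ).measurePreserving_sub_left t).setLIntegral_comp_preimage_emb
    (Homeomorph.subLeft t).measurableEmbedding K (Ioo 0 t)
  rw [← h]
  congr 2
  ext s
  simp only [mem_preimage, mem_Ioo]
  constructor <;> rintro ⟨h1, h2⟩ <;> constructor <;> linarith

/-- Minkowski's inequality in time, applied to the bound for each noise integral. Local boundedness
of the Fourier transforms is the form of rapid decrease that the argument uses, and the explicit
kernels satisfy it directly. -/
theorem exists_solutionMomentBound {p : ℝ} (hp : 2 ≤ p) : ∃ B : ℝ, 0 < B ∧
    ∀ (d : ℕ) (ν : Measure ℝ), IsJumpMeasure ν → moment ν p < ⊤ →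
    ∀ κ : Eu d → ℝ≥0∞, IsTempered κ → (∃ h, HasFourier (funPairing κ) h) →
    ∀ G : ℝ → 𝓢'(Eu d, ℂ), (∀ t : ℝ, 0 < t → HasLocallyBoundedFourier (fun φ => G t φ)) →
      SolutionMomentBound.{u} ν κ G p (fun t =>
        ENNReal.ofReal B * max (moment ν 2 ^ (1 / 2 : ℝ)) (moment ν p ^ (1 / p)) *
          ∫⁻ s in Ioc 0 t,
            (J G (reflectKernel κ) 2 s ^ (1 / 2 : ℝ) +
              J G (reflectKernel κ) p s ^ (1 / 2 : ℝ))) := by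
  obtain ⟨B, hB0, hB⟩ := exists_eLpNorm_noiseIntegral_le.{u} hp
  refine ⟨B, hB0, ?_⟩
  intro d ν hν hνp κ hκ hκf G hG Ω _ P _ N hN v hv t ht x
  obtain ⟨Y, hYm, hYn, -, hvY⟩ := hv t ht.le x
  have hp0 : 0 < p := by linarith
  have hJ : ∀ q s : ℝ, J G (reflectKernel κ) q s ^ (1 / 2 : ℝ) =
      convNorm (G s) (reflectKernel κ) q := by
    intro q s
    rw [J, ← ENNReal.rpow_natCast, ← ENNReal.rpow_mul]
    norm_num
  simp only [hJ]
  have h1 : eLpNorm (v t x) (ENNReal.ofReal p) P ≤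
      ∫⁻ s in Ioo 0 t, eLpNorm (Y s) (ENNReal.ofReal p) P := by
    refine le_trans (le_of_eq (eLpNorm_congr_ae ?_)) (eLpNorm_integral_le hYm (by linarith))
    filter_upwards [hvY] with ω hω
    rw [hω, intervalIntegral.integral_of_le ht.le, integral_Ioc_eq_integral_Ioo]
  refine h1.trans ?_
  set A := max (moment ν 2 ^ (1 / 2 : ℝ)) (moment ν p ^ (1 / p)) with hA
  have hAt : ENNReal.ofReal B * A ≠ ⊤ := by
    refine ENNReal.mul_ne_top ENNReal.ofReal_ne_top (max_lt ?_ ?_).ne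
    · exact ENNReal.rpow_lt_top_of_nonneg (by positivity) hν.2.ne
    · exact ENNReal.rpow_lt_top_of_nonneg (by positivity) hνp.ne
  -- On the open interval `t - s` stays positive, as the bound at time `s` requires; the endpoints
  -- are null, and `s ↦ t - s` preserves the interval.
  rw [← restrict_Ioo_eq_restrict_Ioc, ← lintegral_Ioo_comp_sub (fun s => convNorm (G s) (reflectKernel κ) 2 +
    convNorm (G s) (reflectKernel κ) p), ← lintegral_const_mul' _ _ hAt]
  refine setLIntegral_mono' measurableSet_Ioo fun s hs => ?_
  exact hB d ν hν hνp κ hκ hκf (G (t - s)) (hG _ (by linarith [hs.2])) Ω P N hN x (Y s)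
    (hYn s hs.1.le hs.2)

theorem SolutionMomentBound.mono {d : ℕ} {ν : Measure ℝ} {κ : Eu d → ℝ≥0∞}
    {G : ℝ → 𝓢'(Eu d, ℂ)} {p : ℝ} {b b' : ℝ → ℝ≥0∞} (h : SolutionMomentBound.{u} ν κ G p b)
    (hb : ∀ t, 0 < t → b t ≤ b' t) : SolutionMomentBound.{u} ν κ G p b' :=
  fun Ω _ P _ N hN v hv t ht x => (h Ω P N hN v hv t ht x).trans (hb t ht)

theorem J_reflectKernel_le {d : ℕ} {κ : Eu d → ℝ≥0∞} {G : ℝ → 𝓢'(Eu d, ℂ)}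
    (h : (∀ s : ℝ, 0 < s → EvenDistribution (G s)) ∨ (∀ᵐ x, κ (-x) = κ x)) (q : ℝ) {s : ℝ}
    (hs : 0 < s) : J G (reflectKernel κ) q s ≤ J G κ q s := by
  unfold J
  gcongr
  rcases h with h | h
  · exact convNorm_reflectKernel_le_of_even (h s hs) κ q
  · exact convNorm_reflectKernel_le_of_symm (G s) h q

theorem exists_solutionMomentBound_of_symm {p : ℝ} (hp : 2 ≤ p) : ∃ B : ℝ, 0 < B ∧
    ∀ (d : ℕ) (ν : Measure ℝ), IsJumpMeasure ν → moment ν p < ⊤ →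
    ∀ κ : Eu d → ℝ≥0∞, IsTempered κ → (∃ h, HasFourier (funPairing κ) h) →
    ∀ G : ℝ → 𝓢'(Eu d, ℂ), (∀ t : ℝ, 0 < t → HasLocallyBoundedFourier (fun φ => G t φ)) →
      SolutionMomentBound.{u} ν κ G p (fun t =>
        ENNReal.ofReal B * max (moment ν 2 ^ (1 / 2 : ℝ)) (moment ν p ^ (1 / p)) *
          ∫⁻ s in Ioc 0 t,
            (J G (reflectKernel κ) 2 s ^ (1 / 2 : ℝ) +
              J G (reflectKernel κ) p s ^ (1 / 2 : ℝ))) ∧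
      (((∀ s : ℝ, 0 < s → EvenDistribution (G s)) ∨ (∀ᵐ x, κ (-x) = κ x)) →
        SolutionMomentBound.{u} ν κ G p (fun t =>
          ENNReal.ofReal B * max (moment ν 2 ^ (1 / 2 : ℝ)) (moment ν p ^ (1 / p)) *
            ∫⁻ s in Ioc 0 t, (J G κ 2 s ^ (1 / 2 : ℝ) + J G κ p s ^ (1 / 2 : ℝ)))) := by
  obtain ⟨B, hB0, hB⟩ := exists_solutionMomentBound.{u} hp
  refine ⟨B, hB0, fun d ν hν hνp κ hκ hκf G hG => ?_⟩
  have h := hB d ν hν hνp κ hκ hκf G hG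
  refine ⟨h, fun hs => h.mono fun t _ => ?_⟩
  refine mul_le_mul_right ?_ _
  refine setLIntegral_mono' measurableSet_Ioc fun s hs' => ?_
  gcongr
  · exact J_reflectKernel_le hs 2 hs'.1
  · exact J_reflectKernel_le hs p hs'.1

theorem momentInequality {p : ℝ} (hp : 2 ≤ p) : ∃ B : ℝ, 0 < B ∧
    ∀ (d : ℕ), 1 ≤ d → ∀ ν : Measure ℝ, IsJumpMeasure ν → moment ν p < ⊤ →
    ∀ κ : Eu d → ℝ≥0∞, AssumptionA1 κ →
    ∀ G : ℝ → 𝓢'(Eu d, ℂ), HypothesisA G → HypothesisB κ G → HypothesisC κ G →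
      SolutionMomentBound.{u} ν κ G p (fun t =>
        ENNReal.ofReal B * max (moment ν 2 ^ (1 / 2 : ℝ)) (moment ν p ^ (1 / p)) *
          ∫⁻ s in Ioc 0 t,
            (J G (reflectKernel κ) 2 s ^ (1 / 2 : ℝ) +
              J G (reflectKernel κ) p s ^ (1 / 2 : ℝ))) ∧
      (((∀ s : ℝ, 0 < s → EvenDistribution (G s)) ∨ (∀ᵐ x, κ (-x) = κ x)) →
        SolutionMomentBound.{u} ν κ G p (fun t =>
          ENNReal.ofReal B * max (moment ν 2 ^ (1 / 2 : ℝ)) (moment ν p ^ (1 / p)) *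
            ∫⁻ s in Ioc 0 t, (J G κ 2 s ^ (1 / 2 : ℝ) + J G κ p s ^ (1 / 2 : ℝ)))) := by
  obtain ⟨B, hB0, hB⟩ := exists_solutionMomentBound_of_symm.{u} hp
  refine ⟨B, hB0, fun d _ ν hν hνp κ hκ G hG _ _ => ?_⟩
  obtain ⟨hκt, h, -, hh, -⟩ := hκ
  exact hB d ν hν hνp κ hκt ⟨h, hh⟩ G fun t ht => (hG t ht).hasLocallyBoundedFourier

end Moment

end LevyColored

namespace LevyColored

/-! ### Power bounds -/

section Power

theorem lintegral_Ioc_rpow {r t : ℝ} (hr : -1 < r) (ht : 0 < t) :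
    ∫⁻ s in Ioc 0 t, ENNReal.ofReal (s ^ r) = ENNReal.ofReal (t ^ (r + 1) / (r + 1)) := by
  have hi : IntervalIntegrable (fun s : ℝ => s ^ r) volume 0 t :=
    intervalIntegral.intervalIntegrable_rpow' hr
  rw [← ofReal_integral_eq_lintegral_ofReal ((intervalIntegrable_iff_integrableOn_Ioc_of_le ht.le).1 hi)
    ((ae_restrict_mem measurableSet_Ioc).mono fun s hs => Real.rpow_nonneg hs.1.le r),
    ← intervalIntegral.integral_of_le ht.le, integral_rpow (Or.inl hr),
    Real.zero_rpow (by linarith), sub_zero]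

/-- The condition `-2 < γ` is integrability of `s^{γ/2}` at `0`. The restrictions on `p` for the
heat equation express it for the exponent of `J_p`. -/
theorem lintegral_Ioc_rpow_half_le {f : ℝ → ℝ≥0∞} {C γ : ℝ} (hγ : -2 < γ)
    (hf : ∀ s, 0 < s → f s ≤ ENNReal.ofReal (C * s ^ γ)) {t : ℝ} (ht : 0 < t) :
    ∫⁻ s in Ioc 0 t, f s ^ (1 / 2 : ℝ) ≤
      ENNReal.ofReal (|C| ^ (1 / 2 : ℝ) / (γ / 2 + 1) * t ^ (γ / 2 + 1)) := by
  have h1 : ∀ s ∈ Ioc 0 t, f s ^ (1 / 2 : ℝ) ≤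
      ENNReal.ofReal (|C| ^ (1 / 2 : ℝ)) * ENNReal.ofReal (s ^ (γ / 2)) := by
    intro s hs
    have hs0 := hs.1
    calc f s ^ (1 / 2 : ℝ) ≤ ENNReal.ofReal (|C| * s ^ γ) ^ (1 / 2 : ℝ) := by
          gcongr
          refine (hf s hs0).trans (ENNReal.ofReal_le_ofReal ?_)
          gcongr
          exact le_abs_self C
      _ = _ := by
          rw [ENNReal.ofReal_rpow_of_nonneg (by positivity) (by positivity),
            ← ENNReal.ofReal_mul (by positivity), Real.mul_rpow (by positivity) (by positivity),
            ← Real.rpow_mul hs0.le]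
          congr 3
          ring
  refine (setLIntegral_mono' measurableSet_Ioc h1).trans (le_of_eq ?_)
  rw [lintegral_const_mul' _ _ ENNReal.ofReal_ne_top, lintegral_Ioc_rpow (by linarith) ht,
    ← ENNReal.ofReal_mul (by positivity)]
  congr 1
  ring

/-- Moment bounds for the solution, from power bounds for `J₂` and `J_p`. -/
theorem exists_solutionMomentBound_of_rpow {d : ℕ} {p : ℝ} (hp : 2 ≤ p) {ν : Measure ℝ}
    (hν : IsJumpMeasure ν) (hνp : moment ν p < ⊤) {κ : Eu d → ℝ≥0∞} (hκ : IsTempered κ)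
    (hκf : ∃ h, HasFourier (funPairing κ) h) {G : ℝ → 𝓢'(Eu d, ℂ)}
    (hG : ∀ t : ℝ, 0 < t → HasLocallyBoundedFourier (fun φ => G t φ))
    (hs : (∀ s : ℝ, 0 < s → EvenDistribution (G s)) ∨ (∀ᵐ x, κ (-x) = κ x))
    {C₁ C₂ γ₁ γ₂ : ℝ} (hγ₁ : -2 < γ₁) (hγ₂ : -2 < γ₂)
    (h₁ : ∀ t, 0 < t → J G κ 2 t ≤ ENNReal.ofReal (C₁ * t ^ γ₁))
    (h₂ : ∀ t, 0 < t → J G κ p t ≤ ENNReal.ofReal (C₂ * t ^ γ₂)) :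
    ∃ C : ℝ, SolutionMomentBound.{u} ν κ G p
      (fun t => ENNReal.ofReal (C * (t ^ (γ₁ / 2 + 1) + t ^ (γ₂ / 2 + 1)))) := by
  obtain ⟨B, hB0, hB⟩ := exists_solutionMomentBound_of_symm.{u} hp
  have h := (hB d ν hν hνp κ hκ hκf G hG).2 hs
  set A := ENNReal.ofReal B * max (moment ν 2 ^ (1 / 2 : ℝ)) (moment ν p ^ (1 / p)) with hA
  have hAt : A ≠ ⊤ := by
    have hp0 : 0 < p := by linarith
    refine ENNReal.mul_ne_top ENNReal.ofReal_ne_top (max_lt ?_ ?_).ne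
    · exact ENNReal.rpow_lt_top_of_nonneg (by positivity) hν.2.ne
    · exact ENNReal.rpow_lt_top_of_nonneg (by positivity) hνp.ne
  set D₁ := |C₁| ^ (1 / 2 : ℝ) / (γ₁ / 2 + 1) with hD₁
  set D₂ := |C₂| ^ (1 / 2 : ℝ) / (γ₂ / 2 + 1) with hD₂
  have hD₁0 : 0 ≤ D₁ := div_nonneg (by positivity) (by linarith)
  have hD₂0 : 0 ≤ D₂ := div_nonneg (by positivity) (by linarith)
  refine ⟨A.toReal * (D₁ + D₂), h.mono fun t ht => ?_⟩
  have h3 : ∫⁻ s in Ioc 0 t, (J G κ 2 s ^ (1 / 2 : ℝ) + J G κ p s ^ (1 / 2 : ℝ)) ≤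
      ENNReal.ofReal (D₁ * t ^ (γ₁ / 2 + 1)) + ENNReal.ofReal (D₂ * t ^ (γ₂ / 2 + 1)) := by
    have k1 : ∀ s ∈ Ioc 0 t, J G κ 2 s ^ (1 / 2 : ℝ) + J G κ p s ^ (1 / 2 : ℝ) ≤
        ENNReal.ofReal (C₁ * s ^ γ₁) ^ (1 / 2 : ℝ) + ENNReal.ofReal (C₂ * s ^ γ₂) ^ (1 / 2 : ℝ) := by
      intro s hs
      gcongr
      · exact h₁ s hs.1
      · exact h₂ s hs.1
    refine (setLIntegral_mono' measurableSet_Ioc k1).trans ?_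
    rw [lintegral_add_left (by fun_prop)]
    exact add_le_add (lintegral_Ioc_rpow_half_le hγ₁ (fun _ _ => le_rfl) ht)
      (lintegral_Ioc_rpow_half_le hγ₂ (fun _ _ => le_rfl) ht)
  refine (mul_le_mul_right h3 A).trans ?_
  rw [← ENNReal.ofReal_add (by positivity) (by positivity)]
  conv_lhs => rw [← ENNReal.ofReal_toReal hAt]
  rw [← ENNReal.ofReal_mul ENNReal.toReal_nonneg]
  refine ENNReal.ofReal_le_ofReal ?_
  rw [mul_assoc]
  gcongr
  have a1 : 0 ≤ t ^ (γ₁ / 2 + 1) := by positivity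
  have a2 : 0 ≤ t ^ (γ₂ / 2 + 1) := by positivity
  nlinarith [mul_nonneg hD₁0 a2, mul_nonneg hD₂0 a1]

end Power

/-! ### Convolutions of nonnegative functions -/

section ConvLp

variable {d : ℕ}

/-- The `Lᵖ` norm of the convolution of `κ` and `|a|`. -/
noncomputable def convLp (κ : Eu d → ℝ≥0∞) (a : Eu d → ℂ) (p : ℝ) : ℝ≥0∞ :=
  (∫⁻ x, (∫⁻ y, κ y * ‖a (x - y)‖ₑ) ^ p) ^ (1 / p)

theorem convNorm_le_convLp {κ : Eu d → ℝ≥0∞} (hκ : IsTempered κ) {a : Eu d → ℂ}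
    (ha : Measurable a) (hai : ∀ k : ℕ, Integrable (fun x => (1 + ‖x‖ ^ 2) ^ k * ‖a x‖))
    {S : 𝓢'(Eu d, ℂ)} (hS : ∀ φ : 𝓢(Eu d, ℂ), S φ = ∫ x, a x * φ x) {p : ℝ} (hp : 0 < p) :
    convNorm S κ p ≤ convLp κ a p := by
  have h : HasConv S κ (fun x => ∫ y, a (x - y) * ((κ y).toReal : ℂ)) := by
    have h1 := hasConvolution_of_integrable hκ ha hai
    refine ⟨h1.1, fun φ => ?_⟩
    simp_rw [hS]
    exact h1.2 φ
  refine (iInf₂_le _ h).trans ?_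
  rw [eLpNorm_ofReal_eq _ hp, convLp]
  gcongr with x
  refine (enorm_integral_le_lintegral_enorm _).trans (lintegral_mono fun y => ?_)
  rw [enorm_mul, mul_comm]
  gcongr
  rw [← ofReal_norm, Complex.norm_real, Real.norm_of_nonneg ENNReal.toReal_nonneg]
  exact ENNReal.ofReal_toReal_le

theorem convLp_le {κ : Eu d → ℝ≥0∞} (hκ : Measurable κ) {a : Eu d → ℂ} (ha : Measurable a)
    {p q r : ℝ} (hp : 1 ≤ p) (hq : 1 ≤ q) (hr : 1 ≤ r) (h : 1 / r + 1 / q = 1 + 1 / p) :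
    convLp κ a p ≤ (∫⁻ x, κ x ^ r) ^ (1 / r) * (∫⁻ x, ‖a x‖ₑ ^ q) ^ (1 / q) :=
  lintegral_convolution_rpow_le hκ ha.enorm hp hq hr h

theorem convLp_le_left {κ : Eu d → ℝ≥0∞} (hκ : Measurable κ) {a : Eu d → ℂ} (ha : Measurable a)
    {p : ℝ} (hp : 1 ≤ p) : convLp κ a p ≤ (∫⁻ x, κ x) * (∫⁻ x, ‖a x‖ₑ ^ p) ^ (1 / p) := by
  have := convLp_le hκ ha hp hp le_rfl (by norm_num)
  simpa using this

theorem convLp_le_right {κ : Eu d → ℝ≥0∞} (hκ : Measurable κ) {a : Eu d → ℂ} (ha : Measurable a)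
    {p : ℝ} (hp : 1 ≤ p) : convLp κ a p ≤ (∫⁻ x, κ x ^ p) ^ (1 / p) * ∫⁻ x, ‖a x‖ₑ := by
  have := convLp_le hκ ha hp le_rfl hp (by ring)
  simpa using this

theorem convLp_add_le {κ₁ κ₂ : Eu d → ℝ≥0∞} (hκ₁ : Measurable κ₁) (hκ₂ : Measurable κ₂)
    {a : Eu d → ℂ} (ha : Measurable a) {p : ℝ} (hp : 1 ≤ p) :
    convLp (fun y => κ₁ y + κ₂ y) a p ≤ convLp κ₁ a p + convLp κ₂ a p := by
  have hm : ∀ κ : Eu d → ℝ≥0∞, Measurable κ → Measurable fun x => ∫⁻ y, κ y * ‖a (x - y)‖ₑ := by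
    intro κ hκ
    have : Measurable (Function.uncurry fun x y : Eu d => κ y * ‖a (x - y)‖ₑ) := by
      unfold Function.uncurry
      fun_prop
    exact this.lintegral_prod_right'
  unfold convLp
  refine le_trans (le_of_eq ?_)
    (ENNReal.lintegral_Lp_add_le (hm κ₁ hκ₁).aemeasurable (hm κ₂ hκ₂).aemeasurable hp)
  congr 1
  refine lintegral_congr fun x => ?_
  simp only [Pi.add_apply, add_mul]
  rw [lintegral_add_left (by fun_prop)]

theorem lintegral_eq_comp_const_smul (f : Eu d → ℝ≥0∞) {r : ℝ} (hr : 0 < r) :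
    ∫⁻ x, f x = ENNReal.ofReal (r ^ (d : ℝ)) * ∫⁻ x, f (r • x) := by
  rw [lintegral_comp_const_smul f hr, ← mul_assoc, ← ENNReal.ofReal_mul (by positivity),
    ← Real.rpow_add hr, add_neg_cancel, Real.rpow_zero, ENNReal.ofReal_one, one_mul]

theorem lintegral_rpow_scale {a b : Eu d → ℂ} {r m : ℝ} (hr : 0 < r)
    (hab : ∀ x, ‖a (r • x)‖ₑ = ENNReal.ofReal (r ^ m) * ‖b x‖ₑ) {p : ℝ} (hp : 0 < p) :
    (∫⁻ x, ‖a x‖ₑ ^ p) ^ (1 / p) =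
      ENNReal.ofReal (r ^ (m + d / p)) * (∫⁻ x, ‖b x‖ₑ ^ p) ^ (1 / p) := by
  rw [lintegral_eq_comp_const_smul _ hr]
  simp_rw [hab, ENNReal.mul_rpow_of_nonneg _ _ hp.le]
  rw [lintegral_const_mul' _ _ (ENNReal.rpow_ne_top_of_nonneg hp.le ENNReal.ofReal_ne_top),
    ENNReal.mul_rpow_of_nonneg _ _ (by positivity), ENNReal.mul_rpow_of_nonneg _ _ (by positivity),
    ← ENNReal.rpow_mul, mul_one_div_cancel hp.ne', ENNReal.rpow_one, ← mul_assoc,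
    ENNReal.ofReal_rpow_of_pos (by positivity), ← ENNReal.ofReal_mul (by positivity),
    ← Real.rpow_mul hr.le, ← Real.rpow_add hr]
  congr 3
  ring

/-- Both variables are dilated by `r`: the inner integral contributes `d`, the kernel `-β`, the
density `m`, and the outer `L^p` norm `d / p`. -/
theorem convLp_scale {κ : Eu d → ℝ≥0∞} {a b : Eu d → ℂ} {r m β : ℝ} (hr : 0 < r)
    (hκ : ∀ x, κ (r • x) = ENNReal.ofReal (r ^ (-β)) * κ x)
    (hab : ∀ x, ‖a (r • x)‖ₑ = ENNReal.ofReal (r ^ m) * ‖b x‖ₑ) {p : ℝ} (hp : 0 < p) :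
    convLp κ a p = ENNReal.ofReal (r ^ (d - β + m + d / p)) * convLp κ b p := by
  have h1 : ∀ x, ∫⁻ y, κ y * ‖a (r • x - y)‖ₑ =
      ENNReal.ofReal (r ^ (d - β + m)) * ∫⁻ y, κ y * ‖b (x - y)‖ₑ := by
    intro x
    rw [lintegral_eq_comp_const_smul _ hr]
    simp_rw [← smul_sub, hκ, hab, mul_mul_mul_comm _ (κ _)]
    rw [lintegral_const_mul' _ _ (ENNReal.mul_ne_top ENNReal.ofReal_ne_top ENNReal.ofReal_ne_top),
      ← mul_assoc, ← ENNReal.ofReal_mul (by positivity), ← ENNReal.ofReal_mul (by positivity),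
      ← Real.rpow_add hr, ← Real.rpow_add hr]
    congr 3
    ring
  unfold convLp
  rw [lintegral_eq_comp_const_smul _ hr]
  simp_rw [h1, ENNReal.mul_rpow_of_nonneg _ _ hp.le]
  rw [lintegral_const_mul' _ _ (ENNReal.rpow_ne_top_of_nonneg hp.le ENNReal.ofReal_ne_top),
    ENNReal.mul_rpow_of_nonneg _ _ (by positivity), ENNReal.mul_rpow_of_nonneg _ _ (by positivity),
    ← ENNReal.rpow_mul, mul_one_div_cancel hp.ne', ENNReal.rpow_one, ← mul_assoc,
    ENNReal.ofReal_rpow_of_pos (by positivity), ← ENNReal.ofReal_mul (by positivity),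
    ← Real.rpow_mul hr.le, ← Real.rpow_add hr]
  congr 3
  ring

theorem evenDistribution_of_integral {S : 𝓢'(Eu d, ℂ)} {a : Eu d → ℂ}
    (hS : ∀ φ : 𝓢(Eu d, ℂ), S φ = ∫ x, a x * φ x) (ha : ∀ x, a (-x) = a x) :
    EvenDistribution S := by
  intro φ
  rw [hS, hS, ← integral_neg_eq_self]
  simp only [reflect_apply, neg_neg, ha]

end ConvLp

end LevyColored

namespace LevyColored

/-! ### Self-similar densities -/

section SelfSimilar

variable {d : ℕ}

/-- The distributions `G t` are given by even, rapidly decreasing densities `a t`, with a scaling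
property. -/
structure IsSelfSimilar (G : ℝ → 𝓢'(Eu d, ℂ)) (a : ℝ → Eu d → ℂ) (θ m : ℝ) : Prop where
  measurable : ∀ t, 0 < t → Measurable (a t)
  integrable : ∀ t, 0 < t → ∀ k : ℕ, Integrable (fun x => (1 + ‖x‖ ^ 2) ^ k * ‖a t x‖)
  apply : ∀ t, 0 < t → ∀ φ : 𝓢(Eu d, ℂ), G t φ = ∫ x, a t x * φ x
  even : ∀ t, 0 < t → ∀ x, a t (-x) = a t x
  scale : ∀ t, 0 < t → ∀ x, ‖a t (t ^ θ • x)‖ₑ = ENNReal.ofReal ((t ^ θ) ^ m) * ‖a 1 x‖ₑ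

variable {G : ℝ → 𝓢'(Eu d, ℂ)} {a : ℝ → Eu d → ℂ} {θ m : ℝ}

theorem IsSelfSimilar.lintegral_lt_top (h : IsSelfSimilar G a θ m) {t : ℝ} (ht : 0 < t) :
    ∫⁻ x, ‖a t x‖ₑ < ⊤ := by
  have h1 := (h.integrable t ht 0).2
  simpa [HasFiniteIntegral] using h1

theorem IsSelfSimilar.hasLocallyBoundedFourier (h : IsSelfSimilar G a θ m) {t : ℝ} (ht : 0 < t) :
    HasLocallyBoundedFourier (fun φ => G t φ) := by
  simp_rw [h.apply t ht]
  exact hasLocallyBoundedFourier_integral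
    ⟨(h.measurable t ht).aestronglyMeasurable, h.lintegral_lt_top ht⟩

theorem IsSelfSimilar.evenDistribution (h : IsSelfSimilar G a θ m) {t : ℝ} (ht : 0 < t) :
    EvenDistribution (G t) :=
  evenDistribution_of_integral (h.apply t ht) (h.even t ht)

theorem ofReal_mul_sq_eq {t c : ℝ} {θ : ℝ} (ht : 0 < t) {A : ℝ≥0∞} (hA : A ≠ ⊤) :
    (ENNReal.ofReal ((t ^ θ) ^ c) * A) ^ 2 =
      ENNReal.ofReal (A.toReal ^ 2 * t ^ (2 * θ * c)) := by
  rw [mul_pow, ENNReal.ofReal_mul (by positivity), mul_comm, ENNReal.ofReal_pow ENNReal.toReal_nonneg,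
    ENNReal.ofReal_toReal hA, ← ENNReal.ofReal_pow (by positivity), ← Real.rpow_mul ht.le,
    ← Real.rpow_natCast, ← Real.rpow_mul ht.le]
  congr 3
  push_cast
  ring

/-- Homogeneity of the kernel and self-similarity of the densities reduce every `t` to `t = 1` by
the dilation of ratio `t^θ`; the factor `2` in the exponent comes from the square in `J`. -/
theorem IsSelfSimilar.exists_J_le_of_homogeneous (h : IsSelfSimilar G a θ m) {κ : Eu d → ℝ≥0∞}
    (hκ : IsTempered κ) {β : ℝ}
    (hβ : ∀ r : ℝ, 0 < r → ∀ x, κ (r • x) = ENNReal.ofReal (r ^ (-β)) * κ x) {p : ℝ} (hp : 0 < p)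
    (hfin : convLp κ (a 1) p ≠ ⊤) :
    ∃ C : ℝ, ∀ t : ℝ, 0 < t →
      J G κ p t ≤ ENNReal.ofReal (C * t ^ (2 * θ * (d - β + m + d / p))) := by
  refine ⟨(convLp κ (a 1) p).toReal ^ 2, fun t ht => ?_⟩
  rw [← ofReal_mul_sq_eq ht hfin, J]
  gcongr
  refine (convNorm_le_convLp hκ (h.measurable t ht) (h.integrable t ht) (h.apply t ht) hp).trans ?_
  exact (convLp_scale (by positivity) (hβ _ (by positivity)) (h.scale t ht) hp).le

theorem IsSelfSimilar.exists_J_le_of_integrable (h : IsSelfSimilar G a θ m) {κ : Eu d → ℝ≥0∞}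
    (hκ : IsTempered κ) (hκi : ∫⁻ x, κ x ≠ ⊤) {p : ℝ} (hp : 1 ≤ p)
    (hfin : ∫⁻ x, ‖a 1 x‖ₑ ^ p ≠ ⊤) :
    ∃ C : ℝ, ∀ t : ℝ, 0 < t → J G κ p t ≤ ENNReal.ofReal (C * t ^ (2 * θ * (m + d / p))) := by
  have hp0 : 0 < p := by linarith
  have hA : (∫⁻ x, κ x) * (∫⁻ x, ‖a 1 x‖ₑ ^ p) ^ (1 / p) ≠ ⊤ :=
    ENNReal.mul_ne_top hκi (ENNReal.rpow_ne_top_of_nonneg (by positivity) hfin)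
  refine ⟨((∫⁻ x, κ x) * (∫⁻ x, ‖a 1 x‖ₑ ^ p) ^ (1 / p)).toReal ^ 2, fun t ht => ?_⟩
  rw [← ofReal_mul_sq_eq ht hA, J]
  gcongr
  refine (convNorm_le_convLp hκ (h.measurable t ht) (h.integrable t ht) (h.apply t ht) hp0).trans ?_
  refine (convLp_le_left hκ.1 (h.measurable t ht) hp).trans (le_of_eq ?_)
  rw [lintegral_rpow_scale (by positivity) (h.scale t ht) hp0, mul_left_comm]

end SelfSimilar

/-! ### Integrability tools and Fourier transforms of kernels in `L¹ + L²` -/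

section Tools

theorem lintegral_rpow_lt_top_of_le {α : Type*} [MeasurableSpace α] {μ : Measure α}
    {f : α → ℝ≥0∞} {M : ℝ≥0∞} (hM : M ≠ ⊤) (hf : ∀ x, f x ≤ M) (hi : ∫⁻ x, f x ∂μ < ⊤) {p : ℝ}
    (hp : 1 ≤ p) : ∫⁻ x, f x ^ p ∂μ < ⊤ := by
  have h1 : ∀ x, f x ^ p ≤ M ^ (p - 1) * f x := by
    intro x
    by_cases h0 : f x = 0
    · rw [h0, ENNReal.zero_rpow_of_pos (by linarith)]
      exact bot_le
    · have ht : f x ≠ ⊤ := ((hf x).trans_lt hM.lt_top).ne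
      calc f x ^ p = f x ^ (p - 1) * f x := by
            conv_rhs => rw [← ENNReal.rpow_one (f x), ← ENNReal.rpow_mul, one_mul]
            rw [← ENNReal.rpow_add _ _ h0 ht, sub_add_cancel]
        _ ≤ _ := by
            gcongr
            exact hf x
  have hMt : M ^ (p - 1) ≠ ⊤ := ENNReal.rpow_ne_top_of_nonneg (by linarith) hM
  refine (lintegral_mono h1).trans_lt ?_
  rw [lintegral_const_mul' _ _ hMt]
  exact ENNReal.mul_lt_top hMt.lt_top hi

theorem eLpNorm_two_eq {α F : Type*} [MeasurableSpace α] [NormedAddCommGroup F]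
    {μ : Measure α} (f : α → F) : eLpNorm f 2 μ = (∫⁻ x, ‖f x‖ₑ ^ (2 : ℝ) ∂μ) ^ (1 / 2 : ℝ) := by
  have := eLpNorm_ofReal_eq (μ := μ) f two_pos
  rwa [ENNReal.ofReal_ofNat] at this

variable {d : ℕ}

/-- A kernel in `L¹ + L²` has a function as Fourier transform. -/
theorem exists_hasFourier_funPairing {κ₁ κ₂ : Eu d → ℝ≥0∞} (hm₁ : Measurable κ₁)
    (hm₂ : Measurable κ₂) (h₁ : ∫⁻ x, κ₁ x ≠ ⊤) (h₂ : ∫⁻ x, κ₂ x ^ 2 ≠ ⊤) :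
    ∃ h, HasFourier (funPairing fun x => κ₁ x + κ₂ x) h := by
  have hi₁ : Integrable (fun x => ((κ₁ x).toReal : ℂ)) :=
    (integrable_toReal_of_lintegral_ne_top hm₁.aemeasurable h₁).ofReal
  have hi₂ : MemLp (fun x => ((κ₂ x).toReal : ℂ)) 2 := by
    refine ⟨(by fun_prop : Measurable fun x => ((κ₂ x).toReal : ℂ)).aestronglyMeasurable, ?_⟩
    rw [eLpNorm_two_eq]
    refine ENNReal.rpow_lt_top_of_nonneg (by positivity) (ne_top_of_le_ne_top h₂ ?_)
    refine lintegral_mono fun x => ?_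
    rw [ENNReal.rpow_two]
    gcongr
    rw [← ofReal_norm, Complex.norm_real, Real.norm_of_nonneg ENNReal.toReal_nonneg]
    exact ENNReal.ofReal_toReal_le
  set F₁ : Eu d → ℂ := 𝓕 (fun x => ((κ₁ x).toReal : ℂ)) with hF₁
  set F₂ : Lp ℂ 2 (volume : Measure (Eu d)) := 𝓕 (hi₂.toLp _) with hF₂
  have hF₁c : Continuous F₁ := continuous_fourier hi₁
  -- The dilation by `(2π)⁻¹` undoes the `2π` in `HasFourier`; the `L¹` part is transformed by the
  -- integral, the `L²` part by Plancherel.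
  refine ⟨fun ξ => F₁ ((2 * Real.pi)⁻¹ • ξ) + F₂ ((2 * Real.pi)⁻¹ • ξ), ?_, fun φ => ?_⟩
  · have hq : Measure.QuasiMeasurePreserving (fun x : Eu d => (2 * Real.pi)⁻¹ • x)
        volume volume := by
      refine ⟨by fun_prop, ?_⟩
      rw [Measure.map_addHaar_smul _ (by positivity)]
      exact Measure.smul_absolutelyContinuous
    exact (by fun_prop : Continuous fun ξ : Eu d => F₁ ((2 * Real.pi)⁻¹ • ξ)).aestronglyMeasurable.add
      ((Lp.aestronglyMeasurable F₂).comp_quasiMeasurePreserving hq)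
  · simp only [smul_smul, inv_mul_cancel₀ Real.two_pi_pos.ne', one_smul, add_mul]
    have i1 : Integrable (fun ξ => F₁ ξ * φ ξ) := by
      refine (φ.integrable.norm.const_mul (∫ x, ‖((κ₁ x).toReal : ℂ)‖)).mono'
        (hF₁c.aestronglyMeasurable.mul φ.continuous.aestronglyMeasurable) (ae_of_all _ fun ξ => ?_)
      rw [norm_mul]
      gcongr
      exact norm_fourier_le_integral _ ξ
    have i2 : Integrable (fun ξ => F₂ ξ * φ ξ) := (Lp.memLp F₂).integrable_mul (φ.memLp 2 volume)
    refine ⟨i1.add i2, ?_⟩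
    rw [integral_add i1 i2, ← integral_mul_fourier_eq hi₂ φ,
      integral_fourier_mul_eq hi₁ φ.integrable, funPairing]
    have j1 : Integrable (fun x => ((κ₁ x).toReal : ℂ) * (𝓕 (φ : Eu d → ℂ)) x) := by
      rw [← SchwartzMap.fourier_coe]
      obtain ⟨C, -, hC⟩ := exists_one_add_sq_pow_mul_norm_le (𝓕 φ) 0
      refine (hi₁.norm.mul_const C).mono'
        (hi₁.1.mul (𝓕 φ).continuous.aestronglyMeasurable) (ae_of_all _ fun ξ => ?_)
      rw [norm_mul]
      gcongr
      simpa using hC ξ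
    have j2 : Integrable (fun x => ((κ₂ x).toReal : ℂ) * (𝓕 φ) x) :=
      hi₂.integrable_mul ((𝓕 φ).memLp 2 volume)
    rw [← integral_add j1 j2]
    refine integral_congr_ae ?_
    have t1 := ae_lt_top hm₁ h₁
    have t2 := ae_lt_top (hm₂.pow_const 2) h₂
    filter_upwards [t1, t2] with x hx1 hx2
    have hx2' : κ₂ x ≠ ⊤ := fun h => by simp [h] at hx2
    rw [ENNReal.toReal_add hx1.ne hx2', ← SchwartzMap.fourier_coe]
    push_cast
    ring

end Tools

/-! ### The heat kernel -/

section Heat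

variable {d : ℕ}

theorem heatKernel_nonneg (d : ℕ) {t : ℝ} (ht : 0 < t) (x : Eu d) : 0 ≤ heatKernel d t x := by
  unfold heatKernel
  positivity

theorem continuous_heatKernel (d : ℕ) (t : ℝ) : Continuous (heatKernel d t) := by
  unfold heatKernel
  fun_prop

theorem heatKernel_neg (d : ℕ) (t : ℝ) (x : Eu d) : heatKernel d t (-x) = heatKernel d t x := by
  simp [heatKernel]

theorem heatKernel_scale (d : ℕ) {t : ℝ} (ht : 0 < t) (x : Eu d) :
    heatKernel d t (t ^ (1 / 2 : ℝ) • x) = (t ^ (1 / 2 : ℝ)) ^ (-(d : ℝ)) * heatKernel d 1 x := by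
  have h1 : ‖t ^ (1 / 2 : ℝ) • x‖ ^ 2 = t * ‖x‖ ^ 2 := by
    rw [norm_smul, mul_pow, Real.norm_of_nonneg (by positivity), ← Real.rpow_natCast,
      ← Real.rpow_mul ht.le]
    norm_num
  have h2 : -(t * ‖x‖ ^ 2) / (2 * t) = -‖x‖ ^ 2 / (2 * 1) := by
    field_simp
  rw [heatKernel, heatKernel, h1, h2, mul_one (2 * Real.pi), Real.mul_rpow (by positivity) ht.le,
    ← Real.rpow_mul ht.le]
  have h3 : -(d : ℝ) / 2 = 1 / 2 * -(d : ℝ) := by ring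
  rw [h3]
  ring

theorem integrable_pow_mul_heatKernel (d : ℕ) {t : ℝ} (ht : 0 < t) (k : ℕ) :
    Integrable (fun x : Eu d => (1 + ‖x‖ ^ 2) ^ k * heatKernel d t x) := by
  have hg := (GaussianFourier.integrable_cexp_neg_mul_sq_norm_add (V := Eu d)
    (b := ((1 / (4 * t) : ℝ) : ℂ)) (by rw [Complex.ofReal_re]; positivity) 0 0).norm
  have hg' : Integrable (fun x : Eu d => Real.exp (-(1 / (4 * t)) * ‖x‖ ^ 2)) := by
    refine hg.congr (ae_of_all _ fun x => ?_)
    simp only [zero_mul, add_zero]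
    rw [Complex.norm_exp]
    congr 1
    norm_cast
  refine (hg'.const_mul ((4 * t) ^ k * k.factorial * Real.exp (1 / (4 * t)) *
    (2 * Real.pi * t) ^ (-(d : ℝ) / 2))).mono' ?_ (ae_of_all _ fun x => ?_)
  · have := continuous_heatKernel d t
    exact (by fun_prop : Continuous _).aestronglyMeasurable
  · have h1 := Real.pow_div_factorial_le_exp (x := (1 + ‖x‖ ^ 2) / (4 * t)) (by positivity) k
    rw [div_le_iff₀ (by positivity), div_pow, div_le_iff₀ (by positivity)] at h1
    rw [Real.norm_of_nonneg (by have := heatKernel_nonneg d ht x; positivity), heatKernel]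
    have h2 : Real.exp ((1 + ‖x‖ ^ 2) / (4 * t)) * Real.exp (-‖x‖ ^ 2 / (2 * t)) =
        Real.exp (1 / (4 * t)) * Real.exp (-(1 / (4 * t)) * ‖x‖ ^ 2) := by
      rw [← Real.exp_add, ← Real.exp_add]
      congr 1
      field_simp
      ring
    calc (1 + ‖x‖ ^ 2) ^ k * ((2 * Real.pi * t) ^ (-(d : ℝ) / 2) * Real.exp (-‖x‖ ^ 2 / (2 * t)))
        ≤ (Real.exp ((1 + ‖x‖ ^ 2) / (4 * t)) * k.factorial * (4 * t) ^ k) *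
            ((2 * Real.pi * t) ^ (-(d : ℝ) / 2) * Real.exp (-‖x‖ ^ 2 / (2 * t))) := by
          gcongr
      _ = (4 * t) ^ k * k.factorial * (2 * Real.pi * t) ^ (-(d : ℝ) / 2) *
            (Real.exp ((1 + ‖x‖ ^ 2) / (4 * t)) * Real.exp (-‖x‖ ^ 2 / (2 * t))) := by ring
      _ = _ := by
          rw [h2]
          ring

theorem isSelfSimilar_heatG (d : ℕ) :
    IsSelfSimilar (heatG d) (fun t x => ((heatKernel d t x : ℝ) : ℂ)) (1 / 2) (-(d : ℝ)) where
  measurable t _ := by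
    have := (continuous_heatKernel d t).measurable
    fun_prop
  integrable t ht k := by
    refine (integrable_pow_mul_heatKernel d ht k).congr (ae_of_all _ fun x => ?_)
    simp only [Complex.norm_real]
    rw [Real.norm_of_nonneg (heatKernel_nonneg d ht x)]
  apply t ht φ := by
    rw [heatG, dif_pos ht, Lp.toTemperedDistribution_apply]
    refine integral_congr_ae ?_
    filter_upwards [(heatKernel_memLp d ht).coeFn_toLp] with x hx
    rw [hx, smul_eq_mul, mul_comm]
  even t _ x := by rw [heatKernel_neg]
  scale t ht x := by
    rw [heatKernel_scale d ht]
    push_cast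
    rw [enorm_mul]
    congr 1
    rw [← ofReal_norm, Complex.norm_real, Real.norm_of_nonneg (by positivity)]

theorem heatKernel_le (d : ℕ) {t : ℝ} (ht : 0 < t) (x : Eu d) :
    heatKernel d t x ≤ (2 * Real.pi * t) ^ (-(d : ℝ) / 2) := by
  unfold heatKernel
  refine mul_le_of_le_one_right (by positivity) ?_
  rw [Real.exp_le_one_iff]
  exact div_nonpos_of_nonpos_of_nonneg (by simp) (by positivity)

theorem lintegral_heatColor_lt_top (d : ℕ) {t : ℝ} (ht : 0 < t) :
    ∫⁻ x, heatColor d t x < ⊤ := by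
  have h := (integrable_pow_mul_heatKernel d ht 0).lintegral_lt_top
  simpa [heatColor] using h

theorem measurable_heatColor (d : ℕ) (t : ℝ) : Measurable (heatColor d t) := by
  have := (continuous_heatKernel d t).measurable
  unfold heatColor
  fun_prop

theorem isTempered_of_lintegral_lt_top {κ : Eu d → ℝ≥0∞} (hm : Measurable κ)
    (h : ∫⁻ x, κ x < ⊤) : IsTempered κ :=
  ⟨hm, 0, by simpa using h⟩

theorem lintegral_heatColor_rpow_lt_top (d : ℕ) {t : ℝ} (ht : 0 < t) {p : ℝ} (hp : 1 ≤ p) :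
    ∫⁻ x, heatColor d t x ^ p < ⊤ :=
  lintegral_rpow_lt_top_of_le ENNReal.ofReal_ne_top
    (fun x => ENNReal.ofReal_le_ofReal (heatKernel_le d ht x)) (lintegral_heatColor_lt_top d ht) hp

theorem enorm_heatKernel (d : ℕ) {t : ℝ} (ht : 0 < t) (x : Eu d) :
    ‖((heatKernel d t x : ℝ) : ℂ)‖ₑ = heatColor d t x := by
  rw [← ofReal_norm, Complex.norm_real, Real.norm_of_nonneg (heatKernel_nonneg d ht x), heatColor]

theorem exists_hasFourier_of_lintegral {κ : Eu d → ℝ≥0∞} (hm : Measurable κ)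
    (h : ∫⁻ x, κ x < ⊤) : ∃ h, HasFourier (funPairing κ) h := by
  have := exists_hasFourier_funPairing (κ₂ := fun _ => 0) hm measurable_const h.ne (by simp)
  simpa using this

end Heat

end LevyColored

namespace LevyColored

/-! ### The Riesz kernel -/

section Riesz

variable {d : ℕ}

theorem nontrivial_eu (hd : 1 ≤ d) : Nontrivial (Eu d) := by
  have : Nonempty (Fin d) := ⟨⟨0, hd⟩⟩
  infer_instance

theorem ae_enorm_rpow_eq (hd : 1 ≤ d) (s : ℝ) :
    ∀ᵐ x : Eu d, ‖x‖ₑ ^ s = ‖‖x‖ ^ s‖ₑ := by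
  have := nontrivial_eu hd
  filter_upwards [Measure.ae_ne (volume : Measure (Eu d)) 0] with x hx
  rw [← ofReal_norm (‖x‖ ^ s), Real.norm_of_nonneg (by positivity), ← ofReal_norm x,
    ENNReal.ofReal_rpow_of_pos (by positivity)]

theorem lintegral_ball_enorm_rpow_lt_top (hd : 1 ≤ d) {s : ℝ} (hs : -(d : ℝ) < s) :
    ∫⁻ x in Metric.ball (0 : Eu d) 1, ‖x‖ₑ ^ s < ⊤ := by
  have := nontrivial_eu hd
  rw [lintegral_congr_ae (ae_restrict_of_ae (ae_enorm_rpow_eq hd s))]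
  have h : IntegrableOn (fun x : Eu d => ‖x‖ ^ s) (Metric.ball 0 1) := by
    rw [integrableOn_fun_norm_addHaar volume (f := fun y : ℝ => y ^ s)]
    have h1 : IntegrableOn (fun y : ℝ => y ^ ((d : ℝ) - 1 + s)) (Ioo 0 1) :=
      (intervalIntegrable_iff_integrableOn_Ioo_of_le zero_le_one).1
        (intervalIntegral.intervalIntegrable_rpow' (by linarith))
    refine h1.congr_fun (fun y hy => ?_) measurableSet_Ioo
    simp only [smul_eq_mul, finrank_euclideanSpace_fin]
    rw [Real.rpow_add hy.1, ← Real.rpow_natCast, Nat.cast_sub hd, Nat.cast_one]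
  exact h.2

theorem lintegral_compl_ball_enorm_rpow_lt_top (hd : 1 ≤ d) {s : ℝ} (hs : s < -(d : ℝ)) :
    ∫⁻ x in (Metric.ball (0 : Eu d) 1)ᶜ, ‖x‖ₑ ^ s < ⊤ := by
  have := nontrivial_eu hd
  rw [lintegral_congr_ae (ae_restrict_of_ae (ae_enorm_rpow_eq hd s))]
  have h : IntegrableOn (fun x : Eu d => ‖x‖ ^ s) (Metric.ball 0 1)ᶜ := by
    rw [← integrable_indicator_iff measurableSet_ball.compl]
    have h0 : (Metric.ball (0 : Eu d) 1)ᶜ.indicator (fun x : Eu d => ‖x‖ ^ s) =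
        fun x => (Ici (1 : ℝ)).indicator (fun y : ℝ => y ^ s) ‖x‖ := by
      ext x
      simp [indicator]
    rw [h0, integrable_fun_norm_addHaar volume (f := (Ici (1 : ℝ)).indicator (fun y : ℝ => y ^ s))]
    have h1 : IntegrableOn (fun y : ℝ => y ^ ((d : ℝ) - 1 + s)) (Ici 1) :=
      (integrableOn_Ici_iff_integrableOn_Ioi (by simp)).2 (integrableOn_Ioi_rpow_of_lt (by linarith) one_pos)
    refine ((integrable_indicator_iff measurableSet_Ici).2 h1).integrableOn.congr_fun
      (fun y hy => ?_) measurableSet_Ioi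
    simp only [smul_eq_mul, finrank_euclideanSpace_fin, indicator]
    split_ifs with h2
    · rw [Real.rpow_add hy, ← Real.rpow_natCast, Nat.cast_sub hd, Nat.cast_one]
    · simp
  exact h.2

theorem measurable_rieszColor (d : ℕ) (α : ℝ) : Measurable (rieszColor d α) := by
  unfold rieszColor
  fun_prop

theorem rieszColor_smul {α r : ℝ} (hr : 0 < r) (x : Eu d) :
    rieszColor d α (r • x) = ENNReal.ofReal (r ^ (-(d - α))) * rieszColor d α x := by
  rw [rieszColor, rieszColor, enorm_smul, ENNReal.mul_rpow_of_ne_top (by simp) (by simp),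
    Real.enorm_of_nonneg hr.le, ENNReal.ofReal_rpow_of_pos hr, mul_left_comm]

theorem lintegral_indicator_rpow {s : Set (Eu d)} (hs : MeasurableSet s) (f : Eu d → ℝ≥0∞)
    {r : ℝ} (hr : 0 < r) : ∫⁻ x, s.indicator f x ^ r = ∫⁻ x in s, f x ^ r := by
  rw [← lintegral_indicator hs]
  refine lintegral_congr fun x => ?_
  by_cases hx : x ∈ s
  · simp [hx]
  · simp [hx, hr]

theorem setLIntegral_rieszColor_rpow_lt_top {α r : ℝ} (hr : 0 < r) {s : Set (Eu d)}
    (hs : ∫⁻ x in s, ‖x‖ₑ ^ (-(d - α) * r) < ⊤) : ∫⁻ x in s, rieszColor d α x ^ r < ⊤ := by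
  unfold rieszColor
  simp_rw [ENNReal.mul_rpow_of_nonneg _ _ hr.le, ← ENNReal.rpow_mul]
  have hc : ENNReal.ofReal (Real.pi ^ (-(d : ℝ) / 2) * 2 ^ (-α) * Real.Gamma ((d - α) / 2) /
    Real.Gamma (α / 2)) ^ r ≠ ⊤ := ENNReal.rpow_ne_top_of_nonneg hr.le ENNReal.ofReal_ne_top
  rw [lintegral_const_mul' _ _ hc]
  exact ENNReal.mul_lt_top hc.lt_top hs

theorem lintegral_rieszColor_ball_lt_top (hd : 1 ≤ d) {α r : ℝ} (hr : 0 < r)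
    (h : (d - α) * r < d) :
    ∫⁻ x, (Metric.ball (0 : Eu d) 1).indicator (rieszColor d α) x ^ r < ⊤ := by
  rw [lintegral_indicator_rpow measurableSet_ball _ hr]
  exact setLIntegral_rieszColor_rpow_lt_top hr
    (lintegral_ball_enorm_rpow_lt_top hd (by linarith))

theorem lintegral_rieszColor_compl_ball_lt_top (hd : 1 ≤ d) {α r : ℝ} (hr : 0 < r)
    (h : d < (d - α) * r) :
    ∫⁻ x, (Metric.ball (0 : Eu d) 1)ᶜ.indicator (rieszColor d α) x ^ r < ⊤ := by
  rw [lintegral_indicator_rpow measurableSet_ball.compl _ hr]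
  exact setLIntegral_rieszColor_rpow_lt_top hr
    (lintegral_compl_ball_enorm_rpow_lt_top hd (by linarith))

theorem isTempered_add {κ₁ κ₂ : Eu d → ℝ≥0∞} (hd : 1 ≤ d) (hm₁ : Measurable κ₁)
    (hm₂ : Measurable κ₂) (h₁ : ∫⁻ x, κ₁ x ≠ ⊤) (h₂ : ∫⁻ x, κ₂ x ^ 2 ≠ ⊤) :
    IsTempered (fun x => κ₁ x + κ₂ x) := by
  refine ⟨hm₁.add hm₂, d, ?_⟩
  set w : Eu d → ℝ≥0∞ := fun x => ENNReal.ofReal ((1 + ‖x‖ ^ 2) ^ (-(d : ℝ))) with hw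
  have hwm : Measurable w := by
    rw [hw]
    fun_prop
  have hw1 : ∀ x, w x ≤ 1 := fun x => by
    rw [hw, ← ENNReal.ofReal_one]
    exact ENNReal.ofReal_le_ofReal
      (Real.rpow_le_one_of_one_le_of_nonpos (by nlinarith [norm_nonneg x]) (by simp))
  have hwi : ∫⁻ x, w x < ⊤ := by
    have hd' : (1 : ℝ) ≤ d := by exact_mod_cast hd
    have h := integrable_rpow_neg_one_add_norm_sq (E := Eu d) (μ := volume) (r := 2 * (d : ℝ))
      (by rw [finrank_euclideanSpace_fin]; linarith)
    have e : -(2 * (d : ℝ)) / 2 = -(d : ℝ) := by ring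
    rw [e] at h
    exact h.lintegral_lt_top
  -- The `L²` part is dominated by `w` where it is at most `1`, and by its square elsewhere; `w` is
  -- integrable since `2d > d`.
  have hb : ∀ x, (κ₁ x + κ₂ x) * w x ≤ κ₁ x + (κ₂ x ^ 2 + w x) := by
    intro x
    rw [add_mul]
    refine add_le_add (mul_le_of_le_one_right' (hw1 x)) ?_
    rcases le_total (κ₂ x) 1 with h | h
    · exact (mul_le_of_le_one_left' h).trans le_add_self
    · refine le_trans ?_ le_self_add
      rw [pow_two]
      exact (mul_le_of_le_one_right' (hw1 x)).trans (le_mul_of_one_le_right' h)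
  refine (lintegral_mono hb).trans_lt ?_
  rw [lintegral_add_left hm₁, lintegral_add_left (by fun_prop)]
  exact ENNReal.add_lt_top.2 ⟨h₁.lt_top, ENNReal.add_lt_top.2 ⟨h₂.lt_top, hwi⟩⟩

theorem rieszColor_eq_add (α : ℝ) : rieszColor d α =
    fun x => (Metric.ball (0 : Eu d) 1).indicator (rieszColor d α) x +
      (Metric.ball (0 : Eu d) 1)ᶜ.indicator (rieszColor d α) x := by
  ext x
  exact (indicator_self_add_compl_apply _ _ x).symm

/-- Cut at the unit sphere, the kernel is in `L¹ + L²`: `0 < α` makes it integrable near the origin,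
and `2(d - α) > d` makes it square integrable at infinity. -/
theorem isTempered_and_hasFourier_rieszColor (hd : 1 ≤ d) {α : ℝ} (h0 : 0 < α)
    (h1 : α < (d : ℝ) / 2) :
    IsTempered (rieszColor d α) ∧ ∃ h, HasFourier (funPairing (rieszColor d α)) h := by
  have hm := measurable_rieszColor d α
  have k1 := lintegral_rieszColor_ball_lt_top hd (α := α) one_pos (by linarith)
  have k2 := lintegral_rieszColor_compl_ball_lt_top hd (α := α) two_pos (by linarith)
  simp only [ENNReal.rpow_one] at k1
  simp only [ENNReal.rpow_two] at k2
  have m1 := hm.indicator (measurableSet_ball (x := (0 : Eu d)) (ε := 1))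
  have m2 := hm.indicator (measurableSet_ball (x := (0 : Eu d)) (ε := 1)).compl
  rw [rieszColor_eq_add]
  exact ⟨isTempered_add hd m1 m2 k1.ne k2.ne, exists_hasFourier_funPairing m1 m2 k1.ne k2.ne⟩

/-- The singular part of the kernel lies in `L^r` and is paired with the density in `L^q` by Young's
inequality. The tail lies in `L^p`, because `(d - α) p ≥ 2(d - α) > d`, and is paired with the
density in `L¹`. -/
theorem convLp_rieszColor_ne_top (hd : 1 ≤ d) {α : ℝ} (h1 : α < (d : ℝ) / 2) {a : Eu d → ℂ}
    (ha : Measurable a) (hai : ∫⁻ x, ‖a x‖ₑ < ⊤) {p q r : ℝ} (hp : 2 ≤ p) (hq : 1 ≤ q) (hr : 1 ≤ r)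
    (hpqr : 1 / r + 1 / q = 1 + 1 / p) (hrd : (d - α) * r < d) (haq : ∫⁻ x, ‖a x‖ₑ ^ q < ⊤) :
    convLp (rieszColor d α) a p ≠ ⊤ := by
  have hm := measurable_rieszColor d α
  have hp0 : 0 < p := by linarith
  have k1 := lintegral_rieszColor_ball_lt_top hd (α := α) (by linarith) hrd
  have k2 := lintegral_rieszColor_compl_ball_lt_top hd (α := α) hp0 (by nlinarith)
  have m1 := hm.indicator (measurableSet_ball (x := (0 : Eu d)) (ε := 1))
  have m2 := hm.indicator (measurableSet_ball (x := (0 : Eu d)) (ε := 1)).compl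
  rw [rieszColor_eq_add]
  refine ne_top_of_le_ne_top ?_ ((convLp_add_le m1 m2 ha (by linarith)).trans
    (add_le_add (convLp_le m1 ha (by linarith) hq hr hpqr) (convLp_le_right m2 ha (by linarith))))
  refine ENNReal.add_ne_top.2 ⟨ENNReal.mul_ne_top ?_ ?_, ENNReal.mul_ne_top ?_ hai.ne⟩
  · exact ENNReal.rpow_ne_top_of_nonneg (by positivity) k1.ne
  · exact ENNReal.rpow_ne_top_of_nonneg (by positivity) haq.ne
  · exact ENNReal.rpow_ne_top_of_nonneg (by positivity) k2.ne

end Riesz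

/-! ### The heat equation -/

section HeatEquation

variable {d : ℕ}

theorem IsSelfSimilar.exists_J_le_of_rpow_integrable {G : ℝ → 𝓢'(Eu d, ℂ)} {a : ℝ → Eu d → ℂ}
    {θ m : ℝ} (h : IsSelfSimilar G a θ m) {κ : Eu d → ℝ≥0∞} (hκ : IsTempered κ) {p : ℝ}
    (hp : 1 ≤ p) (hκp : ∫⁻ x, κ x ^ p ≠ ⊤) :
    ∃ C : ℝ, ∀ t : ℝ, 0 < t → J G κ p t ≤ ENNReal.ofReal (C * t ^ (2 * θ * (m + d))) := by
  have hp0 : 0 < p := by linarith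
  have hA : (∫⁻ x, κ x ^ p) ^ (1 / p) * ∫⁻ x, ‖a 1 x‖ₑ ≠ ⊤ :=
    ENNReal.mul_ne_top (ENNReal.rpow_ne_top_of_nonneg (by positivity) hκp)
      (h.lintegral_lt_top one_pos).ne
  refine ⟨((∫⁻ x, κ x ^ p) ^ (1 / p) * ∫⁻ x, ‖a 1 x‖ₑ).toReal ^ 2, fun t ht => ?_⟩
  rw [← ofReal_mul_sq_eq ht hA, J]
  gcongr
  refine (convNorm_le_convLp hκ (h.measurable t ht) (h.integrable t ht) (h.apply t ht) hp0).trans ?_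
  refine (convLp_le_right hκ.1 (h.measurable t ht) hp).trans (le_of_eq ?_)
  have := lintegral_rpow_scale (by positivity) (h.scale t ht) one_pos
  simp only [ENNReal.rpow_one, div_one] at this
  rw [this, mul_left_comm]

theorem lintegral_enorm_heatKernel_rpow_lt_top (d : ℕ) {p : ℝ} (hp : 1 ≤ p) :
    ∫⁻ x : Eu d, ‖((heatKernel d 1 x : ℝ) : ℂ)‖ₑ ^ p < ⊤ := by
  simp_rw [enorm_heatKernel d one_pos]
  exact lintegral_heatColor_rpow_lt_top d one_pos hp

/-- Young's inequality is used twice: with the colour in `L^p` it bounds `J_p` uniformly in `t`,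
with the colour in `L¹` it gives decay at large times. The bounds are joined at `t = α/2`. The
uniform bound alone yields the linear growth of the moments. -/
theorem heat_heatColor (d : ℕ) {α p : ℝ} (hα : 0 < α) (hp : 2 ≤ p) :
    (∃ C : ℝ, ∀ t : ℝ, 0 < t →
      J (heatG d) (heatColor d (α / 2)) p t ≤
        ENNReal.ofReal (C * (t + α / 2) ^ (-(d : ℝ) / 2))) ∧
    ∀ ν : Measure ℝ, IsJumpMeasure ν → moment ν p < ⊤ →
      ∃ C : ℝ, SolutionMomentBound.{u} ν (heatColor d (α / 2)) (heatG d) p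
        (fun t => ENNReal.ofReal (C * t)) := by
  have hs : 0 < α / 2 := by linarith
  set s := α / 2 with hs'
  have hκm := measurable_heatColor d s
  have hκi := lintegral_heatColor_lt_top d hs
  have hκ := isTempered_of_lintegral_lt_top hκm hκi
  have hG := isSelfSimilar_heatG d
  have hconst : ∀ q : ℝ, 2 ≤ q → ∃ C : ℝ, ∀ t : ℝ, 0 < t →
      J (heatG d) (heatColor d s) q t ≤ ENNReal.ofReal (C * t ^ (0 : ℝ)) := by
    intro q hq
    obtain ⟨C, hC⟩ := hG.exists_J_le_of_rpow_integrable hκ (p := q) (by linarith)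
      (lintegral_heatColor_rpow_lt_top d hs (by linarith)).ne
    refine ⟨C, fun t ht => (hC t ht).trans (le_of_eq ?_)⟩
    congr 3
    ring
  refine ⟨?_, fun ν hν hνp => ?_⟩
  · obtain ⟨C₁, hC₁⟩ := hconst p hp
    obtain ⟨C₂, hC₂⟩ := hG.exists_J_le_of_integrable hκ hκi.ne (p := p) (by linarith)
      (lintegral_enorm_heatKernel_rpow_lt_top d (by linarith)).ne
    -- The decay obtained is `t^{-δ - d/2}`; since `p ≥ 2` gives `δ ≥ 0`, the factor `t^{-δ}` is
    -- bounded for `t ≥ s` and is discarded.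
    set δ : ℝ := (d : ℝ) / 2 - d / p with hδ
    have hδ0 : 0 ≤ δ := by
      rw [hδ, sub_nonneg]
      gcongr
    have hd0 : 0 ≤ (d : ℝ) / 2 := by positivity
    refine ⟨|C₁| * (2 * s) ^ ((d : ℝ) / 2) + |C₂| * s ^ (-δ) * 2 ^ ((d : ℝ) / 2), fun t ht => ?_⟩
    have hts : 0 < t + s := by linarith
    have hneg : ∀ u v : ℝ, 0 < u → u ≤ v → v ^ (-(d : ℝ) / 2) ≤ u ^ (-(d : ℝ) / 2) :=
      fun u v hu huv => Real.rpow_le_rpow_of_nonpos hu huv (by linarith)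
    rcases le_total t s with h | h
    · refine (hC₁ t ht).trans (ENNReal.ofReal_le_ofReal ?_)
      rw [Real.rpow_zero, mul_one, add_mul]
      have h1 : 1 ≤ (2 * s) ^ ((d : ℝ) / 2) * (t + s) ^ (-(d : ℝ) / 2) := by
        have := hneg (t + s) (2 * s) hts (by linarith)
        calc (1 : ℝ) = (2 * s) ^ ((d : ℝ) / 2) * (2 * s) ^ (-(d : ℝ) / 2) := by
              rw [← Real.rpow_add (by positivity), neg_div, add_neg_cancel, Real.rpow_zero]
          _ ≤ _ := by gcongr
      have h2 : 0 ≤ |C₂| * s ^ (-δ) * 2 ^ ((d : ℝ) / 2) * (t + s) ^ (-(d : ℝ) / 2) := by positivity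
      calc C₁ ≤ |C₁| * 1 := by rw [mul_one]; exact le_abs_self _
        _ ≤ |C₁| * ((2 * s) ^ ((d : ℝ) / 2) * (t + s) ^ (-(d : ℝ) / 2)) := by gcongr
        _ ≤ _ := by linarith
    · refine (hC₂ t ht).trans (ENNReal.ofReal_le_ofReal ?_)
      rw [add_mul]
      have e1 : 2 * (1 / 2 : ℝ) * (-(d : ℝ) + d / p) = -δ + -(d : ℝ) / 2 := by
        rw [hδ]
        ring
      have h1 : t ^ (-(d : ℝ) / 2) ≤ 2 ^ ((d : ℝ) / 2) * (t + s) ^ (-(d : ℝ) / 2) := by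
        have := hneg (t + s) (2 * t) hts (by linarith)
        calc t ^ (-(d : ℝ) / 2) = 2 ^ ((d : ℝ) / 2) * (2 * t) ^ (-(d : ℝ) / 2) := by
              rw [Real.mul_rpow (by positivity) ht.le, ← mul_assoc, ← Real.rpow_add two_pos,
                neg_div, add_neg_cancel, Real.rpow_zero, one_mul]
          _ ≤ _ := by gcongr
      have h2 : t ^ (-δ) ≤ s ^ (-δ) := Real.rpow_le_rpow_of_nonpos hs h (by linarith)
      have h3 : 0 ≤ |C₁| * (2 * s) ^ ((d : ℝ) / 2) * (t + s) ^ (-(d : ℝ) / 2) := by positivity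
      calc C₂ * t ^ (2 * (1 / 2 : ℝ) * (-(d : ℝ) + d / p))
          ≤ |C₂| * (t ^ (-δ) * t ^ (-(d : ℝ) / 2)) := by
            rw [e1, Real.rpow_add ht]
            gcongr
            exact le_abs_self _
        _ ≤ |C₂| * (s ^ (-δ) * (2 ^ ((d : ℝ) / 2) * (t + s) ^ (-(d : ℝ) / 2))) := by gcongr
        _ ≤ _ := by linarith
  · obtain ⟨C₁, hC₁⟩ := hconst 2 le_rfl
    obtain ⟨C₂, hC₂⟩ := hconst p hp
    obtain ⟨C, hC⟩ := exists_solutionMomentBound_of_rpow.{u} hp hν hνp hκ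
      (exists_hasFourier_of_lintegral hκm hκi) (fun t ht => hG.hasLocallyBoundedFourier ht)
      (Or.inl fun t ht => hG.evenDistribution ht) (by norm_num) (by norm_num) hC₁ hC₂
    refine ⟨2 * C, hC.mono fun t _ => le_of_eq ?_⟩
    rw [zero_div, zero_add, Real.rpow_one]
    ring_nf

theorem mul_rpow_add_eq {C t a b c γ₁ γ₂ : ℝ} (ht : 0 < t) (h₁ : γ₁ / 2 + 1 = a + b)
    (h₂ : γ₂ / 2 + 1 = a + c) :
    C * (t ^ (γ₁ / 2 + 1) + t ^ (γ₂ / 2 + 1)) = C * t ^ a * (t ^ b + t ^ c) := by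
  rw [h₁, h₂, Real.rpow_add ht, Real.rpow_add ht]
  ring

theorem heat_rieszColor {d : ℕ} (hd : 1 ≤ d) {α p : ℝ} (hα : max ((d : ℝ) - 2) 0 < α)
    (hαd : α < d) (hp : 2 ≤ p) :
    (∃ C : ℝ, ∀ t : ℝ, 0 < t →
      J (heatG d) (rieszColor d (α / 2)) p t ≤
        ENNReal.ofReal (C * t ^ ((d : ℝ) * (1 / p + α / (2 * d) - 1)))) ∧
    ((p * (2 * d - α - 4) < 2 * d ∨ d ≤ 2 ∨ (d = 3 ∧ 2 ≤ α) ∨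
        (d = 3 ∧ α < 2 ∧ p < 6 / (2 - α)) ∨ (4 ≤ d ∧ p < 2 * d / (2 * d - α - 4))) →
      ∀ ν : Measure ℝ, IsJumpMeasure ν → moment ν p < ⊤ →
        ∃ C : ℝ, SolutionMomentBound.{u} ν (rieszColor d (α / 2)) (heatG d) p
          (fun t => ENNReal.ofReal (C * t ^ ((d : ℝ) / 2 * (α / (2 * d) - 1) + 1) *
            (t ^ ((d : ℝ) / 4) + t ^ ((d : ℝ) / (2 * p)))))) := by
  have hα0 : 0 < α := (le_max_right _ _).trans_lt hα
  have hα2 : (d : ℝ) - 2 < α := (le_max_left _ _).trans_lt hα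
  have hd0 : (0 : ℝ) < d := by exact_mod_cast hd
  have hG := isSelfSimilar_heatG d
  obtain ⟨hκ, hκf⟩ := isTempered_and_hasFourier_rieszColor hd (α := α / 2) (by linarith)
    (by linarith)
  have hJ : ∀ q : ℝ, 2 ≤ q → ∃ C : ℝ, ∀ t : ℝ, 0 < t →
      J (heatG d) (rieszColor d (α / 2)) q t ≤
        ENNReal.ofReal (C * t ^ ((d : ℝ) * (1 / q + α / (2 * d) - 1))) := by
    intro q hq
    obtain ⟨C, hC⟩ := hG.exists_J_le_of_homogeneous hκ
      (fun r hr x => rieszColor_smul (α := α / 2) hr x) (p := q) (by linarith)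
      (convLp_rieszColor_ne_top hd (by linarith) (hG.measurable 1 one_pos)
        (hG.lintegral_lt_top one_pos) hq (q := q) (r := 1) (by linarith) le_rfl (by ring)
        (by linarith) (lintegral_enorm_heatKernel_rpow_lt_top d (by linarith)))
    refine ⟨C, fun t ht => (hC t ht).trans (le_of_eq ?_)⟩
    have e : 2 * (1 / 2 : ℝ) * ((d : ℝ) - (d - α / 2) + -(d : ℝ) + d / q) =
        (d : ℝ) * (1 / q + α / (2 * d) - 1) := by
      field_simp
      ring
    rw [e]
  refine ⟨hJ p hp, fun hcase ν hν hνp => ?_⟩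
  have hp0 : 0 < p := by linarith
  -- The first alternative is equivalent to the time exponent of `J_p` exceeding `-2`; each of the
  -- others implies it.
  have hcond : p * (2 * d - α - 4) < 2 * d := by
    rcases hcase with h | h | ⟨h, h'⟩ | ⟨h, h1, h2⟩ | ⟨h, h'⟩
    · exact h
    · have : (d : ℝ) ≤ 2 := by exact_mod_cast h
      nlinarith
    · subst h
      push_cast
      nlinarith
    · subst h
      rw [lt_div_iff₀ (by linarith)] at h2
      push_cast
      linarith
    · have : (4 : ℝ) ≤ d := by exact_mod_cast h
      rwa [lt_div_iff₀ (by linarith)] at h'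
  obtain ⟨C₁, hC₁⟩ := hJ 2 le_rfl
  obtain ⟨C₂, hC₂⟩ := hJ p hp
  have g1 : -2 < (d : ℝ) * (1 / 2 + α / (2 * d) - 1) := by
    have : (d : ℝ) * (1 / 2 + α / (2 * d) - 1) = (α - d) / 2 := by
      field_simp
      ring
    rw [this]
    linarith
  have g2 : -2 < (d : ℝ) * (1 / p + α / (2 * d) - 1) := by
    have : (d : ℝ) * (1 / p + α / (2 * d) - 1) = (2 * d + p * (α - 2 * d)) / (2 * p) := by
      field_simp
      ring
    rw [this, lt_div_iff₀ (by positivity)]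
    linarith
  obtain ⟨C, hC⟩ := exists_solutionMomentBound_of_rpow.{u} hp hν hνp hκ hκf
    (fun t ht => hG.hasLocallyBoundedFourier ht)
    (Or.inl fun t ht => hG.evenDistribution ht) g1 g2 hC₁ hC₂
  refine ⟨C, hC.mono fun t ht => le_of_eq ?_⟩
  rw [mul_rpow_add_eq ht]
  · ring
  · field_simp
    ring

theorem heat_integrable (d : ℕ) {κ : Eu d → ℝ≥0∞} (hκ : IsTempered κ) (hκi : ∫⁻ x, κ x < ⊤)
    {p : ℝ} (hp : 2 ≤ p) :
    (∃ C : ℝ, ∀ t : ℝ, 0 < t →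
      J (heatG d) κ p t ≤ ENNReal.ofReal (C * t ^ ((d : ℝ) * (1 / p - 1)))) ∧
    ((p * ((d : ℝ) - 2) < d ∨ d ≤ 2 ∨ (d = 3 ∧ p < 3)) →
      ∀ ν : Measure ℝ, IsJumpMeasure ν → moment ν p < ⊤ →
        ∃ C : ℝ, SolutionMomentBound.{u} ν κ (heatG d) p
          (fun t => ENNReal.ofReal (C * t ^ (-(d : ℝ) / 2 + 1) *
            (t ^ ((d : ℝ) / 4) + t ^ ((d : ℝ) / (2 * p)))))) := by
  have hG := isSelfSimilar_heatG d
  have hJ : ∀ q : ℝ, 2 ≤ q → ∃ C : ℝ, ∀ t : ℝ, 0 < t →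
      J (heatG d) κ q t ≤ ENNReal.ofReal (C * t ^ ((d : ℝ) * (1 / q - 1))) := by
    intro q hq
    obtain ⟨C, hC⟩ := hG.exists_J_le_of_integrable hκ hκi.ne (p := q) (by linarith)
      (lintegral_enorm_heatKernel_rpow_lt_top d (by linarith)).ne
    refine ⟨C, fun t ht => (hC t ht).trans (le_of_eq ?_)⟩
    congr 3
    ring
  refine ⟨hJ p hp, fun hcase ν hν hνp => ?_⟩
  have hp0 : 0 < p := by linarith
  -- These say that the time exponents of `J_p` and of `J_2` exceed `-2`; as `p ≥ 2`, the first
  -- implies the second.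
  have hcond : p * ((d : ℝ) - 2) < d ∧ (d : ℝ) < 4 := by
    rcases hcase with h | h | ⟨h, h'⟩
    · refine ⟨h, ?_⟩
      by_contra! h4
      nlinarith
    · have h2 : (d : ℝ) ≤ 2 := by exact_mod_cast h
      refine ⟨?_, by linarith⟩
      nlinarith [mul_nonneg (sub_nonneg.2 hp) (sub_nonneg.2 h2)]
    · subst h
      push_cast
      constructor <;> linarith
  obtain ⟨C₁, hC₁⟩ := hJ 2 le_rfl
  obtain ⟨C₂, hC₂⟩ := hJ p hp
  have g2 : -2 < (d : ℝ) * (1 / p - 1) := by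
    have : (d : ℝ) * (1 / p - 1) = (d - d * p) / p := by field_simp
    rw [this, lt_div_iff₀ hp0]
    linarith [hcond.1]
  obtain ⟨C, hC⟩ := exists_solutionMomentBound_of_rpow.{u} hp hν hνp hκ
    (exists_hasFourier_of_lintegral hκ.1 hκi) (fun t ht => hG.hasLocallyBoundedFourier ht)
    (Or.inl fun t ht => hG.evenDistribution ht) (by linarith [hcond.2]) g2 hC₁ hC₂
  refine ⟨C, hC.mono fun t ht => le_of_eq ?_⟩
  rw [mul_rpow_add_eq ht]
  · ring
  · field_simp
    ring

end HeatEquation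

end LevyColored

namespace LevyColored

/-! ### The wave equation with a Gaussian kernel -/

section WaveSymbol

variable {d : ℕ}

/-- The Fourier transform of the fundamental solution of the wave equation. -/
noncomputable def waveSymbol (d : ℕ) (t : ℝ) (ξ : Eu d) : ℂ :=
  ((t * Real.sinc (t * (2 * Real.pi * ‖ξ‖)) : ℝ) : ℂ)

theorem continuous_waveSymbol (d : ℕ) (t : ℝ) : Continuous (waveSymbol d t) := by
  have := Real.continuous_sinc
  unfold waveSymbol
  fun_prop

theorem norm_waveSymbol_le (t : ℝ) (ξ : Eu d) : ‖waveSymbol d t ξ‖ ≤ |t| := by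
  rw [waveSymbol, Complex.norm_real, Real.norm_eq_abs, abs_mul]
  exact mul_le_of_le_one_right (abs_nonneg _) (Real.abs_sinc_le_one _)

theorem waveG_apply (t : ℝ) (φ : 𝓢(Eu d, ℂ)) :
    waveG d t φ = ∫ ξ, waveSymbol d t ξ * (𝓕⁻ φ) ξ := by
  rw [waveG, TemperedDistribution.fourierInv_apply, Lp.toTemperedDistribution_apply]
  refine integral_congr_ae ?_
  filter_upwards [(waveSymbol_memLp d t).coeFn_toLp] with x hx
  rw [hx, smul_eq_mul, mul_comm]
  rfl

theorem hasLocallyBoundedFourier_waveG (d : ℕ) (t : ℝ) :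
    HasLocallyBoundedFourier (fun φ => waveG d t φ) := by
  refine fun R => ⟨|t|, fun φ _ => ?_⟩
  change ‖waveG d t (𝓕 φ)‖ ≤ _
  rw [waveG_apply, FourierTransform.fourierInv_fourier_eq, ← integral_const_mul]
  refine norm_integral_le_of_norm_le (φ.integrable.norm.const_mul _) (ae_of_all _ fun x => ?_)
  rw [norm_mul]
  gcongr
  exact norm_waveSymbol_le t x

theorem integrable_waveSymbol_mul (t : ℝ) {f : Eu d → ℂ} (hf : Integrable f) :
    Integrable (fun ξ => waveSymbol d t ξ * f ξ) := by
  refine (hf.norm.const_mul |t|).mono'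
    ((continuous_waveSymbol d t).aestronglyMeasurable.mul hf.1) (ae_of_all _ fun ξ => ?_)
  rw [norm_mul]
  gcongr
  exact norm_waveSymbol_le t ξ

theorem waveG_shift (t : ℝ) (y : Eu d) (φ : 𝓢(Eu d, ℂ)) :
    waveG d t (shift y φ) = 𝓕 (fun ξ => waveSymbol d t ξ * (𝓕⁻ φ) ξ) y := by
  have h : 𝓕⁻ (shift y φ) = modulate y (𝓕⁻ φ) := by
    rw [modulate, FourierTransform.fourier_fourierInv_eq]
  rw [waveG_apply, h, Real.fourier_eq]
  refine integral_congr_ae (ae_of_all _ fun ξ => ?_)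
  simp only [modulate_apply, Circle.smul_def, smul_eq_mul]
  ring

/-- In a general dimension the fundamental solution need not be a function. When `κ` and `𝓕 κ` are
integrable, its convolution with `κ` is the inverse transform of the product of symbols, by moving
transforms across integrals. -/
theorem hasConv_waveG (t : ℝ) {κ : Eu d → ℝ≥0∞}
    (hκ : Integrable (fun x => ((κ x).toReal : ℂ)))
    (hκ' : Integrable (𝓕 (fun x => ((κ x).toReal : ℂ)))) :
    HasConv (waveG d t) κ
      (𝓕⁻ (fun ξ => waveSymbol d t ξ * 𝓕 (fun x => ((κ x).toReal : ℂ)) ξ)) := by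
  have h1 := integrable_waveSymbol_mul t hκ'
  have hc : Continuous (𝓕⁻ (fun ξ => waveSymbol d t ξ * 𝓕 (fun x => ((κ x).toReal : ℂ)) ξ)) := by
    rw [Real.fourierInv_eq_fourier_comp_neg]
    exact continuous_fourier h1.comp_neg
  refine ⟨hc.aestronglyMeasurable, fun φ => ?_⟩
  have h2 : Integrable (fun ξ => waveSymbol d t ξ * (𝓕⁻ φ) ξ) :=
    integrable_waveSymbol_mul t (𝓕⁻ φ).integrable
  simp_rw [waveG_shift]
  refine ⟨?_, ?_, ?_⟩
  · refine (hκ.norm.mul_const (∫ ξ, ‖waveSymbol d t ξ * (𝓕⁻ φ) ξ‖)).mono'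
      (hκ.1.mul (continuous_fourier h2).aestronglyMeasurable) (ae_of_all _ fun y => ?_)
    rw [norm_mul]
    gcongr
    exact norm_fourier_le_integral _ y
  · refine (φ.integrable.norm.const_mul
      (∫ ξ, ‖waveSymbol d t ξ * 𝓕 (fun x => ((κ x).toReal : ℂ)) ξ‖)).mono'
      (hc.aestronglyMeasurable.mul φ.continuous.aestronglyMeasurable) (ae_of_all _ fun y => ?_)
    rw [norm_mul]
    gcongr
    exact norm_fourierInv_le_integral _ y
  · rw [← integral_fourier_mul_eq hκ h2, integral_fourierInv_mul_eq h1 φ.integrable,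
      ← SchwartzMap.fourierInv_coe]
    refine integral_congr_ae (ae_of_all _ fun ξ => ?_)
    ring

/-- Interpolation between `L²` and `L^∞` with a common bound: `|g|^p ≤ M^{p-2} |g|²`. -/
theorem eLpNorm_le_of_enorm_le {α F : Type*} [MeasurableSpace α] [NormedAddCommGroup F]
    {μ : Measure α} {g : α → F} {M : ℝ≥0∞} (hM : M ≠ ⊤) (hg : ∀ x, ‖g x‖ₑ ≤ M)
    (hg2 : eLpNorm g 2 μ ≤ M) {p : ℝ} (hp : 2 ≤ p) : eLpNorm g (ENNReal.ofReal p) μ ≤ M := by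
  have hp0 : 0 < p := by linarith
  have h0 : ∀ x : ℝ≥0∞, x ^ p = x ^ (p - 2) * x ^ (2 : ℝ) := fun x => by
    rw [← ENNReal.rpow_add_of_nonneg _ _ (by linarith) two_pos.le, sub_add_cancel]
  rw [eLpNorm_two_eq, one_div, ENNReal.rpow_inv_le_iff two_pos] at hg2
  rw [eLpNorm_ofReal_eq _ hp0, one_div, ENNReal.rpow_inv_le_iff hp0, h0 M]
  calc ∫⁻ x, ‖g x‖ₑ ^ p ∂μ ≤ ∫⁻ x, M ^ (p - 2) * ‖g x‖ₑ ^ (2 : ℝ) ∂μ := by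
        refine lintegral_mono fun x => ?_
        simp only
        rw [h0]
        have : 0 ≤ p - 2 := by linarith
        gcongr
        exact hg x
    _ = M ^ (p - 2) * ∫⁻ x, ‖g x‖ₑ ^ (2 : ℝ) ∂μ :=
        lintegral_const_mul' _ _ (ENNReal.rpow_ne_top_of_nonneg (by linarith) hM)
    _ ≤ _ := by gcongr

/-- Plancherel's theorem for an integrable and square integrable function. -/
theorem eLpNorm_fourier_eq {f : Eu d → ℂ} (hf : Integrable f) (hf2 : MemLp f 2) :
    eLpNorm (𝓕 f) 2 volume = eLpNorm f 2 volume := by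
  set F : Lp ℂ 2 (volume : Measure (Eu d)) := 𝓕 (hf2.toLp f) with hF
  have hl : LocallyIntegrable (fun ξ => 𝓕 f ξ - F ξ) :=
    (continuous_fourier hf).locallyIntegrable.sub ((Lp.memLp F).locallyIntegrable one_le_two)
  have h := ae_eq_zero_of_integral_mul_schwartz hl fun φ _ => by
    have i1 : Integrable (fun ξ => 𝓕 f ξ * φ ξ) := by
      refine (φ.integrable.norm.const_mul (∫ x, ‖f x‖)).mono'
        ((continuous_fourier hf).aestronglyMeasurable.mul φ.continuous.aestronglyMeasurable)
        (ae_of_all _ fun ξ => ?_)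
      rw [norm_mul]
      gcongr
      exact norm_fourier_le_integral _ ξ
    have i2 : Integrable (fun ξ => F ξ * φ ξ) := (Lp.memLp F).integrable_mul (φ.memLp 2 volume)
    simp only [sub_mul]
    rw [integral_sub i1 i2, ← integral_mul_fourier_eq hf2 φ, integral_fourier_mul_eq hf φ.integrable,
      ← SchwartzMap.fourier_coe, sub_self]
  have h1 : 𝓕 f =ᵐ[volume] F := by
    filter_upwards [h] with x hx
    exact sub_eq_zero.1 hx
  rw [eLpNorm_congr_ae h1, ← ENNReal.ofReal_toReal (Lp.memLp F).2.ne,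
    ← ENNReal.ofReal_toReal hf2.2.ne, ← Lp.norm_def, hF, Lp.norm_fourier_eq, Lp.norm_toLp]

theorem eLpNorm_fourierInv_eq {f : Eu d → ℂ} (hf : Integrable f) (hf2 : MemLp f 2) :
    eLpNorm (𝓕⁻ f) 2 volume = eLpNorm f 2 volume := by
  rw [← eLpNorm_fourier_eq hf hf2]
  have h : 𝓕⁻ f = fun x => 𝓕 f (-x) := funext fun x => Real.fourierInv_eq_fourier_neg f x
  rw [h]
  exact eLpNorm_comp_measurePreserving (continuous_fourier hf).aestronglyMeasurable
    (Measure.measurePreserving_neg volume)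

/-- The wave symbol is at most `t` in modulus. Hence the convolution is bounded by `t ‖𝓕 κ‖₁`
pointwise and, by Plancherel, by `t ‖𝓕 κ‖₂` in `L²`. -/
theorem exists_J_waveG_le {κ : Eu d → ℝ≥0∞}
    (hκ : Integrable (fun x => ((κ x).toReal : ℂ)))
    (hκ1 : Integrable (𝓕 (fun x => ((κ x).toReal : ℂ))))
    (hκ2 : MemLp (𝓕 (fun x => ((κ x).toReal : ℂ))) 2) {p : ℝ} (hp : 2 ≤ p) :
    ∃ C : ℝ, ∀ t : ℝ, 0 < t → J (waveG d) κ p t ≤ ENNReal.ofReal (C * t ^ 2) := by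
  set K := 𝓕 (fun x => ((κ x).toReal : ℂ)) with hK
  set M := max (∫⁻ ξ, ‖K ξ‖ₑ) (eLpNorm K 2 volume) with hM
  have hMt : M ≠ ⊤ := (max_lt hκ1.2 hκ2.2).ne
  refine ⟨M.toReal ^ 2, fun t ht => ?_⟩
  have e : ENNReal.ofReal (M.toReal ^ 2 * t ^ 2) = (ENNReal.ofReal t * M) ^ 2 := by
    rw [ENNReal.ofReal_mul (by positivity), ENNReal.ofReal_pow ENNReal.toReal_nonneg,
      ENNReal.ofReal_toReal hMt, ENNReal.ofReal_pow ht.le, mul_pow, mul_comm]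
  have hb : ∀ ξ, ‖waveSymbol d t ξ * K ξ‖ₑ ≤ ENNReal.ofReal t * ‖K ξ‖ₑ := by
    intro ξ
    rw [enorm_mul]
    gcongr
    rw [← ofReal_norm]
    exact ENNReal.ofReal_le_ofReal ((norm_waveSymbol_le t ξ).trans (abs_of_pos ht).le)
  have hb2 : eLpNorm (fun ξ => waveSymbol d t ξ * K ξ) 2 volume ≤
      ENNReal.ofReal t * eLpNorm K 2 volume := by
    refine eLpNorm_le_mul_eLpNorm_of_ae_le_mul (c := t) (ae_of_all _ fun ξ => ?_) 2
    rw [norm_mul]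
    gcongr
    exact (norm_waveSymbol_le t ξ).trans (abs_of_pos ht).le
  have hi := integrable_waveSymbol_mul t hκ1
  rw [e, J]
  gcongr
  refine (iInf₂_le _ (hasConv_waveG t hκ hκ1)).trans ?_
  refine eLpNorm_le_of_enorm_le (ENNReal.mul_ne_top ENNReal.ofReal_ne_top hMt) (fun x => ?_) ?_ hp
  · refine le_trans ?_ (mul_le_mul_right (le_max_left _ _) _)
    rw [← lintegral_const_mul' _ _ ENNReal.ofReal_ne_top]
    refine le_trans ?_ (lintegral_mono hb)
    rw [Real.fourierInv_eq]
    refine (enorm_integral_le_lintegral_enorm _).trans (le_of_eq (lintegral_congr fun ξ => ?_))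
    rw [← ofReal_norm, Circle.norm_smul, ofReal_norm]
  · rw [eLpNorm_fourierInv_eq hi ⟨hi.1, hb2.trans_lt (ENNReal.mul_lt_top ENNReal.ofReal_lt_top hκ2.2)⟩]
    exact hb2.trans (mul_le_mul_right (le_max_right _ _) _)

theorem norm_fourier_heatColor (d : ℕ) {s : ℝ} (hs : 0 < s) : ∃ C : ℝ, ∃ r : ℝ, 0 < r ∧ ∀ ξ : Eu d,
    ‖𝓕 (fun x => ((heatColor d s x).toReal : ℂ)) ξ‖ = C * heatKernel d r ξ := by
  have hb : 0 < ((1 / (2 * s) : ℝ) : ℂ).re := by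
    rw [Complex.ofReal_re]
    positivity
  set c : ℝ := (2 * Real.pi * s) ^ (-(d : ℝ) / 2) with hc
  set A : ℂ := ((Real.pi : ℂ) / ((1 / (2 * s) : ℝ) : ℂ)) ^ ((Module.finrank ℝ (Eu d) : ℂ) / 2) with hA
  -- The transform has the shape `exp(-2π² s |ξ|²)`, that is `exp(-|ξ|² / (2r))` for this `r`.
  set r : ℝ := 1 / (4 * Real.pi ^ 2 * s) with hr
  have hr0 : 0 < r := by positivity
  refine ⟨|c| * ‖A‖ / (2 * Real.pi * r) ^ (-(d : ℝ) / 2), r, hr0, fun ξ => ?_⟩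
  have h1 : (fun x => ((heatColor d s x).toReal : ℂ)) =
      (c : ℂ) • fun x : Eu d => Complex.exp (-((1 / (2 * s) : ℝ) : ℂ) * ‖x‖ ^ 2) := by
    ext x
    rw [heatColor, ENNReal.toReal_ofReal (heatKernel_nonneg d hs x), heatKernel]
    simp only [Pi.smul_apply, smul_eq_mul]
    push_cast
    congr 2
    ring
  have h2 : 𝓕 ((c : ℂ) • fun x : Eu d => Complex.exp (-((1 / (2 * s) : ℝ) : ℂ) * ‖x‖ ^ 2)) ξ =
      (c : ℂ) * 𝓕 (fun x : Eu d => Complex.exp (-((1 / (2 * s) : ℝ) : ℂ) * ‖x‖ ^ 2)) ξ := by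
    rw [Real.fourier_eq, Real.fourier_eq, ← integral_const_mul]
    refine integral_congr_ae (ae_of_all _ fun x => ?_)
    simp only [Pi.smul_apply, smul_eq_mul, Circle.smul_def]
    ring
  rw [h1, h2, fourier_gaussian_innerProductSpace hb, norm_mul, norm_mul, ← hA, Complex.norm_real,
    Real.norm_eq_abs, heatKernel, Complex.norm_exp]
  have h3 : (-(Real.pi : ℂ) ^ 2 * (‖ξ‖ : ℂ) ^ 2 / ((1 / (2 * s) : ℝ) : ℂ)).re = -‖ξ‖ ^ 2 / (2 * r) := by
    have : -(Real.pi : ℂ) ^ 2 * (‖ξ‖ : ℂ) ^ 2 / ((1 / (2 * s) : ℝ) : ℂ) =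
        ((-Real.pi ^ 2 * ‖ξ‖ ^ 2 / (1 / (2 * s)) : ℝ) : ℂ) := by push_cast; ring
    rw [this, Complex.ofReal_re, hr]
    field_simp
    ring
  rw [h3]
  have h4 : (2 * Real.pi * r) ^ (-(d : ℝ) / 2) ≠ 0 := by positivity
  field_simp

theorem wave_heatColor (d : ℕ) {α p : ℝ} (hα : 0 < α) (hp : 2 ≤ p) :
    (∃ C : ℝ, ∀ t : ℝ, 0 < t →
      J (waveG d) (heatColor d (α / 2)) p t ≤ ENNReal.ofReal (C * t ^ 2)) ∧
    ∀ ν : Measure ℝ, IsJumpMeasure ν → moment ν p < ⊤ →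
      ∃ C : ℝ, SolutionMomentBound.{u} ν (heatColor d (α / 2)) (waveG d) p
        (fun t => ENNReal.ofReal (C * t ^ 2)) := by
  have hs : 0 < α / 2 := by linarith
  set s := α / 2 with hs'
  have hκm := measurable_heatColor d s
  have hκi := lintegral_heatColor_lt_top d hs
  have hκ := isTempered_of_lintegral_lt_top hκm hκi
  have hI : Integrable (fun x => ((heatColor d s x).toReal : ℂ)) :=
    (integrable_toReal_of_lintegral_ne_top hκm.aemeasurable hκi.ne).ofReal
  obtain ⟨C, r, hr, hCr⟩ := norm_fourier_heatColor d hs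
  have hKm : AEStronglyMeasurable (𝓕 (fun x => ((heatColor d s x).toReal : ℂ))) volume :=
    (continuous_fourier hI).aestronglyMeasurable
  have hmem : ∀ q : ℝ, 1 ≤ q →
      MemLp (𝓕 (fun x => ((heatColor d s x).toReal : ℂ))) (ENNReal.ofReal q) := by
    intro q hq
    have h1 : MemLp (heatKernel d r) (ENNReal.ofReal q) volume := by
      refine ⟨(continuous_heatKernel d r).aestronglyMeasurable, ?_⟩
      rw [eLpNorm_ofReal_eq _ (by linarith)]
      refine ENNReal.rpow_lt_top_of_nonneg (by positivity) (ne_of_lt ?_)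
      have h2 := lintegral_heatColor_rpow_lt_top d hr hq
      refine lt_of_eq_of_lt (lintegral_congr fun x => ?_) h2
      rw [heatColor, Real.enorm_of_nonneg (heatKernel_nonneg d hr x)]
    refine (h1.const_mul C).mono hKm (ae_of_all _ fun ξ => ?_)
    rw [hCr]
    exact le_abs_self _
  have hK1 : Integrable (𝓕 (fun x => ((heatColor d s x).toReal : ℂ))) := by
    have := hmem 1 le_rfl
    rwa [ENNReal.ofReal_one, memLp_one_iff_integrable] at this
  have hK2 : MemLp (𝓕 (fun x => ((heatColor d s x).toReal : ℂ))) 2 := by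
    have := hmem 2 one_le_two
    rwa [ENNReal.ofReal_ofNat] at this
  refine ⟨exists_J_waveG_le hI hK1 hK2 hp, fun ν hν hνp => ?_⟩
  obtain ⟨C₁, hC₁⟩ := exists_J_waveG_le hI hK1 hK2 le_rfl
  obtain ⟨C₂, hC₂⟩ := exists_J_waveG_le hI hK1 hK2 hp
  obtain ⟨D, hD⟩ := exists_solutionMomentBound_of_rpow.{u} hp hν hνp hκ
    (exists_hasFourier_of_lintegral hκm hκi)
    (fun t _ => hasLocallyBoundedFourier_waveG d t)
    (Or.inr (ae_of_all _ fun x => by simp only [heatColor, heatKernel_neg]))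
    (γ₁ := 2) (γ₂ := 2) (by norm_num) (by norm_num)
    (fun t ht => by rw [Real.rpow_two]; exact hC₁ t ht)
    (fun t ht => by rw [Real.rpow_two]; exact hC₂ t ht)
  refine ⟨2 * D, hD.mono fun t _ => le_of_eq ?_⟩
  norm_num
  ring_nf

end WaveSymbol

end LevyColored

namespace LevyColored

/-! ### The fundamental solution of the wave equation in dimensions one and two -/

section WaveDensity

theorem waveG_eq_integral {d : ℕ} {t : ℝ} {a : Eu d → ℂ} (ha : Integrable a)
    (h : 𝓕 a = waveSymbol d t) (φ : 𝓢(Eu d, ℂ)) : waveG d t φ = ∫ x, a x * φ x := by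
  have h2 := integral_fourier_mul_eq ha (𝓕⁻ φ).integrable
  rw [← SchwartzMap.fourier_coe, FourierTransform.fourier_fourierInv_eq] at h2
  rw [waveG_apply, ← h, h2]

theorem integral_eu_one (F : ℝ → ℂ) : ∫ v : Eu 1, F (v 0) = ∫ x, F x :=
  ((EuclideanSpace.volume_preserving_symm_measurableEquiv_toLp (Fin 1)).trans
    (volume_preserving_funUnique (Fin 1) ℝ)).integral_comp' F

theorem integral_eu_two (F : ℝ × ℝ → ℂ) : ∫ v : Eu 2, F (v 0, v 1) = ∫ z, F z :=
  ((EuclideanSpace.volume_preserving_symm_measurableEquiv_toLp (Fin 2)).trans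
    (volume_preserving_finTwoArrow ℝ)).integral_comp' F

theorem integrable_eu_two {F : ℝ × ℝ → ℂ} (h : Integrable (fun v : Eu 2 => F (v 0, v 1))) :
    Integrable F :=
  (((EuclideanSpace.volume_preserving_symm_measurableEquiv_toLp (Fin 2)).trans
    (volume_preserving_finTwoArrow ℝ)).integrable_comp_emb
      (MeasurableEquiv.measurableEmbedding _)).1 h

theorem integral_exp_mul_I_sinc (c t : ℝ) :
    ∫ x in -t..t, Complex.exp (((c * x : ℝ) : ℂ) * Complex.I) = 2 * t * Real.sinc (t * c) := by
  rcases eq_or_ne c 0 with rfl | hc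
  · simp
    ring
  · have h := intervalIntegral.integral_comp_mul_left (a := -t) (b := t)
      (fun u : ℝ => Complex.exp ((u : ℂ) * Complex.I)) hc
    have e : c * -t = -(c * t) := by ring
    rw [h, e, integral_exp_mul_I_eq_sinc, Complex.real_smul, mul_comm t c]
    have hc' : (c : ℂ) ≠ 0 := by exact_mod_cast hc
    push_cast
    field_simp

theorem integral_fourierChar_Ioo {t : ℝ} (ht : 0 < t) (r : ℝ) :
    ∫ x, ((Real.fourierChar (-(x * r)) : Circle) : ℂ) *
      (Ioo (-t) t).indicator (fun _ => (1 / 2 : ℂ)) x = ((t * Real.sinc (t * (2 * Real.pi * |r|)) : ℝ) : ℂ) := by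
  have h1 : ∀ x : ℝ, ((Real.fourierChar (-(x * r)) : Circle) : ℂ) *
      (Ioo (-t) t).indicator (fun _ => (1 / 2 : ℂ)) x = (Ioo (-t) t).indicator (fun x : ℝ =>
        Complex.exp (((-(2 * Real.pi * r) * x : ℝ) : ℂ) * Complex.I) * (1 / 2)) x := by
    intro x
    by_cases hx : x ∈ Ioo (-t) t
    · rw [indicator_of_mem hx, indicator_of_mem hx, Real.fourierChar_apply]
      congr 4
      ring
    · rw [indicator_of_notMem hx, indicator_of_notMem hx, mul_zero]
  simp_rw [h1]
  rw [integral_indicator measurableSet_Ioo, integral_mul_const, ← integral_Ioc_eq_integral_Ioo,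
    ← intervalIntegral.integral_of_le (by linarith), integral_exp_mul_I_sinc]
  have h2 : Real.sinc (t * -(2 * Real.pi * r)) = Real.sinc (t * (2 * Real.pi * |r|)) := by
    rcases abs_cases r with ⟨h, -⟩ | ⟨h, -⟩
    · rw [h, mul_neg, Real.sinc_neg]
    · rw [h]
      congr 1
      ring
  rw [h2]
  push_cast
  ring

/-- The fundamental solution of the wave equation in dimension one. -/
noncomputable def waveDensityOne (t : ℝ) (x : Eu 1) : ℂ :=
  (Metric.ball (0 : Eu 1) t).indicator (fun _ => (1 / 2 : ℂ)) x

theorem norm_eu_one (v : Eu 1) : ‖v‖ = |v 0| := by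
  simp [EuclideanSpace.norm_eq, Real.sqrt_sq_eq_abs]

theorem integrable_pow_mul_of_support {d : ℕ} {a : Eu d → ℂ} (ha : Integrable a) {t : ℝ}
    (h : ∀ x, t ≤ ‖x‖ → a x = 0) (k : ℕ) : Integrable (fun x => (1 + ‖x‖ ^ 2) ^ k * ‖a x‖) := by
  refine (ha.norm.const_mul ((1 + t ^ 2) ^ k)).mono'
    ((by fun_prop : Continuous fun x : Eu d => (1 + ‖x‖ ^ 2) ^ k).aestronglyMeasurable.mul
      ha.1.norm) (ae_of_all _ fun x => ?_)
  rw [Real.norm_of_nonneg (by positivity)]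
  rcases le_or_gt t ‖x‖ with h1 | h1
  · simp [h x h1]
  · gcongr

theorem integrable_waveDensityOne (t : ℝ) : Integrable (waveDensityOne t) :=
  (integrable_indicator_iff measurableSet_ball).2
    (integrableOn_const measure_ball_lt_top.ne)

theorem fourier_waveDensityOne {t : ℝ} (ht : 0 < t) :
    𝓕 (waveDensityOne t) = waveSymbol 1 t := by
  ext ξ
  rw [Real.fourier_eq, waveSymbol, norm_eu_one, ← integral_fourierChar_Ioo ht (ξ 0),
    ← integral_eu_one]
  refine integral_congr_ae (ae_of_all _ fun v => ?_)
  simp only [Circle.smul_def, smul_eq_mul]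
  have h1 : ⟪v, ξ⟫ = v 0 * ξ 0 := by
    simp [PiLp.inner_apply, mul_comm]
  have h2 : waveDensityOne t v = (Ioo (-t) t).indicator (fun _ => (1 / 2 : ℂ)) (v 0) := by
    rw [waveDensityOne]
    by_cases hv : |v 0| < t
    · rw [indicator_of_mem (by rwa [mem_ball_zero_iff, norm_eu_one]),
        indicator_of_mem (show v 0 ∈ Ioo (-t) t from abs_lt.1 hv)]
    · rw [indicator_of_notMem (by rwa [mem_ball_zero_iff, norm_eu_one]),
        indicator_of_notMem (show v 0 ∉ Ioo (-t) t from fun h => hv (abs_lt.2 h))]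
  rw [h1, h2]

theorem isSelfSimilar_waveG_one : IsSelfSimilar (waveG 1) waveDensityOne 1 0 where
  measurable t _ := measurable_const.indicator measurableSet_ball
  integrable t _ := integrable_pow_mul_of_support (integrable_waveDensityOne t) (t := t)
    fun x hx => indicator_of_notMem (by simpa using hx) _
  apply t ht := waveG_eq_integral (integrable_waveDensityOne t) (fourier_waveDensityOne ht)
  even t _ x := by simp [waveDensityOne, indicator]
  scale t ht x := by
    rw [Real.rpow_one, Real.rpow_zero, ENNReal.ofReal_one, one_mul]
    congr 1
    simp only [waveDensityOne, indicator, mem_ball_zero_iff, norm_smul, Real.norm_of_nonneg ht.le]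
    congr 1
    rw [mul_lt_iff_lt_one_right ht]

theorem lintegral_waveDensityOne_rpow_lt_top {p : ℝ} (hp : 1 ≤ p) :
    ∫⁻ x, ‖waveDensityOne 1 x‖ₑ ^ p < ⊤ := by
  refine lintegral_rpow_lt_top_of_le ENNReal.one_ne_top (fun x => ?_)
    (isSelfSimilar_waveG_one.lintegral_lt_top one_pos) hp
  rw [waveDensityOne, ← ofReal_norm, ← ENNReal.ofReal_one]
  refine ENNReal.ofReal_le_ofReal ((norm_indicator_le_norm_self _ x).trans ?_)
  norm_num

/-- The fundamental solution of the wave equation in dimension two. -/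
noncomputable def waveDensityTwo (t : ℝ) (x : Eu 2) : ℂ :=
  (((2 * Real.pi)⁻¹ * (√(t ^ 2 - ‖x‖ ^ 2))⁻¹ : ℝ) : ℂ)

theorem measurable_waveDensityTwo (t : ℝ) : Measurable (waveDensityTwo t) := by
  unfold waveDensityTwo
  fun_prop

/-- The conventions `√x = 0` for `x ≤ 0` and `0⁻¹ = 0` build the indicator of the disc into the
formula. -/
theorem waveDensityTwo_eq_zero {t : ℝ} (ht : 0 < t) {x : Eu 2} (hx : t ≤ ‖x‖) :
    waveDensityTwo t x = 0 := by
  rw [waveDensityTwo, Real.sqrt_eq_zero_of_nonpos (by nlinarith)]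
  simp

theorem norm_waveDensityTwo (t : ℝ) (x : Eu 2) :
    ‖waveDensityTwo t x‖ = (2 * Real.pi)⁻¹ * (√(t ^ 2 - ‖x‖ ^ 2))⁻¹ := by
  rw [waveDensityTwo, Complex.norm_real, Real.norm_of_nonneg (by positivity)]

/-- In polar coordinates `t² - y² ≥ t (t - y)` for `0 < y < t`, so the singularity at the light cone
is at most `(t - y)^{-q/2}`, integrable because `q < 2`. -/
theorem lintegral_waveDensityTwo_rpow_lt_top {t : ℝ} (ht : 0 < t) {q : ℝ} (hq : 1 ≤ q)
    (hq2 : q < 2) : ∫⁻ x, ‖waveDensityTwo t x‖ₑ ^ q < ⊤ := by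
  have hq0 : 0 < q := by linarith
  have hI : Integrable (fun x : Eu 2 => ((√(t ^ 2 - ‖x‖ ^ 2))⁻¹) ^ q) := by
    rw [integrable_fun_norm_addHaar volume (f := fun y : ℝ => ((√(t ^ 2 - y ^ 2))⁻¹) ^ q)]
    have h0 : IntervalIntegrable (fun y : ℝ => (t - y) ^ (-(q / 2))) volume 0 t := by
      have := (intervalIntegral.intervalIntegrable_rpow' (a := 0) (b := t) (r := -(q / 2))
        (by linarith)).comp_sub_left t
      simpa using this.symm
    have h1 : Integrable ((Ioo 0 t).indicator fun y : ℝ =>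
        t * (t ^ (-(q / 2)) * (t - y) ^ (-(q / 2)))) :=
      (integrable_indicator_iff measurableSet_Ioo).2 (((intervalIntegrable_iff_integrableOn_Ioo_of_le
        ht.le).1 h0).const_mul _ |>.const_mul _)
    refine h1.integrableOn.mono' ?_ ((ae_restrict_mem measurableSet_Ioi).mono fun y hy => ?_)
    · exact (by fun_prop : Measurable fun y : ℝ =>
        y ^ (Module.finrank ℝ (Eu 2) - 1) • ((√(t ^ 2 - y ^ 2))⁻¹) ^ q).aestronglyMeasurable
    · have hy0 : 0 < y := hy
      rw [finrank_euclideanSpace_fin, smul_eq_mul, pow_one, Real.norm_of_nonneg (by positivity)]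
      by_cases hyt : y < t
      · rw [indicator_of_mem (show y ∈ Ioo 0 t from ⟨hy0, hyt⟩), ← Real.mul_rpow ht.le (by linarith)]
        have hpos : 0 < t * (t - y) := mul_pos ht (by linarith)
        have h2 : t * (t - y) ≤ t ^ 2 - y ^ 2 := by nlinarith
        have h3 : ((√(t ^ 2 - y ^ 2))⁻¹) ^ q = (t ^ 2 - y ^ 2) ^ (-(q / 2)) := by
          rw [Real.sqrt_eq_rpow, ← Real.rpow_neg (by linarith), ← Real.rpow_mul (by linarith)]
          congr 1
          ring
        rw [h3]
        exact mul_le_mul hyt.le (Real.rpow_le_rpow_of_nonpos hpos h2 (by linarith))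
          (Real.rpow_nonneg (by linarith) _) ht.le
      · rw [indicator_of_notMem (show y ∉ Ioo 0 t from fun h => hyt h.2),
          Real.sqrt_eq_zero_of_nonpos (by nlinarith [not_lt.1 hyt]), inv_zero,
          Real.zero_rpow hq0.ne', mul_zero]
  have h := (hI.const_mul (((2 * Real.pi)⁻¹) ^ q)).lintegral_lt_top
  refine lt_of_eq_of_lt (lintegral_congr fun x => ?_) h
  rw [← ofReal_norm, norm_waveDensityTwo, ENNReal.ofReal_rpow_of_nonneg (by positivity) hq0.le,
    Real.mul_rpow (by positivity) (by positivity)]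

theorem integrable_waveDensityTwo {t : ℝ} (ht : 0 < t) : Integrable (waveDensityTwo t) := by
  have := lintegral_waveDensityTwo_rpow_lt_top ht le_rfl one_lt_two
  simp only [ENNReal.rpow_one] at this
  exact ⟨(measurable_waveDensityTwo t).aestronglyMeasurable, this⟩

/-- The primitive is `arcsin (y / u)`. It is continuous up to the endpoints with nonnegative
derivative inside, which settles integrability there. -/
theorem integral_inv_sqrt_sub_sq {u : ℝ} (hu : 0 < u) : ∫ y, (√(u ^ 2 - y ^ 2))⁻¹ = Real.pi := by
  have hd : ∀ y ∈ Ioo (-u) u,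
      HasDerivAt (fun y => Real.arcsin (y / u)) ((√(u ^ 2 - y ^ 2))⁻¹) y := by
    intro y hy
    have h1 : y / u ≠ -1 := by
      rw [ne_eq, div_eq_iff hu.ne']
      linarith [hy.1]
    have h2 : y / u ≠ 1 := by
      rw [ne_eq, div_eq_iff hu.ne']
      linarith [hy.2]
    have h := (Real.hasDerivAt_arcsin h1 h2).comp y ((hasDerivAt_id y).div_const u)
    refine h.congr_deriv ?_
    have h3 : 1 - (y / u) ^ 2 = (u ^ 2 - y ^ 2) / u ^ 2 := by field_simp
    rw [h3, Real.sqrt_div' _ (by positivity), Real.sqrt_sq hu.le]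
    field_simp
  have hc : Continuous fun y => Real.arcsin (y / u) := by
    have := Real.continuous_arcsin
    fun_prop
  have hle : -u ≤ u := by linarith
  have hi : IntervalIntegrable (fun y => (√(u ^ 2 - y ^ 2))⁻¹) volume (-u) u := by
    refine intervalIntegral.intervalIntegrable_deriv_of_nonneg hc.continuousOn ?_ ?_
    · rw [min_eq_left hle, max_eq_right hle]
      exact hd
    · exact fun _ _ => by positivity
  have h := intervalIntegral.integral_eq_sub_of_hasDerivAt_of_le hle hc.continuousOn hd hi
  rw [div_self hu.ne', neg_div, div_self hu.ne', Real.arcsin_one, Real.arcsin_neg_one,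
    intervalIntegral.integral_of_le hle] at h
  rw [← setIntegral_eq_integral_of_forall_compl_eq_zero (s := Ioc (-u) u), h]
  · ring
  · intro y hy
    rw [Real.sqrt_eq_zero_of_nonpos, inv_zero]
    rcases lt_or_ge (-u) y with h1 | h1
    · have : u < y := by
        by_contra! h2
        exact hy ⟨h1, h2⟩
      nlinarith
    · nlinarith

theorem norm_sq_eu_two (v : Eu 2) : ‖v‖ ^ 2 = v 0 ^ 2 + v 1 ^ 2 := by
  simp [EuclideanSpace.norm_sq_eq, Fin.sum_univ_two]

/-- Descent to dimension one: for a frequency on the first axis the second coordinate integrates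
out, the arcsine integral gives `π`, and what remains is the density `1/2` on `(-t, t)`. -/
theorem fourier_waveDensityTwo_single {t : ℝ} (ht : 0 < t) (r : ℝ) :
    𝓕 (waveDensityTwo t) (EuclideanSpace.single 0 r) =
      ((t * Real.sinc (t * (2 * Real.pi * |r|)) : ℝ) : ℂ) := by
  set F : ℝ × ℝ → ℂ := fun z => ((Real.fourierChar (-(z.1 * r)) : Circle) : ℂ) *
    (((2 * Real.pi)⁻¹ * (√(t ^ 2 - (z.1 ^ 2 + z.2 ^ 2)))⁻¹ : ℝ) : ℂ) with hF
  have e1 : ∀ v : Eu 2, Real.fourierChar (-⟪v, EuclideanSpace.single 0 r⟫) • waveDensityTwo t v =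
      F (v 0, v 1) := by
    intro v
    have h1 : ⟪v, EuclideanSpace.single 0 r⟫ = v 0 * r := by
      simp [PiLp.inner_apply, mul_comm]
    rw [h1, waveDensityTwo, norm_sq_eu_two, Circle.smul_def, smul_eq_mul]
  have hFi : Integrable F := by
    refine integrable_eu_two ?_
    simp_rw [← e1]
    exact (Real.fourierIntegral_convergent_iff _).2 (integrable_waveDensityTwo ht)
  rw [Real.fourier_eq]
  simp_rw [e1]
  rw [integral_eu_two, ← integral_fourierChar_Ioo ht r]
  refine (integral_prod F hFi).trans (integral_congr_ae (ae_of_all _ fun x => ?_))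
  simp only [hF]
  rw [integral_const_mul, integral_complex_ofReal, integral_const_mul]
  congr 1
  by_cases hx : x ∈ Ioo (-t) t
  · have hpos : 0 < t ^ 2 - x ^ 2 := by nlinarith [hx.1, hx.2]
    have h2 := integral_inv_sqrt_sub_sq (Real.sqrt_pos.2 hpos)
    rw [Real.sq_sqrt hpos.le] at h2
    simp only [← sub_sub, indicator_of_mem hx, h2]
    push_cast
    field_simp
  · have h3 : t ^ 2 - x ^ 2 ≤ 0 := by
      rw [mem_Ioo, not_and_or, not_lt, not_lt] at hx
      rcases hx with h | h <;> nlinarith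
    have h4 : ∀ y, √(t ^ 2 - (x ^ 2 + y ^ 2)) = 0 := fun y =>
      Real.sqrt_eq_zero_of_nonpos (by nlinarith [sq_nonneg y])
    simp [h4, indicator_of_notMem hx]

theorem fourier_waveDensityTwo {t : ℝ} (ht : 0 < t) :
    𝓕 (waveDensityTwo t) = waveSymbol 2 t := by
  ext ξ
  have hn : ‖ξ‖ = ‖(EuclideanSpace.single 0 ‖ξ‖ : Eu 2)‖ := by simp
  -- A reflection carrying `ξ` to the first axis; the density is radial, so its Fourier transform is
  -- invariant under it.
  set A : Eu 2 ≃ₗᵢ[ℝ] Eu 2 :=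
    (ℝ ∙ (ξ - (EuclideanSpace.single 0 ‖ξ‖ : Eu 2)))ᗮ.reflection with hA
  have h1 : A ξ = EuclideanSpace.single 0 ‖ξ‖ := Submodule.reflection_sub hn
  have h2 : waveDensityTwo t ∘ A = waveDensityTwo t := by
    ext x
    simp [waveDensityTwo]
  have h3 := Real.fourier_comp_linearIsometry A (waveDensityTwo t) ξ
  rw [h2, h1, fourier_waveDensityTwo_single ht, abs_of_nonneg (norm_nonneg _)] at h3
  exact h3

theorem isSelfSimilar_waveG_two : IsSelfSimilar (waveG 2) waveDensityTwo 1 (-1) where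
  measurable t _ := measurable_waveDensityTwo t
  integrable t ht := integrable_pow_mul_of_support (integrable_waveDensityTwo ht) (t := t)
    fun x hx => waveDensityTwo_eq_zero ht hx
  apply t ht := waveG_eq_integral (integrable_waveDensityTwo ht) (fourier_waveDensityTwo ht)
  even t _ x := by simp [waveDensityTwo]
  scale t ht x := by
    rw [← ofReal_norm, ← ofReal_norm, ← ENNReal.ofReal_mul (by positivity), norm_waveDensityTwo,
      norm_waveDensityTwo, Real.rpow_one, norm_smul, Real.norm_of_nonneg ht.le, Real.rpow_neg_one]
    have : t ^ 2 - (t * ‖x‖) ^ 2 = t ^ 2 * (1 ^ 2 - ‖x‖ ^ 2) := by ring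
    rw [this, Real.sqrt_mul (by positivity), Real.sqrt_sq ht.le, mul_inv]
    congr 1
    ring

end WaveDensity

/-! ### The wave equation in dimensions one and two -/

section WaveEquation

theorem wave_rieszColor_one {α p : ℝ} (hα : 0 < α) (hα1 : α < 1) (hp : 2 ≤ p) :
    (∃ C : ℝ, ∀ t : ℝ, 0 < t →
      J (waveG 1) (rieszColor 1 (α / 2)) p t ≤ ENNReal.ofReal (C * t ^ (2 / p + α))) ∧
    ∀ ν : Measure ℝ, IsJumpMeasure ν → moment ν p < ⊤ →
      ∃ C : ℝ, SolutionMomentBound.{u} ν (rieszColor 1 (α / 2)) (waveG 1) p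
        (fun t => ENNReal.ofReal (C * t ^ (α / 2 + 1) * (t ^ (1 / 2 : ℝ) + t ^ (1 / p)))) := by
  have hG := isSelfSimilar_waveG_one
  obtain ⟨hκ, hκf⟩ := isTempered_and_hasFourier_rieszColor (d := 1) le_rfl (α := α / 2)
    (by linarith) (by push_cast; linarith)
  have hJ : ∀ q : ℝ, 2 ≤ q → ∃ C : ℝ, ∀ t : ℝ, 0 < t →
      J (waveG 1) (rieszColor 1 (α / 2)) q t ≤ ENNReal.ofReal (C * t ^ (2 / q + α)) := by
    intro q hq
    obtain ⟨C, hC⟩ := hG.exists_J_le_of_homogeneous hκ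
      (fun r hr x => rieszColor_smul (α := α / 2) hr x) (p := q) (by linarith)
      (convLp_rieszColor_ne_top le_rfl (by push_cast; linarith) (hG.measurable 1 one_pos)
        (hG.lintegral_lt_top one_pos) hq (q := q) (r := 1) (by linarith) le_rfl (by ring)
        (by linarith) (lintegral_waveDensityOne_rpow_lt_top (by linarith)))
    refine ⟨C, fun t ht => (hC t ht).trans (le_of_eq ?_)⟩
    congr 3
    push_cast
    ring
  refine ⟨hJ p hp, fun ν hν hνp => ?_⟩
  have hp0 : 0 < p := by linarith
  obtain ⟨C₁, hC₁⟩ := hJ 2 le_rfl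
  obtain ⟨C₂, hC₂⟩ := hJ p hp
  have h2p : 0 < 2 / p := by positivity
  obtain ⟨C, hC⟩ := exists_solutionMomentBound_of_rpow.{u} hp hν hνp hκ hκf
    (fun t ht => hG.hasLocallyBoundedFourier ht)
    (Or.inl fun t ht => hG.evenDistribution ht) (by linarith) (by linarith) hC₁ hC₂
  refine ⟨C, hC.mono fun t ht => le_of_eq ?_⟩
  rw [mul_rpow_add_eq ht] <;> ring

/-- The density lies in `L^w` only for `w < 2`, and the singular part of the kernel in `L^r` only
for `1/r > 1 - α/4`. Young's relation `1/r + 1/w = 1 + 1/q` leaves room exactly when `q < 4 / (2 -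
α)`; `ε` is half of the slack. -/
theorem wave_rieszColor_two {α p : ℝ} (hα : 0 < α) (hα2 : α < 2) (hp : 2 ≤ p)
    (hpα : p < 4 / (2 - α)) :
    (∃ C : ℝ, ∀ t : ℝ, 0 < t →
      J (waveG 2) (rieszColor 2 (α / 2)) p t ≤ ENNReal.ofReal (C * t ^ (4 / p + α - 2))) ∧
    ∀ ν : Measure ℝ, IsJumpMeasure ν → moment ν p < ⊤ →
      ∃ C : ℝ, SolutionMomentBound.{u} ν (rieszColor 2 (α / 2)) (waveG 2) p
        (fun t => ENNReal.ofReal (C * t ^ (α / 2) * (t + t ^ (2 / p)))) := by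
  have hG := isSelfSimilar_waveG_two
  obtain ⟨hκ, hκf⟩ := isTempered_and_hasFourier_rieszColor (d := 2) one_le_two (α := α / 2)
    (by linarith) (by push_cast; linarith)
  have hJ : ∀ q : ℝ, 2 ≤ q → q ≤ p → ∃ C : ℝ, ∀ t : ℝ, 0 < t →
      J (waveG 2) (rieszColor 2 (α / 2)) q t ≤ ENNReal.ofReal (C * t ^ (4 / q + α - 2)) := by
    intro q hq hqp
    have hq0 : 0 < q := by linarith
    have hqα : q * (2 - α) < 4 := by
      rw [lt_div_iff₀ (by linarith)] at hpα
      nlinarith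
    have hq2 : 1 / q ≤ 1 / 2 := one_div_le_one_div_of_le two_pos hq
    -- the exponent `1 / w = 1 / 2 + ε` for the density, `1 / r = 1 / 2 + 1 / q - ε` for the kernel
    have hqi : (2 - α) / 4 < 1 / q := by
      rw [div_lt_div_iff₀ (by norm_num) hq0]
      linarith
    set ε : ℝ := (1 / q - (2 - α) / 4) / 2 with hε
    have hε0 : 0 < ε := by linarith
    have hε1 : ε < 1 / q := by linarith
    have hw0 : 0 < 1 / 2 + ε := by linarith
    have hr0 : 0 < 1 / 2 + 1 / q - ε := by linarith
    have hw2 : (1 / 2 + ε)⁻¹ < 2 := by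
      rw [inv_lt_comm₀ hw0 two_pos]
      linarith
    have hw1 : 1 ≤ (1 / 2 + ε)⁻¹ := (one_le_inv₀ hw0).2 (by linarith)
    have hr1 : 1 ≤ (1 / 2 + 1 / q - ε)⁻¹ := (one_le_inv₀ hr0).2 (by linarith)
    obtain ⟨C, hC⟩ := hG.exists_J_le_of_homogeneous hκ
      (fun r hr x => rieszColor_smul (α := α / 2) hr x) (p := q) (by linarith)
      (convLp_rieszColor_ne_top one_le_two (by push_cast; linarith) (hG.measurable 1 one_pos)
        (hG.lintegral_lt_top one_pos) hq hw1 hr1 (by simp only [one_div, inv_inv]; ring)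
        (by
          rw [← div_eq_mul_inv, div_lt_iff₀ hr0]
          push_cast
          linarith) (lintegral_waveDensityTwo_rpow_lt_top one_pos hw1 hw2))
    refine ⟨C, fun t ht => (hC t ht).trans (le_of_eq ?_)⟩
    congr 3
    push_cast
    ring
  refine ⟨hJ p hp le_rfl, fun ν hν hνp => ?_⟩
  have hp0 : 0 < p := by linarith
  obtain ⟨C₁, hC₁⟩ := hJ 2 le_rfl hp
  obtain ⟨C₂, hC₂⟩ := hJ p hp le_rfl
  have h4p : 0 < 4 / p := by positivity
  obtain ⟨C, hC⟩ := exists_solutionMomentBound_of_rpow.{u} hp hν hνp hκ hκf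
    (fun t ht => hG.hasLocallyBoundedFourier ht)
    (Or.inl fun t ht => hG.evenDistribution ht) (by linarith) (by linarith) hC₁ hC₂
  refine ⟨C, hC.mono fun t ht => le_of_eq ?_⟩
  rw [mul_rpow_add_eq (a := α / 2) (b := 1) (c := 2 / p) ht (by ring) (by ring), Real.rpow_one]

theorem wave_integrable_one {κ : Eu 1 → ℝ≥0∞} (hκ : IsTempered κ) (hκi : ∫⁻ x, κ x < ⊤)
    {p : ℝ} (hp : 2 ≤ p) :
    (∃ C : ℝ, ∀ t : ℝ, 0 < t → J (waveG 1) κ p t ≤ ENNReal.ofReal (C * t ^ (2 / p))) ∧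
    ∀ ν : Measure ℝ, IsJumpMeasure ν → moment ν p < ⊤ →
      ∃ C : ℝ, SolutionMomentBound.{u} ν κ (waveG 1) p
        (fun t => ENNReal.ofReal (C * t * (t ^ (1 / 2 : ℝ) + t ^ (1 / p)))) := by
  have hG := isSelfSimilar_waveG_one
  have hJ : ∀ q : ℝ, 2 ≤ q → ∃ C : ℝ, ∀ t : ℝ, 0 < t →
      J (waveG 1) κ q t ≤ ENNReal.ofReal (C * t ^ (2 / q)) := by
    intro q hq
    obtain ⟨C, hC⟩ := hG.exists_J_le_of_integrable hκ hκi.ne (p := q) (by linarith)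
      (lintegral_waveDensityOne_rpow_lt_top (by linarith)).ne
    refine ⟨C, fun t ht => (hC t ht).trans (le_of_eq ?_)⟩
    congr 3
    push_cast
    ring
  refine ⟨hJ p hp, fun ν hν hνp => ?_⟩
  have hp0 : 0 < p := by linarith
  obtain ⟨C₁, hC₁⟩ := hJ 2 le_rfl
  obtain ⟨C₂, hC₂⟩ := hJ p hp
  have h2p : 0 < 2 / p := by positivity
  obtain ⟨C, hC⟩ := exists_solutionMomentBound_of_rpow.{u} hp hν hνp hκ
    (exists_hasFourier_of_lintegral hκ.1 hκi) (fun t ht => hG.hasLocallyBoundedFourier ht)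
    (Or.inl fun t ht => hG.evenDistribution ht) (by norm_num) (by linarith) hC₁ hC₂
  refine ⟨C, hC.mono fun t ht => le_of_eq ?_⟩
  rw [mul_rpow_add_eq (a := 1) (b := 1 / 2) (c := 1 / p) ht (by ring) (by ring), Real.rpow_one]

end WaveEquation

end LevyColored

open LevyColored in
theorem mainTheorem6 :
    -- the moment inequality
    (∀ p : ℝ, 2 ≤ p → ∃ B : ℝ, 0 < B ∧
      ∀ (d : ℕ), 1 ≤ d → ∀ ν : Measure ℝ, IsJumpMeasure ν → moment ν p < ⊤ →
      ∀ κ : Eu d → ℝ≥0∞, AssumptionA1 κ →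
      ∀ G : ℝ → 𝓢'(Eu d, ℂ), HypothesisA G → HypothesisB κ G → HypothesisC κ G →
        SolutionMomentBound.{u} ν κ G p (fun t =>
          ENNReal.ofReal B * max (moment ν 2 ^ (1 / 2 : ℝ)) (moment ν p ^ (1 / p)) *
            ∫⁻ s in Ioc 0 t,
              (J G (reflectKernel κ) 2 s ^ (1 / 2 : ℝ) +
                J G (reflectKernel κ) p s ^ (1 / 2 : ℝ))) ∧
        (((∀ s : ℝ, 0 < s → EvenDistribution (G s)) ∨ (∀ᵐ x, κ (-x) = κ x)) →
          SolutionMomentBound.{u} ν κ G p (fun t =>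
            ENNReal.ofReal B * max (moment ν 2 ^ (1 / 2 : ℝ)) (moment ν p ^ (1 / p)) *
              ∫⁻ s in Ioc 0 t, (J G κ 2 s ^ (1 / 2 : ℝ) + J G κ p s ^ (1 / 2 : ℝ))))) ∧
    -- heat equation, heat kernel
    (∀ (d : ℕ), 1 ≤ d → ∀ α p : ℝ, 0 < α → 2 ≤ p →
      (∃ C : ℝ, ∀ t : ℝ, 0 < t →
        J (heatG d) (heatColor d (α / 2)) p t ≤
          ENNReal.ofReal (C * (t + α / 2) ^ (-(d : ℝ) / 2))) ∧
      ∀ ν : Measure ℝ, IsJumpMeasure ν → moment ν p < ⊤ →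
        ∃ C : ℝ, SolutionMomentBound.{u} ν (heatColor d (α / 2)) (heatG d) p
          (fun t => ENNReal.ofReal (C * t))) ∧
    -- heat equation, Riesz kernel
    (∀ (d : ℕ), 1 ≤ d → ∀ α p : ℝ, max ((d : ℝ) - 2) 0 < α → α < d → 2 ≤ p →
      (∃ C : ℝ, ∀ t : ℝ, 0 < t →
        J (heatG d) (rieszColor d (α / 2)) p t ≤
          ENNReal.ofReal (C * t ^ ((d : ℝ) * (1 / p + α / (2 * d) - 1)))) ∧
      ((p * (2 * d - α - 4) < 2 * d ∨ d ≤ 2 ∨ (d = 3 ∧ 2 ≤ α) ∨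
          (d = 3 ∧ α < 2 ∧ p < 6 / (2 - α)) ∨ (4 ≤ d ∧ p < 2 * d / (2 * d - α - 4))) →
        ∀ ν : Measure ℝ, IsJumpMeasure ν → moment ν p < ⊤ →
          ∃ C : ℝ, SolutionMomentBound.{u} ν (rieszColor d (α / 2)) (heatG d) p
            (fun t => ENNReal.ofReal (C * t ^ ((d : ℝ) / 2 * (α / (2 * d) - 1) + 1) *
              (t ^ ((d : ℝ) / 4) + t ^ ((d : ℝ) / (2 * p))))))) ∧
    -- heat equation, integrable kernel
    (∀ (d : ℕ), 1 ≤ d → ∀ κ : Eu d → ℝ≥0∞, AssumptionA1 κ → DalangCondition κ →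
      ∫⁻ x, κ x < ⊤ → ∀ p : ℝ, 2 ≤ p →
      (∃ C : ℝ, ∀ t : ℝ, 0 < t →
        J (heatG d) κ p t ≤ ENNReal.ofReal (C * t ^ ((d : ℝ) * (1 / p - 1)))) ∧
      ((p * ((d : ℝ) - 2) < d ∨ d ≤ 2 ∨ (d = 3 ∧ p < 3)) →
        ∀ ν : Measure ℝ, IsJumpMeasure ν → moment ν p < ⊤ →
          ∃ C : ℝ, SolutionMomentBound.{u} ν κ (heatG d) p
            (fun t => ENNReal.ofReal (C * t ^ (-(d : ℝ) / 2 + 1) *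
              (t ^ ((d : ℝ) / 4) + t ^ ((d : ℝ) / (2 * p))))))) ∧
    -- wave equation, heat kernel
    (∀ (d : ℕ), 1 ≤ d → ∀ α p : ℝ, 0 < α → 2 ≤ p →
      (∃ C : ℝ, ∀ t : ℝ, 0 < t →
        J (waveG d) (heatColor d (α / 2)) p t ≤ ENNReal.ofReal (C * t ^ 2)) ∧
      ∀ ν : Measure ℝ, IsJumpMeasure ν → moment ν p < ⊤ →
        ∃ C : ℝ, SolutionMomentBound.{u} ν (heatColor d (α / 2)) (waveG d) p
          (fun t => ENNReal.ofReal (C * t ^ 2))) ∧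
    -- wave equation, Riesz kernel, dimension one
    (∀ α p : ℝ, 0 < α → α < 1 → 2 ≤ p →
      (∃ C : ℝ, ∀ t : ℝ, 0 < t →
        J (waveG 1) (rieszColor 1 (α / 2)) p t ≤ ENNReal.ofReal (C * t ^ (2 / p + α))) ∧
      ∀ ν : Measure ℝ, IsJumpMeasure ν → moment ν p < ⊤ →
        ∃ C : ℝ, SolutionMomentBound.{u} ν (rieszColor 1 (α / 2)) (waveG 1) p
          (fun t => ENNReal.ofReal (C * t ^ (α / 2 + 1) *
            (t ^ (1 / 2 : ℝ) + t ^ (1 / p))))) ∧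
    -- wave equation, Riesz kernel, dimension two
    (∀ α p : ℝ, 0 < α → α < 2 → 2 ≤ p → p < 4 / (2 - α) →
      (∃ C : ℝ, ∀ t : ℝ, 0 < t →
        J (waveG 2) (rieszColor 2 (α / 2)) p t ≤ ENNReal.ofReal (C * t ^ (4 / p + α - 2))) ∧
      ∀ ν : Measure ℝ, IsJumpMeasure ν → moment ν p < ⊤ →
        ∃ C : ℝ, SolutionMomentBound.{u} ν (rieszColor 2 (α / 2)) (waveG 2) p
          (fun t => ENNReal.ofReal (C * t ^ (α / 2) * (t + t ^ (2 / p))))) ∧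
    -- wave equation, integrable kernel, dimension one
    (∀ κ : Eu 1 → ℝ≥0∞, AssumptionA1 κ → DalangCondition κ → ∫⁻ x, κ x < ⊤ →
      ∀ p : ℝ, 2 ≤ p →
      (∃ C : ℝ, ∀ t : ℝ, 0 < t →
        J (waveG 1) κ p t ≤ ENNReal.ofReal (C * t ^ (2 / p))) ∧
      ∀ ν : Measure ℝ, IsJumpMeasure ν → moment ν p < ⊤ →
        ∃ C : ℝ, SolutionMomentBound.{u} ν κ (waveG 1) p
          (fun t => ENNReal.ofReal (C * t * (t ^ (1 / 2 : ℝ) + t ^ (1 / p))))) := by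
  refine ⟨fun p hp => momentInequality hp,
    fun d _ α p hα hp => heat_heatColor d hα hp,
    fun d hd α p hα hαd hp => heat_rieszColor hd hα hαd hp,
    fun d _ κ hκ _ hκi p hp => heat_integrable d hκ.1 hκi hp,
    fun d _ α p hα hp => wave_heatColor d hα hp,
    fun α p hα hα1 hp => wave_rieszColor_one hα hα1 hp,
    fun α p hα hα2 hp hpα => wave_rieszColor_two hα hα2 hp hpα,
    fun κ hκ _ hκi p hp => wave_integrable_one hκ.1 hκi hp⟩
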